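/- Let $\nu\in(0,1)$. Let $\mathcal F_s^\nu$ be the space of functions equal to $c_1^-|x|^{\nu+\frac12}+c_2^-|x|^{-\nu+\frac12}$ on $(-1,0)$ and to $c_1^+|x|^{\nu+\frac12}+c_2^+|x|^{-\nu+\frac12}$ on $(0,1)$, with $c_1^\pm,c_2^\pm\in\mathbb R$. Let $A_\nu$ be the unbounded operator on the real space $L^2(-1,1)$ given by $$A_\nu f=-f''+\frac{\nu^2-\frac14}{x^2}f,$$ where $f''$ is the distributional second derivative on $(-1,0)\cup(0,1)$, whose domain consists of all $f=f_r+f_s$ with $f_r\in H^2(-1,1)$, $f_r(0)=f_r'(0)=0$, $f_s\in\mathcal F_s^\nu$, such that $f(-1)=f(1)=0$, $c_1^-+c_2^-+c_1^++c_2^+=0$ and $$\left(\nu+\tfrac12\right)c_1^-+\left(-\nu+\tfrac12\right)c_2^-=\left(\nu+\tfrac12\right)c_1^++\left(-\nu+\tfrac12\right)c_2^+ .$$ For real $\mu$ and $x>0$ let $J_\mu(x)=\sum_{k\ge0}\frac{(-1)^k}{k!\,\Gamma(k+\mu+1)}\left(\frac x2\right)^{2k+\mu}$ be the Bessel function of the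 first kind. For $\mu=\pm\nu$ the positive zeros of $J_\mu$ form a strictly increasing infinite sequence $0<j_{\mu,1}<j_{\mu,2}<\cdots$. A number $E>0$ is an eigenvalue of $A_\nu$ if and only if it satisfies $$J_\nu(\sqrt E)\left(\frac{\sqrt E}2\right)^{-2\nu}\frac{\Gamma(\nu+1)}{\Gamma(1-\nu)}=J_{-\nu}(\sqrt E)\qquad(+)$$ or $$J_\nu(\sqrt E)\left(\frac{\sqrt E}2\right)^{-2\nu}\frac{\Gamma(\nu+1)}{\Gamma(1-\nu)}\,\frac{1-2\nu}{1+2\nu}=J_{-\nu}(\sqrt E).\qquad(-)$$ **Even eigenvalues.** Put $\lambda_0=0$. - No $E\in(0,j_{-\nu,1}^2)$ satisfies $(+)$. - For every $n\ge1$, no $E\in[j_{-\nu,n}^2,j_{\nu,n}^2]$ satisfies $(+)$. - For every $n\ge1$ there is exactly one $E\in(j_{\nu,n}^2,j_{-\nu,n+1}^2)$ satisfying $(+)$; denote it by $\lambda_{2n}$. **Odd eigenvalues.** Case $\nu<\frac12$: - There is exactly one $E\in(0,j_{-\nu,1}^2)$ satisfying $(-)$; denote it by $\lambda_1$. - For every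 $n\ge1$, no $E\in[j_{-\nu,n}^2,j_{\nu,n}^2]$ satisfies $(-)$. - For every $n\ge1$ there is exactly one $E\in(j_{\nu,n}^2,j_{-\nu,n+1}^2)$ satisfying $(-)$; denote it by $\lambda_{2n+1}$. Case $\nu>\frac12$: - No $E\in(0,j_{-\nu,1}^2]$ satisfies $(-)$. - For every $n\ge1$ there is exactly one $E\in(j_{-\nu,n}^2,j_{\nu,n}^2)$ satisfying $(-)$; denote it by $\lambda_{2n-1}$. - For every $n\ge1$, no $E\in[j_{\nu,n}^2,j_{-\nu,n+1}^2]$ satisfies $(-)$. Case $\nu=\frac12$: - For every $n\ge1$, $E=j_{-\nu,n}^2$ satisfies $(-)$; denote it by $\lambda_{2n-1}$. - No other $E>0$ satisfies $(-)$. In all cases $0=\lambda_0<\lambda_1<\lambda_2<\cdots$, and $\{\lambda_n : n\ge0\}$ is the set of all eigenvalues of $A_\nu$. -/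

import Mathlib

open scoped ContDiff

noncomputable section

/-- Lebesgue measure on the interval `(-1, 1)`. -/
def intervalMeasure : MeasureTheory.Measure ℝ :=
  MeasureTheory.volume.restrict (Set.Ioo (-1 : ℝ) 1)

/-- Test functions on an open set `U`, that is, elements of `C_c^∞(U)`. -/
def IsTestFunction (U : Set ℝ) (φ : ℝ → ℝ) : Prop :=
  ContDiff ℝ ∞ φ ∧ HasCompactSupport φ ∧ tsupport φ ⊆ U

/-- `g` is the weak (distributional) derivative of `f` on the open set `U`
(used for functions that are integrable on `U`). -/
def HasWeakDerivOn (U : Set ℝ) (f g : ℝ → ℝ) : Prop :=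
  ∀ φ : ℝ → ℝ, IsTestFunction U φ →
    ∫ x in U, f x * deriv φ x = -∫ x in U, g x * φ x

/-- The space of `f ∈ H²(-1,1)` with `f(0) = f'(0) = 0`. Here `f` and its weak derivative `f₁`
are given by their representatives that are continuous on `[-1, 1]`, so that the point values
of `f` and `f'` make sense. -/
def IsRegularPart (f : ℝ → ℝ) : Prop :=
  ∃ f₁ f₂ : ℝ → ℝ,
    MeasureTheory.MemLp f 2 intervalMeasure ∧
    MeasureTheory.MemLp f₁ 2 intervalMeasure ∧
    MeasureTheory.MemLp f₂ 2 intervalMeasure ∧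
    HasWeakDerivOn (Set.Ioo (-1) 1) f f₁ ∧
    HasWeakDerivOn (Set.Ioo (-1) 1) f₁ f₂ ∧
    ContinuousOn f (Set.Icc (-1) 1) ∧
    ContinuousOn f₁ (Set.Icc (-1) 1) ∧
    f 0 = 0 ∧ f₁ 0 = 0

/-- The singular functions: `c₁⁻ |x|^(ν+1/2) + c₂⁻ |x|^(-ν+1/2)` on `x < 0`, and
`c₁⁺ |x|^(ν+1/2) + c₂⁺ |x|^(-ν+1/2)` on `x > 0`. (The value at `0` is irrelevant.) -/
def singularPart (ν c₁m c₂m c₁p c₂p : ℝ) (x : ℝ) : ℝ :=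
  if x < 0 then c₁m * |x| ^ (ν + 1 / 2) + c₂m * |x| ^ (-ν + 1 / 2)
  else c₁p * |x| ^ (ν + 1 / 2) + c₂p * |x| ^ (-ν + 1 / 2)

/-- The domain `D(A_ν) ⊆ L²(-1,1)`: sums of a regular and a singular part that satisfy the
Dirichlet conditions at `±1` and the two transmission conditions at `0`. -/
def operatorDomain (ν : ℝ) : Set (MeasureTheory.Lp ℝ 2 intervalMeasure) :=
  {f | ∃ (fr : ℝ → ℝ) (c₁m c₂m c₁p c₂p : ℝ),
    IsRegularPart fr ∧
    (∀ᵐ x ∂intervalMeasure, f x = fr x + singularPart ν c₁m c₂m c₁p c₂p x) ∧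
    fr (-1) + singularPart ν c₁m c₂m c₁p c₂p (-1) = 0 ∧
    fr 1 + singularPart ν c₁m c₂m c₁p c₂p 1 = 0 ∧
    c₁m + c₂m + c₁p + c₂p = 0 ∧
    (ν + 1 / 2) * c₁m + (-ν + 1 / 2) * c₂m = (ν + 1 / 2) * c₁p + (-ν + 1 / 2) * c₂p}

/-- `-f'' + (ν² - 1/4) / x² f = g`, with `f''` the distributional second derivative on
`(-1,0) ∪ (0,1)`. -/
def OperatorEq (ν : ℝ) (f g : MeasureTheory.Lp ℝ 2 intervalMeasure) : Prop :=
  ∀ φ : ℝ → ℝ, IsTestFunction (Set.Ioo (-1) 0 ∪ Set.Ioo 0 1) φ →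
    ∫ x, f x * (-iteratedDeriv 2 φ x + (ν ^ 2 - 1 / 4) / x ^ 2 * φ x) ∂intervalMeasure =
      ∫ x, g x * φ x ∂intervalMeasure

/-- `E` is an eigenvalue of the operator `A_ν = -d²/dx² + (ν² - 1/4) / x²` with domain
`operatorDomain ν`. -/
def IsEigenvalue (ν E : ℝ) : Prop :=
  ∃ f ∈ operatorDomain ν, f ≠ 0 ∧ OperatorEq ν f (E • f)

/-- The Bessel function of the first kind `J_μ(x)` for real order `μ` and `x > 0`.
(`Real.Gamma` vanishes at the non-positive integers, so `1 / Γ` is `0` there.) -/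
def besselJ (μ x : ℝ) : ℝ :=
  ∑' k : ℕ, (-1) ^ k / ((k.factorial : ℝ) * Real.Gamma (k + μ + 1)) * (x / 2) ^ (2 * k + μ)

/-- `besselZero μ n` is the `n`-th positive zero `j_{μ,n}` of `J_μ`, for `n ≥ 1`; the value
at `n = 0` is `0` by convention. -/
def besselZero (μ : ℝ) : ℕ → ℝ
  | 0 => 0
  | n + 1 => sInf {x | besselZero μ n < x ∧ besselJ μ x = 0}

/-- The first transcendental equation for the positive eigenvalues. -/
def CondPlus (ν E : ℝ) : Prop :=
  besselJ ν (√E) * (√E / 2) ^ (-2 * ν) * (Real.Gamma (ν + 1) / Real.Gamma (1 - ν)) =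
    besselJ (-ν) (√E)

/-- The second transcendental equation for the positive eigenvalues. -/
def CondMinus (ν E : ℝ) : Prop :=
  besselJ ν (√E) * (√E / 2) ^ (-2 * ν) * (Real.Gamma (ν + 1) / Real.Gamma (1 - ν)) *
      ((1 - 2 * ν) / (1 + 2 * ν)) =
    besselJ (-ν) (√E)

end

noncomputable section

/-! ### Power series with factorially decaying coefficients -/

/-! Write J_μ(x) = (x/2)^μ / Γ(μ+1) · P_μ(x²), where P_μ is entire, P_μ(0) = 1 and s P'' + (μ+1) P'
+ P/4 = 0. With P = P_ν and M = P_{-ν}, the two conditions become κ P(E) = M(E), with κ = 1 for (+)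
and κ = (1-2ν)/(1+2ν) for (-) (`condPlus_iff`, `condMinus_iff`). The equation in this form also
makes sense for E ≤ 0.

Spectral side. For every real E the functions x^(±ν+1/2) P_{±ν}(E x²) form a basis of solutions on
(0,1), and at E = 0 they are the pure powers of the singular part. Given an eigenfunction, subtract
on each side the solution with the same singular coefficients. What remains solves the equation,
vanishes to first order at 0 and has second derivative in L²; hence its Wronskians with both basic
solutions tend to 0 at the origin, are constant, and therefore vanish
(`eq_zero_of_regular_solution`). An eigenfunction is thus four coefficients subject to four linear
equations, and sums and differences across the origin decouple them into κ P = M for the two values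
of κ (`isEigenvalue_iff`). For E < 0 the power series give 0 < P < M, so neither condition holds.

Counting side. The Wronskian identity s (P' M - P M') = ν (1 - P M) governs everything. At positive
zeros of P or M it shows that the zeros are simple and fixes the sign of the derivative against the
other function, which makes the zeros interlace (`besselZero_sq_interlace`) and determines the sign
of P M on every gap. Elsewhere it says that the quotient q = P/M increases where P M < 1. If q ≥ 1
then P M ≤ P² < 1 by an energy estimate (`normBessel_sq_lt_one`), so q attains a value 1/κ ≥ 1 at
most once on an interval free of zeros of M. If κ < 0, only gaps with P M < 0 matter, and there q is
increasing outright. Existence is the intermediate value theorem for κ P - M. For 0 < κ < 1 the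
level 1 is reached before 1/κ, so each even eigenvalue precedes the odd one in the same gap. -/

theorem summable_of_abs_le_factorial {c : ℕ → ℝ} {M B : ℝ}
    (h : ∀ k, |c k| ≤ M * (B ^ k / k.factorial)) (s : ℝ) : Summable fun k => c k * s ^ k := by
  refine Summable.of_norm_bounded
    (((Real.summable_pow_div_factorial (B * |s|)).mul_left M)) fun k => ?_
  rw [Real.norm_eq_abs, abs_mul, abs_pow, mul_pow]
  calc |c k| * |s| ^ k ≤ M * (B ^ k / k.factorial) * |s| ^ k := by gcongr; exact h k
    _ = _ := by ring

/-- The factorial bound keeps its shape, with M replaced by M B, so termwise differentiation can be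
repeated. -/
theorem abs_succ_mul_le_factorial {c : ℕ → ℝ} {M B : ℝ}
    (h : ∀ k, |c k| ≤ M * (B ^ k / k.factorial)) (k : ℕ) :
    |(k + 1) * c (k + 1)| ≤ M * B * (B ^ k / k.factorial) := by
  rw [abs_mul, abs_of_pos (by positivity : (0 : ℝ) < k + 1)]
  calc ((k : ℝ) + 1) * |c (k + 1)| ≤ (k + 1) * (M * (B ^ (k + 1) / (k + 1).factorial)) := by
        gcongr; exact h _
    _ = _ := by
        rw [Nat.factorial_succ]; push_cast
        have : (k.factorial : ℝ) ≠ 0 := by positivity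
        field_simp
        ring

theorem hasDerivAt_tsum_mul_pow {c : ℕ → ℝ} {M B : ℝ}
    (h : ∀ k, |c k| ≤ M * (B ^ k / k.factorial)) (s : ℝ) :
    HasDerivAt (fun s => ∑' k, c k * s ^ k) (∑' k : ℕ, ((k + 1) * c (k + 1)) * s ^ k) s := by
  have h' := abs_succ_mul_le_factorial h
  set R := |s| + 1
  -- A summable majorant for the differentiated terms on the ball of radius |s| + 1, which contains
  -- both s and 0.
  set u : ℕ → ℝ := fun k => |c k * (k * R ^ (k - 1))| with hu
  have hsu : Summable u := by
    rw [← summable_nat_add_iff 1]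
    refine ((summable_of_abs_le_factorial h' R).abs).congr fun k => ?_
    simp only [hu, Nat.add_sub_cancel]
    congr 1; push_cast; ring
  have key := hasDerivAt_tsum_of_isPreconnected (𝕜 := ℝ) (g := fun k s => c k * s ^ k)
    (g' := fun k s => c k * (k * s ^ (k - 1))) (t := Metric.ball 0 R) (y₀ := s) (y := s) hsu
    Metric.isOpen_ball (convex_ball _ _).isPreconnected
    (fun n y _ => (hasDerivAt_pow n y).const_mul _) ?_ ?_ ?_ ?_
  · refine key.congr_deriv ?_
    have hs : Summable fun k : ℕ => c k * (k * s ^ (k - 1)) := by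
      rw [← summable_nat_add_iff 1]
      refine (summable_of_abs_le_factorial h' s).congr fun k => ?_
      simp only [Nat.add_sub_cancel]; push_cast; ring
    rw [hs.tsum_eq_zero_add]
    simp only [Nat.cast_zero, zero_mul, mul_zero, zero_add, Nat.add_sub_cancel]
    refine tsum_congr fun k => ?_
    push_cast; ring
  · intro n y hy
    simp only [hu, Real.norm_eq_abs, abs_mul, abs_pow]
    have hy' : |y| ≤ |R| := by
      rw [mem_ball_zero_iff, Real.norm_eq_abs] at hy
      exact hy.le.trans (le_abs_self _)
    gcongr _ * (_ * ?_ ^ _)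
  · simp [R]
  · exact summable_of_abs_le_factorial h s
  · simp [R]

/-! ### The normalized Bessel function -/

/-- The Taylor coefficients of `normBessel μ`. -/
def normBesselCoeff (μ : ℝ) (k : ℕ) : ℝ :=
  (-1 / 4) ^ k * (Real.Gamma (μ + 1) / (k.factorial * Real.Gamma (k + μ + 1)))

/-- The entire function `P` with `J_μ(x) = (x/2)^μ / Γ(μ+1) * P(x²)`. -/
def normBessel (μ s : ℝ) : ℝ := ∑' k : ℕ, normBesselCoeff μ k * s ^ k

section Coeff
variable {μ : ℝ} (hμ : -1 < μ)
include hμ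

theorem normBesselCoeff_zero : normBesselCoeff μ 0 = 1 := by
  have : Real.Gamma (μ + 1) ≠ 0 := (Real.Gamma_pos_of_pos (by linarith)).ne'
  simp [normBesselCoeff, this]

/-- Γ(z+1) = z Γ(z). This recursion is the differential equation read coefficientwise; it also
yields the growth bound and the comparison of orders ν and -ν. -/
theorem normBesselCoeff_succ (k : ℕ) :
    normBesselCoeff μ (k + 1) = -normBesselCoeff μ k / (4 * ((k + 1) * (k + 1 + μ))) := by
  have hk : (0 : ℝ) ≤ k := k.cast_nonneg
  have h0 : 0 < (k : ℝ) + μ + 1 := by linarith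
  have h1 : Real.Gamma (k + μ + 1) ≠ 0 := (Real.Gamma_pos_of_pos h0).ne'
  have h2 : (k : ℝ) + 1 + μ ≠ 0 := by linarith
  have h3 : Real.Gamma ((k + 1 : ℕ) + μ + 1) = (k + 1 + μ) * Real.Gamma (k + μ + 1) := by
    rw [show ((k + 1 : ℕ) : ℝ) + μ + 1 = (k + μ + 1) + 1 by push_cast; ring,
      Real.Gamma_add_one h0.ne']
    ring
  have h4 : (k.factorial : ℝ) ≠ 0 := by positivity
  have h5 : (k : ℝ) + 1 ≠ 0 := by positivity
  rw [normBesselCoeff, normBesselCoeff, h3, Nat.factorial_succ]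
  push_cast
  field_simp
  ring

/-- In the recursion k + 1 + μ ≥ 1 + μ > 0, so each step costs at most a factor 1 / (4 (1+μ) (k+1)).
-/
theorem abs_normBesselCoeff_le (k : ℕ) :
    |normBesselCoeff μ k| ≤ 1 * ((1 / (4 * (1 + μ))) ^ k / k.factorial) := by
  have h1 : 0 < 1 + μ := by linarith
  induction k with
  | zero => simp [normBesselCoeff_zero hμ]
  | succ k ih =>
    have hk : (0 : ℝ) ≤ k := k.cast_nonneg
    have h2 : 0 < (k : ℝ) + 1 + μ := by linarith
    rw [normBesselCoeff_succ hμ, abs_div, abs_neg,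
      abs_of_pos (by positivity : 0 < 4 * (((k : ℝ) + 1) * (k + 1 + μ)))]
    calc |normBesselCoeff μ k| / (4 * (((k : ℝ) + 1) * (k + 1 + μ)))
        ≤ (1 * ((1 / (4 * (1 + μ))) ^ k / k.factorial)) / (4 * (((k : ℝ) + 1) * (1 + μ))) := by
          gcongr; linarith
      _ = _ := by
          rw [Nat.factorial_succ]; push_cast
          have : (k.factorial : ℝ) ≠ 0 := by positivity
          rw [pow_succ]
          field_simp

theorem hasDerivAt_normBessel_tsum (s : ℝ) : HasDerivAt (normBessel μ)
    (∑' k : ℕ, ((k + 1) * normBesselCoeff μ (k + 1)) * s ^ k) s :=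
  hasDerivAt_tsum_mul_pow (abs_normBesselCoeff_le hμ) s

theorem deriv_normBessel : deriv (normBessel μ) =
    fun s => ∑' k : ℕ, ((k + 1) * normBesselCoeff μ (k + 1)) * s ^ k :=
  funext fun s => (hasDerivAt_normBessel_tsum hμ s).deriv

theorem hasDerivAt_normBessel (s : ℝ) :
    HasDerivAt (normBessel μ) (deriv (normBessel μ) s) s :=
  (hasDerivAt_normBessel_tsum hμ s).differentiableAt.hasDerivAt

theorem hasDerivAt_deriv_normBessel_tsum (s : ℝ) : HasDerivAt (deriv (normBessel μ))
    (∑' k : ℕ, ((k + 1) * (((k + 1 : ℕ) + 1) * normBesselCoeff μ (k + 1 + 1))) * s ^ k) s := by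
  rw [deriv_normBessel hμ]
  exact hasDerivAt_tsum_mul_pow (c := fun k : ℕ => (k + 1) * normBesselCoeff μ (k + 1))
    (abs_succ_mul_le_factorial (abs_normBesselCoeff_le hμ)) s

theorem hasDerivAt_deriv_normBessel (s : ℝ) :
    HasDerivAt (deriv (normBessel μ)) (deriv (deriv (normBessel μ)) s) s :=
  (hasDerivAt_deriv_normBessel_tsum hμ s).differentiableAt.hasDerivAt

theorem continuous_normBessel : Continuous (normBessel μ) :=
  continuous_iff_continuousAt.2 fun s => (hasDerivAt_normBessel hμ s).continuousAt

theorem continuous_deriv_normBessel : Continuous (deriv (normBessel μ)) :=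
  continuous_iff_continuousAt.2 fun s => (hasDerivAt_deriv_normBessel hμ s).continuousAt

theorem normBessel_zero : normBessel μ 0 = 1 := by
  rw [normBessel, tsum_eq_single 0 (by intro k hk; simp [hk])]
  simp [normBesselCoeff_zero hμ]

/-- The differential equation of `normBessel`. -/
theorem normBessel_ode (s : ℝ) :
    s * deriv (deriv (normBessel μ)) s + (μ + 1) * deriv (normBessel μ) s
      + normBessel μ s / 4 = 0 := by
  have b0 := abs_normBesselCoeff_le hμ
  have b1 := abs_succ_mul_le_factorial b0
  have b2 := abs_succ_mul_le_factorial (c := fun k : ℕ => (k + 1) * normBesselCoeff μ (k + 1)) b1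
  have s0 := summable_of_abs_le_factorial b0 s
  have s1 := summable_of_abs_le_factorial b1 s
  have s2 := summable_of_abs_le_factorial b2 s
  have s2' : Summable fun k : ℕ => (k * ((k + 1) * normBesselCoeff μ (k + 1))) * s ^ k := by
    rw [← summable_nat_add_iff 1]
    refine (s2.mul_left s).congr fun k => ?_
    push_cast; ring
  -- Multiplication by s undoes the index shift of the second differentiation; the k = 0 term
  -- vanishes.
  have e2 : s * deriv (deriv (normBessel μ)) s =
      ∑' k : ℕ, (k * ((k + 1) * normBesselCoeff μ (k + 1))) * s ^ k := by
    rw [(hasDerivAt_deriv_normBessel_tsum hμ s).deriv, ← tsum_mul_left, s2'.tsum_eq_zero_add]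
    simp only [Nat.cast_zero, zero_mul, zero_add]
    refine tsum_congr fun k => ?_
    push_cast; ring
  rw [e2, deriv_normBessel hμ, normBessel, ← tsum_mul_left, ← tsum_div_const,
    ← s2'.tsum_add (s1.mul_left _), ← (s2'.add (s1.mul_left _)).tsum_add (s0.div_const _)]
  convert tsum_zero with k
  have hk : (0 : ℝ) ≤ k := k.cast_nonneg
  have h2 : (k : ℝ) + 1 + μ ≠ 0 := by linarith
  have h5 : (k : ℝ) + 1 ≠ 0 := by positivity
  rw [normBesselCoeff_succ hμ]
  field_simp
  ring

/-- At the singular point s = 0 the equation loses its second-order term and determines P'(0). -/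
theorem deriv_normBessel_zero : deriv (normBessel μ) 0 = -1 / (4 * (μ + 1)) := by
  have h := normBessel_ode hμ 0
  rw [normBessel_zero hμ] at h
  have : μ + 1 ≠ 0 := by linarith
  field_simp
  linarith

theorem besselJ_eq {x : ℝ} (hx : 0 < x) :
    besselJ μ x = (x / 2) ^ μ / Real.Gamma (μ + 1) * normBessel μ (x ^ 2) := by
  have hG : Real.Gamma (μ + 1) ≠ 0 := (Real.Gamma_pos_of_pos (by linarith)).ne'
  rw [besselJ, normBessel, ← tsum_mul_left]
  refine tsum_congr fun k => ?_
  rw [Real.rpow_add (by positivity), normBesselCoeff,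
    show (2 * (k : ℝ)) = ((2 * k : ℕ) : ℝ) by push_cast; ring, Real.rpow_natCast, pow_mul,
    div_pow, div_pow, div_pow, ← pow_mul, ← pow_mul]
  have h4 : (k.factorial : ℝ) ≠ 0 := by positivity
  have hk : (0 : ℝ) ≤ k := k.cast_nonneg
  have h1 : Real.Gamma (k + μ + 1) ≠ 0 := (Real.Gamma_pos_of_pos (by linarith)).ne'
  field_simp
  norm_num [pow_mul]

theorem besselJ_eq_zero_iff {x : ℝ} (hx : 0 < x) :
    besselJ μ x = 0 ↔ normBessel μ (x ^ 2) = 0 := by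
  have hG : Real.Gamma (μ + 1) ≠ 0 := (Real.Gamma_pos_of_pos (by linarith)).ne'
  have : (x / 2) ^ μ ≠ 0 := (Real.rpow_pos_of_pos (by positivity) _).ne'
  rw [besselJ_eq hμ hx, mul_eq_zero]
  simp [hG, this]

end Coeff

/-- The energy P² + 4 s P'² equals 1 at s = 0 and, by the differential equation, has derivative -4
(2μ+1) P'² ≤ 0. -/
theorem normBessel_sq_lt_one {μ : ℝ} (hμ : -1 / 2 < μ) {s : ℝ} (hs : 0 < s) :
    normBessel μ s ^ 2 < 1 := by
  have hμ' : -1 < μ := by linarith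
  set P := normBessel μ
  set F : ℝ → ℝ := fun s => P s ^ 2 + 4 * s * deriv P s ^ 2 with hF
  have hd : ∀ s, HasDerivAt F (-(4 * (2 * μ + 1)) * deriv P s ^ 2) s := by
    intro s
    have h1 := hasDerivAt_normBessel hμ' s
    have h2 := hasDerivAt_deriv_normBessel hμ' s
    have h := (h1.pow 2).add (((hasDerivAt_id s).const_mul 4).mul (h2.pow 2))
    refine HasDerivAt.congr_deriv (f := F) h ?_
    have := normBessel_ode hμ' s
    simp only [Pi.pow_apply, id]
    norm_num
    linear_combination (8 * deriv (normBessel μ) s) * this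
  have hdF : deriv F = fun s => -(4 * (2 * μ + 1)) * deriv P s ^ 2 :=
    funext fun s => (hd s).deriv
  have hanti : Antitone F := by
    refine antitone_of_deriv_nonpos (fun s => (hd s).differentiableAt) fun s => ?_
    rw [hdF]
    have : 0 < 2 * μ + 1 := by linarith
    simp only [neg_mul, Left.neg_nonpos_iff]
    positivity
  have hF0 : F 0 = 1 := by simp [hF, P, normBessel_zero hμ']
  have hFs : F s < 1 := by
    -- For strictness: otherwise the energy is constant on [0, s], while its derivative at 0 is
    -- nonzero because P'(0) ≠ 0.
    by_contra! hge
    have hconst : ∀ t ∈ Set.Icc 0 s, F t = 1 := fun t ht =>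
      le_antisymm (hF0 ▸ hanti ht.1) (hge.trans (hanti ht.2))
    have hder : HasDerivWithinAt F 0 (Set.Icc 0 s) 0 :=
      (hasDerivWithinAt_const (0 : ℝ) (Set.Icc 0 s) (1 : ℝ)).congr hconst
        (hconst 0 ⟨le_rfl, hs.le⟩)
    have heq := (uniqueDiffOn_Icc hs 0 ⟨le_rfl, hs.le⟩).eq_deriv _
      (hd 0).hasDerivWithinAt hder
    rw [show deriv P 0 = _ from deriv_normBessel_zero hμ'] at heq
    have h1 : 0 < 2 * μ + 1 := by linarith
    have h2 : 0 < μ + 1 := by linarith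
    have : 0 < 4 * (2 * μ + 1) * (-1 / (4 * (μ + 1))) ^ 2 := by
      have : -1 / (4 * (μ + 1)) ≠ 0 := by
        refine div_ne_zero (by norm_num) (by positivity)
      positivity
    linarith
  have : 0 ≤ 4 * s * deriv P s ^ 2 := by positivity
  simp only [hF] at hFs
  linarith

/-- The Wronskian identity for `normBessel ν` and `normBessel (-ν)`. -/
theorem normBessel_wronskian {ν : ℝ} (h0 : -1 < ν) (h1 : ν < 1) (s : ℝ) :
    s * (deriv (normBessel ν) s * normBessel (-ν) s - normBessel ν s * deriv (normBessel (-ν)) s)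
      = ν * (1 - normBessel ν s * normBessel (-ν) s) := by
  have h0' : -1 < -ν := by linarith
  set P := normBessel ν
  set M := normBessel (-ν)
  -- F' is M times the equation of order ν minus P times that of order -ν, hence zero; and F(0) = ν.
  set F : ℝ → ℝ := fun s => s * (deriv P s * M s - P s * deriv M s) + ν * (P s * M s) with hF
  have hd : ∀ s, HasDerivAt F 0 s := by
    intro s
    have p1 := hasDerivAt_normBessel h0 s
    have p2 := hasDerivAt_deriv_normBessel h0 s
    have m1 := hasDerivAt_normBessel h0' s
    have m2 := hasDerivAt_deriv_normBessel h0' s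
    have h := ((hasDerivAt_id s).mul ((p2.mul m1).sub (p1.mul m2))).add
      ((p1.mul m1).const_mul ν)
    refine HasDerivAt.congr_deriv (f := F) h ?_
    have e1 := normBessel_ode h0 s
    have e2 := normBessel_ode h0' s
    simp only [Pi.mul_apply, Pi.sub_apply, id]
    linear_combination M s * e1 - P s * e2
  have hc : F s = F 0 := is_const_of_deriv_eq_zero (fun s => (hd s).differentiableAt)
    (fun s => (hd s).deriv) s 0
  have : F 0 = ν := by simp [hF, P, M, normBessel_zero h0, normBessel_zero h0']
  rw [this] at hc
  simp only [hF] at hc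
  linarith

/-- For s < 0 all terms of both series are positive, and the larger denominators k + 1 + ν make
those of order ν the smaller ones, strictly for k = 1. This rules out negative eigenvalues. -/
theorem normBessel_lt_of_neg {ν : ℝ} (hν0 : 0 < ν) (hν1 : ν < 1) {s : ℝ} (hs : s < 0) :
    0 < normBessel ν s ∧ normBessel ν s < normBessel (-ν) s := by
  have h0 : -1 < ν := by linarith
  have h0' : -1 < -ν := by linarith
  have key : ∀ k : ℕ, 0 < normBesselCoeff ν k * s ^ k ∧
      normBesselCoeff ν k * s ^ k ≤ normBesselCoeff (-ν) k * s ^ k := by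
    intro k
    induction k with
    | zero => simp [normBesselCoeff_zero h0, normBesselCoeff_zero h0']
    | succ k ih =>
      have hk : (0 : ℝ) ≤ k := k.cast_nonneg
      have a1 : 0 < (k : ℝ) + 1 + ν := by linarith
      have a2 : 0 < (k : ℝ) + 1 + -ν := by linarith
      have hs' : 0 < -s := by linarith
      rw [normBesselCoeff_succ h0, normBesselCoeff_succ h0',
        show -normBesselCoeff ν k / (4 * ((k + 1) * (k + 1 + ν))) * s ^ (k + 1) =
          (normBesselCoeff ν k * s ^ k) * (-s) / (4 * ((k + 1) * (k + 1 + ν))) by ring,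
        show -normBesselCoeff (-ν) k / (4 * ((k + 1) * (k + 1 + -ν))) * s ^ (k + 1) =
          (normBesselCoeff (-ν) k * s ^ k) * (-s) / (4 * ((k + 1) * (k + 1 + -ν))) by ring]
      obtain ⟨ih1, ih2⟩ := ih
      have ih3 := ih1.trans_le ih2
      refine ⟨by positivity, ?_⟩
      gcongr
      linarith
  have s0 := summable_of_abs_le_factorial (abs_normBesselCoeff_le h0) s
  have s0' := summable_of_abs_le_factorial (abs_normBesselCoeff_le h0') s
  refine ⟨s0.tsum_pos (fun k => (key k).1.le) 0 (key 0).1, ?_⟩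
  refine Summable.tsum_lt_tsum (i := 1) (fun k => (key k).2) ?_ s0 s0'
  rw [normBesselCoeff_succ h0, normBesselCoeff_succ h0', normBesselCoeff_zero h0,
    normBesselCoeff_zero h0']
  norm_num
  rw [← sub_pos]
  have a1 : 0 < 1 + ν := by linarith
  have a2 : 0 < 1 + -ν := by linarith
  have : -1 / (4 * (1 + -ν)) * s - -1 / (4 * (1 + ν)) * s
      = -s * (2 * ν) / (4 * (1 + -ν) * (1 + ν)) := by
    field_simp; ring
  rw [this]
  have : 0 < -s := by linarith
  positivity

/-! ### Sign and monotonicity criteria for real functions -/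

open Filter Topology in
/-- Near a point with positive derivative the difference quotients are positive. -/
theorem HasDerivAt.eventually_mul_sub_pos {f : ℝ → ℝ} {f' x : ℝ} (h : HasDerivAt f f' x)
    (hf' : 0 < f') : ∀ᶠ y in 𝓝[≠] x, 0 < (f y - f x) * (y - x) := by
  have h1 := (hasDerivAt_iff_tendsto_slope.1 h).eventually (lt_mem_nhds hf')
  filter_upwards [h1, self_mem_nhdsWithin] with y hy hne
  have hne' : y - x ≠ 0 := sub_ne_zero.2 hne
  rw [slope_def_field] at hy
  have : 0 < (y - x) ^ 2 := by positivity
  calc 0 < (f y - f x) / (y - x) * (y - x) ^ 2 := by positivity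
    _ = _ := by field_simp

theorem exists_gt_of_hasDerivAt_pos_right {f : ℝ → ℝ} {f' x y : ℝ} (h : HasDerivAt f f' x)
    (hf' : 0 < f') (hxy : x < y) : ∃ z ∈ Set.Ioo x y, f x < f z := by
  have h1 := (h.eventually_mul_sub_pos hf').filter_mono (nhdsGT_le_nhdsNE x)
  obtain ⟨z, hz, hz'⟩ := (h1.and (Ioo_mem_nhdsGT hxy)).exists
  exact ⟨z, hz', by nlinarith [hz'.1]⟩

theorem exists_lt_of_hasDerivAt_pos_left {f : ℝ → ℝ} {f' x y : ℝ} (h : HasDerivAt f f' y)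
    (hf' : 0 < f') (hxy : x < y) : ∃ z ∈ Set.Ioo x y, f z < f y := by
  have h1 := (h.eventually_mul_sub_pos hf').filter_mono (nhdsLT_le_nhdsNE y)
  obtain ⟨z, hz, hz'⟩ := (h1.and (Ioo_mem_nhdsLT hxy)).exists
  exact ⟨z, hz', by nlinarith [hz'.2]⟩

theorem mul_pos_of_forall_ne_zero {f : ℝ → ℝ} {S : Set ℝ} (hS : S.OrdConnected)
    (hf : ContinuousOn f S) (h0 : ∀ z ∈ S, f z ≠ 0) {x y : ℝ} (hx : x ∈ S) (hy : y ∈ S) :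
    0 < f x * f y := by
  by_contra! hle
  have hpre := hS.isPreconnected
  have : (0 : ℝ) ∈ f '' S := by
    rcases mul_nonpos_iff.1 hle with ⟨h1, h2⟩ | ⟨h1, h2⟩
    · exact hpre.intermediate_value hy hx hf ⟨h2, h1⟩
    · exact hpre.intermediate_value hx hy hf ⟨h1, h2⟩
  obtain ⟨z, hz, hz0⟩ := this
  exact h0 z hz hz0

theorem exists_zero_Ioo_of_mul_neg {f : ℝ → ℝ} {x y : ℝ} (hxy : x < y)
    (hf : ContinuousOn f (Set.Icc x y)) (h : f x * f y < 0) : ∃ z ∈ Set.Ioo x y, f z = 0 := by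
  by_contra! hne
  have hx : f x ≠ 0 := by rintro h0; simp [h0] at h
  have hy : f y ≠ 0 := by rintro h0; simp [h0] at h
  refine h.not_gt (mul_pos_of_forall_ne_zero Set.ordConnected_Icc hf ?_
    (Set.left_mem_Icc.2 hxy.le) (Set.right_mem_Icc.2 hxy.le))
  intro z hz
  rcases eq_or_lt_of_le hz.1 with rfl | h1
  · exact hx
  rcases eq_or_lt_of_le hz.2 with rfl | h2
  · exact hy
  exact hne z ⟨h1, h2⟩

/-- A function which has positive derivative wherever it is at least `q x` exceeds `q x`
to the right of `x`. -/
theorem lt_of_deriv_pos_of_le {q q' : ℝ → ℝ} {x y : ℝ} (hxy : x < y)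
    (hd : ∀ z ∈ Set.Icc x y, HasDerivAt q (q' z) z)
    (hpos : ∀ z ∈ Set.Icc x y, q x ≤ q z → 0 < q' z) : q x < q y := by
  have hc : ContinuousOn q (Set.Icc x y) := fun z hz => (hd z hz).continuousAt.continuousWithinAt
  obtain ⟨m, hm, hmax⟩ := isCompact_Icc.exists_isMaxOn (Set.nonempty_Icc.2 hxy.le) hc
  -- A maximum over [x, y] can only sit at y: its value is at least q x, so the derivative there is
  -- positive.
  have key : ∀ z ∈ Set.Icc x y, q m ≤ q z → z = y := by
    intro z hz hzm
    by_contra hne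
    have hzy : z < y := lt_of_le_of_ne hz.2 hne
    have hxm : q x ≤ q m := hmax (Set.left_mem_Icc.2 hxy.le)
    obtain ⟨w, hw, hlt⟩ := exists_gt_of_hasDerivAt_pos_right (hd z hz)
      (hpos z hz (hxm.trans hzm)) hzy
    exact absurd (hmax (⟨hz.1.trans hw.1.le, hw.2.le⟩ : w ∈ Set.Icc x y)) (by simpa using by linarith)
  have hmy := key m hm le_rfl
  by_contra! hle
  exact hxy.ne (key x (Set.left_mem_Icc.2 hxy.le) (hmy ▸ hle))

/-! ### Enumeration of discrete unbounded zero sets -/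

open Filter Topology in
-- Isolation on the right makes each infimum a minimum. Isolation on the left prevents the sequence
-- from converging, so no zero can be skipped. Right isolation is required at 0 as well, because the
-- enumeration starts at `a 0 = 0`, which need not be a zero.
theorem strictMono_and_image_eq_zeros {g : ℝ → ℝ} {a : ℕ → ℝ} (h0 : a 0 = 0)
    (hs : ∀ n, a (n + 1) = sInf {x | a n < x ∧ g x = 0}) (hc : ContinuousOn g (Set.Ioi 0))
    (hr : ∀ x, 0 ≤ x → ∀ᶠ y in 𝓝[>] x, g y ≠ 0) (hl : ∀ x, 0 < x → ∀ᶠ y in 𝓝[<] x, g y ≠ 0)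
    (hu : ∀ b, ∃ x, b < x ∧ g x = 0) :
    StrictMono a ∧ a '' Set.Ici 1 = {x | 0 < x ∧ g x = 0} := by
  have closed : ∀ x, 0 < x → (∃ᶠ y in 𝓝 x, g y = 0) → g x = 0 := by
    intro x hx hf
    by_contra hne
    have := (hc.continuousAt (Ioi_mem_nhds hx)).eventually_ne hne
    exact hf (this.mono fun y hy => hy)
  have step : ∀ n, 0 ≤ a n → a n < a (n + 1) ∧ g (a (n + 1)) = 0 := by
    intro n hn
    set S := {x | a n < x ∧ g x = 0} with hS
    have hne : S.Nonempty := hu (a n)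
    have hbdd : BddBelow S := ⟨a n, fun x hx => hx.1.le⟩
    have hglb : IsGLB S (a (n + 1)) := hs n ▸ isGLB_csInf hne hbdd
    have hge : a n ≤ a (n + 1) := hglb.2 fun x hx => hx.1.le
    by_cases hmem : a (n + 1) ∈ S
    · exact hmem
    have hfr : ∃ᶠ y in 𝓝[>] a (n + 1), g y = 0 := by
      have h := hglb.frequently_mem hne
      rw [frequently_nhdsWithin_iff] at h ⊢
      refine h.mono fun y hy => ⟨hy.1.2, Set.mem_Ioi.2 (lt_of_le_of_ne (Set.mem_Ici.1 hy.2) ?_)⟩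
      rintro rfl
      exact hmem hy.1
    exact absurd hfr (not_frequently.2 (hr _ (hn.trans hge)))
  have hnn : ∀ n, 0 ≤ a n := by
    intro n
    induction n with
    | zero => exact h0.ge
    | succ n ih => exact ih.trans (step n ih).1.le
  have hmono : StrictMono a := strictMono_nat_of_lt_succ fun n => (step n (hnn n)).1
  refine ⟨hmono, Set.Subset.antisymm ?_ ?_⟩
  · rintro _ ⟨n, hn, rfl⟩
    obtain ⟨m, rfl⟩ := Nat.exists_eq_add_of_le' (show 1 ≤ n from hn)
    exact ⟨(hnn m).trans_lt (step m (hnn m)).1, (step m (hnn m)).2⟩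
  · rintro z ⟨hz0, hz⟩
    by_contra hni
    have hlt : ∀ n, a n < z := by
      intro n
      induction n with
      | zero => rwa [h0]
      | succ n ih =>
        refine lt_of_le_of_ne ?_ fun h => hni ⟨n + 1, by simp, h⟩
        rw [hs]
        exact csInf_le ⟨a n, fun x hx => hx.1.le⟩ ⟨ih, hz⟩
    -- A missed zero z bounds the whole sequence, whose limit is then approached by zeros from the
    -- left.
    have hb : BddAbove (Set.range a) := ⟨z, by rintro _ ⟨n, rfl⟩; exact (hlt n).le⟩
    have ht := tendsto_atTop_ciSup hmono.monotone hb
    set L := ⨆ n, a n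
    have haL : ∀ n, a n < L := fun n => (hmono n.lt_succ_self).trans_le (le_ciSup hb (n + 1))
    have hL : 0 < L := h0 ▸ haL 0
    have ht' : Tendsto (fun n => a (n + 1)) atTop (𝓝[<] L) :=
      tendsto_nhdsWithin_iff.2
        ⟨(tendsto_add_atTop_iff_nat 1).2 ht, Eventually.of_forall fun n => haL _⟩
    obtain ⟨n, hn⟩ := (ht'.eventually (hl L hL)).exists
    exact hn (step n (hnn n)).2

/-! ### Solutions of the Bessel equation in Liouville normal form -/

/-- The solution `x^(μ+1/2) P_μ(E x²)` of `-y'' + (μ² - 1/4) / x² y = E y`. -/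
def besselSol (μ E x : ℝ) : ℝ := x ^ (μ + 1 / 2) * normBessel μ (E * x ^ 2)

/-- The derivative of `besselSol μ E`. -/
def besselSolDeriv (μ E x : ℝ) : ℝ :=
  x ^ (μ - 1 / 2) * ((μ + 1 / 2) * normBessel μ (E * x ^ 2)
    + 2 * E * x ^ 2 * deriv (normBessel μ) (E * x ^ 2))

theorem rpow_add_half_eq {μ x : ℝ} (hx : 0 < x) : x ^ (μ + 1 / 2) = x * x ^ (μ - 1 / 2) := by
  rw [show μ + 1 / 2 = 1 + (μ - 1 / 2) by ring, Real.rpow_add hx, Real.rpow_one]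

theorem hasDerivAt_const_mul_sq (E x : ℝ) : HasDerivAt (fun x => E * x ^ 2) (2 * E * x) x := by
  refine ((hasDerivAt_pow 2 x).const_mul E).congr_deriv ?_
  norm_num; ring

section
variable {μ : ℝ} (hμ : -1 < μ) (E : ℝ) {x : ℝ} (hx : 0 < x)
include hμ hx

theorem hasDerivAt_besselSol : HasDerivAt (besselSol μ E) (besselSolDeriv μ E x) x := by
  have h1 := Real.hasDerivAt_rpow_const (p := μ + 1 / 2) (Or.inl hx.ne')
  have h2 := (hasDerivAt_normBessel hμ (E * x ^ 2)).comp x (hasDerivAt_const_mul_sq E x)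
  refine (h1.mul h2).congr_deriv ?_
  rw [besselSolDeriv, show μ + 1 / 2 - 1 = μ - 1 / 2 by ring, rpow_add_half_eq hx]
  simp only [Function.comp]
  ring

theorem hasDerivAt_besselSolDeriv : HasDerivAt (besselSolDeriv μ E)
    (((μ ^ 2 - 1 / 4) / x ^ 2 - E) * besselSol μ E x) x := by
  have h1 := Real.hasDerivAt_rpow_const (p := μ - 1 / 2) (Or.inl hx.ne')
  have hs := hasDerivAt_const_mul_sq E x
  have h2 := (hasDerivAt_normBessel hμ (E * x ^ 2)).comp x hs
  have h3 := (hasDerivAt_deriv_normBessel hμ (E * x ^ 2)).comp x hs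
  have h4 := hasDerivAt_const_mul_sq (2 * E) x
  refine (h1.mul ((h2.const_mul (μ + 1 / 2)).add (h4.mul h3))).congr_deriv ?_
  have hode := normBessel_ode hμ (E * x ^ 2)
  have e1 : x ^ (μ - 1 / 2) = x * x ^ (μ - 1 / 2 - 1) := by
    rw [show μ - 1 / 2 = 1 + (μ - 1 / 2 - 1) by ring, Real.rpow_add hx, Real.rpow_one]
    ring_nf
  rw [besselSol, rpow_add_half_eq hx]
  simp only [Function.comp, Pi.add_apply, Pi.mul_apply]
  rw [e1]
  field_simp
  linear_combination (64 * E * x ^ 2) * hode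

end

/-- `normBessel μ` has arbitrarily large zeros. -/
theorem exists_normBessel_eq_zero {μ : ℝ} (h0 : -1 < μ) (h1 : μ < 1) (b : ℝ) :
    ∃ s, b < s ∧ normBessel μ s = 0 := by
  by_contra! hne
  -- Sturm comparison of the solution at energy 1 with sin((x - a)/2), which solves y'' = -y/4. For
  -- x ≥ 2 the potential is at most 3/4, so the solution oscillates at least as fast; x ≥ |b| + 2
  -- also gives x² > b.
  set a : ℝ := |b| + 2 with ha
  have ha2 : 2 ≤ a := by have := abs_nonneg b; linarith
  have hb : ∀ x, a ≤ x → b < x ^ 2 := by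
    intro x hx
    have := le_abs_self b
    have := abs_nonneg b
    nlinarith
  set S := Set.Icc a (a + 2 * Real.pi)
  have hpi := Real.pi_pos
  have hX0 : ∀ x ∈ S, besselSol μ 1 x ≠ 0 := by
    intro x hx
    have hx0 : 0 < x := by linarith [hx.1]
    refine mul_ne_zero (Real.rpow_pos_of_pos hx0 _).ne' (hne _ ?_)
    rw [one_mul]
    exact hb x hx.1
  have hXc : ContinuousOn (besselSol μ 1) S := fun x hx =>
    (hasDerivAt_besselSol h0 1 (by linarith [hx.1])).continuousAt.continuousWithinAt
  have haS : a ∈ S := ⟨le_rfl, by linarith⟩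
  have haS' : a + 2 * Real.pi ∈ S := ⟨by linarith, le_rfl⟩
  set c := besselSol μ 1 a
  have hpos : ∀ x ∈ S, 0 < c * besselSol μ 1 x := fun x hx =>
    mul_pos_of_forall_ne_zero Set.ordConnected_Icc hXc hX0 haS hx
  -- The Wronskian with the sine, multiplied by c to normalise the sign. Without zeros it would be
  -- nonincreasing, yet it is negative at a and positive at a + 2π.
  set F : ℝ → ℝ := fun x => c * (besselSolDeriv μ 1 x * Real.sin ((x - a) / 2)
    - besselSol μ 1 x * (Real.cos ((x - a) / 2) / 2)) with hF
  have hFd : ∀ x ∈ S, HasDerivAt F (-(3 / 4 - (μ ^ 2 - 1 / 4) / x ^ 2)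
      * (c * besselSol μ 1 x) * Real.sin ((x - a) / 2)) x := by
    intro x hx
    have hx0 : 0 < x := by linarith [hx.1]
    have hlin : HasDerivAt (fun x : ℝ => (x - a) / 2) (1 / 2) x :=
      ((hasDerivAt_id x).sub_const a).div_const 2
    have d1 := hasDerivAt_besselSol h0 1 hx0
    have d2 := hasDerivAt_besselSolDeriv h0 1 hx0
    refine (((d2.mul hlin.sin).sub (d1.mul (hlin.cos.div_const 2))).const_mul c).congr_deriv ?_
    ring
  have hanti : AntitoneOn F S := by
    refine antitoneOn_of_deriv_nonpos (convex_Icc _ _)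
      (fun x hx => (hFd x hx).continuousAt.continuousWithinAt)
      (fun x hx => (hFd x (interior_subset hx)).differentiableAt.differentiableWithinAt) ?_
    intro x hx
    replace hx := interior_subset hx
    rw [(hFd x hx).deriv]
    have hx2 : 2 ≤ x := by linarith [hx.1]
    have hq : (μ ^ 2 - 1 / 4) / x ^ 2 ≤ 3 / 4 := by
      rw [div_le_iff₀ (by positivity)]
      nlinarith
    have hsin : 0 ≤ Real.sin ((x - a) / 2) :=
      Real.sin_nonneg_of_nonneg_of_le_pi (by linarith [hx.1]) (by linarith [hx.2])
    have := mul_nonneg (mul_nonneg (sub_nonneg.2 hq) (hpos x hx).le) hsin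
    linarith
  have hle := hanti haS haS' (by linarith)
  have hFa : F a = -(c * besselSol μ 1 a) / 2 := by simp [hF]; ring
  have hFb : F (a + 2 * Real.pi) = c * besselSol μ 1 (a + 2 * Real.pi) / 2 := by
    simp only [hF]
    rw [show (a + 2 * Real.pi - a) / 2 = Real.pi by ring, Real.sin_pi, Real.cos_pi]
    ring
  have := hpos a haS
  have := hpos _ haS'
  linarith

/-- The Wronskian identity at a zero. For μ ≠ 0 it shows that the zero is simple and not shared with
order -μ, and for s > 0 it fixes the sign of the derivative against `normBessel (-μ)`. -/
theorem normBessel_zero_simple {μ : ℝ} (h0 : -1 < μ) (h1 : μ < 1) {s : ℝ}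
    (hs : normBessel μ s = 0) : s * (deriv (normBessel μ) s * normBessel (-μ) s) = μ := by
  have := normBessel_wronskian h0 h1 s
  rw [hs] at this
  linarith

open Filter Topology in
theorem eventually_normBessel_ne_zero {μ : ℝ} (h0 : -1 < μ) (h1 : μ < 1) (hμ : μ ≠ 0) (s : ℝ) :
    ∀ᶠ t in 𝓝[≠] s, normBessel μ t ≠ 0 := by
  by_cases hs : normBessel μ s = 0
  · refine (hasDerivAt_normBessel h0 s).eventually_ne fun hd => hμ ?_
    rw [← normBessel_zero_simple h0 h1 hs, hd]
    ring
  · exact ((continuous_normBessel h0).continuousAt.eventually_ne hs).filter_mono nhdsWithin_le_nhds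

open Filter Topology in
theorem besselZero_strictMono_and_image {μ : ℝ} (h0 : -1 < μ) (h1 : μ < 1) (hμ : μ ≠ 0) :
    StrictMono (besselZero μ) ∧
      besselZero μ '' Set.Ici 1 = {x : ℝ | 0 < x ∧ besselJ μ x = 0} := by
  have key : ∀ x, 0 ≤ x → ∀ᶠ y in 𝓝[≠] x, 0 < y → besselJ μ y ≠ 0 := by
    intro x hx
    have ht : Tendsto (fun y : ℝ => y ^ 2) (𝓝 x) (𝓝 (x ^ 2)) := (continuous_pow 2).tendsto x
    have h := eventually_nhdsWithin_iff.1 (eventually_normBessel_ne_zero h0 h1 hμ (x ^ 2))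
    refine eventually_nhdsWithin_iff.2 ((ht.eventually h).mono fun y hy hne hy0 => ?_)
    rw [Ne, besselJ_eq_zero_iff h0 hy0]
    refine hy fun heq => hne ?_
    exact (pow_left_inj₀ hy0.le hx two_ne_zero).1 heq
  refine strictMono_and_image_eq_zeros rfl (fun n => rfl) ?_ ?_ ?_ ?_
  · refine ContinuousOn.congr (f := fun x => (x / 2) ^ μ / Real.Gamma (μ + 1)
      * normBessel μ (x ^ 2)) ?_ fun x hx => besselJ_eq h0 hx
    refine ContinuousOn.mul (ContinuousOn.div_const (ContinuousOn.rpow_const (by fun_prop) ?_) _)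
      ((continuous_normBessel h0).comp (continuous_pow 2)).continuousOn
    intro x hx
    exact Or.inl (half_pos (Set.mem_Ioi.1 hx)).ne'
  · intro x hx
    filter_upwards [(key x hx).filter_mono (nhdsGT_le_nhdsNE x), self_mem_nhdsWithin] with y hy hxy
    exact hy (hx.trans_lt hxy)
  · intro x hx
    filter_upwards [(key x hx.le).filter_mono (nhdsLT_le_nhdsNE x), Ioo_mem_nhdsLT hx] with y hy hxy
    exact hy hxy.1
  · intro b
    obtain ⟨s, hs, hs0⟩ := exists_normBessel_eq_zero h0 h1 (b ^ 2)
    have hs' : 0 < s := (sq_nonneg b).trans_lt hs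
    refine ⟨√s, ?_, ?_⟩
    · exact Real.lt_sqrt_of_sq_lt hs
    · rwa [besselJ_eq_zero_iff h0 (Real.sqrt_pos.2 hs'), Real.sq_sqrt hs'.le]

/-- Squares of Bessel zeros enumerate the positive zeros of `normBessel`. -/
theorem besselZero_sq_spec {μ : ℝ} (h0 : -1 < μ) (h1 : μ < 1) (hμ : μ ≠ 0) :
    StrictMono (fun n => besselZero μ n ^ 2) ∧
    (∀ n, 1 ≤ n → normBessel μ (besselZero μ n ^ 2) = 0) ∧
    ∀ s, 0 < s → normBessel μ s = 0 → ∃ n, 1 ≤ n ∧ besselZero μ n ^ 2 = s := by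
  obtain ⟨hm, him⟩ := besselZero_strictMono_and_image h0 h1 hμ
  have hnn : ∀ n, 0 ≤ besselZero μ n := fun n => hm.monotone (Nat.zero_le n)
  refine ⟨fun m n hmn => pow_lt_pow_left₀ (hm hmn) (hnn m) two_ne_zero, ?_, ?_⟩
  · intro n hn
    have : besselZero μ n ∈ {x : ℝ | 0 < x ∧ besselJ μ x = 0} := him ▸ ⟨n, hn, rfl⟩
    exact (besselJ_eq_zero_iff h0 this.1).1 this.2
  · intro s hs hz
    have : √s ∈ besselZero μ '' Set.Ici 1 := by
      rw [him]
      refine ⟨Real.sqrt_pos.2 hs, ?_⟩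
      rwa [besselJ_eq_zero_iff h0 (Real.sqrt_pos.2 hs), Real.sq_sqrt hs.le]
    obtain ⟨n, hn, hns⟩ := this
    exact ⟨n, hn, by rw [hns, Real.sq_sqrt hs.le]⟩

/-! ### Interlacing of zeros -/

/-- If `f' g > 0` at two consecutive zeros of `f`, then `g` has a zero in between. -/
theorem exists_zero_Ioo_of_consecutive_zeros {f f' g : ℝ → ℝ} {x y : ℝ} (hxy : x < y)
    (hf : ∀ z, HasDerivAt f (f' z) z) (hg : Continuous g) (hx : f x = 0) (hy : f y = 0)
    (hne : ∀ z ∈ Set.Ioo x y, f z ≠ 0) (hx' : 0 < f' x * g x) (hy' : 0 < f' y * g y) :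
    ∃ z ∈ Set.Ioo x y, g z = 0 := by
  have hfc : Continuous f := continuous_iff_continuousAt.2 fun z => (hf z).continuousAt
  have hgx : g x ≠ 0 := fun h => by simp [h] at hx'
  have hgy : g y ≠ 0 := fun h => by simp [h] at hy'
  have hGx : HasDerivAt (fun z => f z * g x) (f' x * g x) x := (hf x).mul_const _
  have hGy : HasDerivAt (fun z => f z * g y) (f' y * g y) y := (hf y).mul_const _
  obtain ⟨u, hu, hu'⟩ := exists_gt_of_hasDerivAt_pos_right hGx hx' hxy
  obtain ⟨v, hv, hv'⟩ := exists_lt_of_hasDerivAt_pos_left hGy hy' hxy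
  simp only [hx, hy, zero_mul] at hu' hv'
  -- f has one sign in between, but f · g x is positive just after x and f · g y negative just
  -- before y; hence g x and g y have opposite signs.
  have huv := mul_pos_of_forall_ne_zero Set.ordConnected_Ioo hfc.continuousOn hne hu hv
  refine exists_zero_Ioo_of_mul_neg hxy hg.continuousOn ?_
  have h1 : (f u * g x) * (f v * g y) < 0 := mul_neg_of_pos_of_neg hu' hv'
  by_contra! hle
  have : 0 ≤ (f u * f v) * (g x * g y) := mul_nonneg huv.le hle
  linarith

section
variable {ν : ℝ} (hν0 : 0 < ν) (hν1 : ν < 1)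
include hν0 hν1

theorem normBessel_deriv_mul_pos {s : ℝ} (hs : 0 < s) (h : normBessel ν s = 0) :
    0 < deriv (normBessel ν) s * normBessel (-ν) s := by
  have := normBessel_zero_simple (by linarith) hν1 h
  by_contra! hle
  nlinarith

theorem normBessel_neg_deriv_mul_pos {s : ℝ} (hs : 0 < s) (h : normBessel (-ν) s = 0) :
    0 < deriv (normBessel (-ν)) s * -normBessel ν s := by
  have := normBessel_zero_simple (by linarith : -1 < -ν) (by linarith) h
  rw [neg_neg] at this
  by_contra! hle
  nlinarith

theorem normBessel_neg_ne_zero {s : ℝ} (h : normBessel ν s = 0) : normBessel (-ν) s ≠ 0 := by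
  intro h'
  have := normBessel_zero_simple (by linarith) hν1 h
  rw [h'] at this
  linarith

theorem besselZero_sq_pos {n : ℕ} (hn : 1 ≤ n) :
    0 < besselZero ν n ^ 2 ∧ 0 < besselZero (-ν) n ^ 2 := by
  have h1 := (besselZero_sq_spec (by linarith) hν1 hν0.ne').1 (Nat.zero_lt_of_lt hn)
  have h2 := (besselZero_sq_spec (μ := -ν) (by linarith) (by linarith) (by linarith)).1
    (Nat.zero_lt_of_lt hn)
  exact ⟨(sq_nonneg _).trans_lt h1, (sq_nonneg _).trans_lt h2⟩

theorem normBessel_ne_zero_of_between {μ : ℝ} (hμ : μ = ν ∨ μ = -ν) {n : ℕ} {s : ℝ}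
    (h1 : besselZero μ n ^ 2 < s) (h2 : s < besselZero μ (n + 1) ^ 2) : normBessel μ s ≠ 0 := by
  intro h
  have hspec : StrictMono (fun n => besselZero μ n ^ 2) ∧
    (∀ n, 1 ≤ n → normBessel μ (besselZero μ n ^ 2) = 0) ∧
    ∀ s, 0 < s → normBessel μ s = 0 → ∃ n, 1 ≤ n ∧ besselZero μ n ^ 2 = s := by
    rcases hμ with rfl | rfl <;>
    exact besselZero_sq_spec (by linarith) (by linarith) (by first | exact hν0.ne' | linarith)
  obtain ⟨m, -, rfl⟩ := hspec.2.2 s ((sq_nonneg _).trans_lt h1) h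
  have h3 := hspec.1.lt_iff_lt.1 h1
  have h4 := hspec.1.lt_iff_lt.1 h2
  omega

/-- By the sign at the zeros, two consecutive zeros of either function enclose a zero of the other.
Applied to both functions, this carries the order of the indices from n to n + 1; the start uses the
common value 1 at s = 0 and the convention `besselZero μ 0 = 0`. -/
theorem besselZero_sq_interlace (n : ℕ) :
    besselZero ν n ^ 2 < besselZero (-ν) (n + 1) ^ 2 ∧
      besselZero (-ν) (n + 1) ^ 2 < besselZero ν (n + 1) ^ 2 := by
  have hp : -1 < ν := by linarith
  have hm : -1 < -ν := by linarith
  obtain ⟨pm, pz, ps⟩ := besselZero_sq_spec hp hν1 hν0.ne'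
  obtain ⟨mm, mz, ms⟩ := besselZero_sq_spec (μ := -ν) hm (by linarith) (by linarith)
  have hpos := fun n (hn : 1 ≤ n) => besselZero_sq_pos hν0 hν1 hn
  have next_lt : ∀ k l,
      (∃ w ∈ Set.Ioo (besselZero (-ν) l ^ 2) (besselZero ν (k + 1) ^ 2), normBessel (-ν) w = 0) →
      besselZero (-ν) (l + 1) ^ 2 < besselZero ν (k + 1) ^ 2 := by
    rintro k l ⟨w, hw, hw0⟩
    obtain ⟨m, hm1, rfl⟩ := ms w ((sq_nonneg _).trans_lt hw.1) hw0
    exact (mm.monotone (mm.lt_iff_lt.1 hw.1)).trans_lt hw.2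
  induction n with
  | zero =>
    refine ⟨by simpa [besselZero] using (hpos 1 le_rfl).2, ?_⟩
    refine next_lt 0 0 ?_
    have hb := (hpos 1 le_rfl).1
    -- P falls from 1 to its first zero, so its derivative there is negative; the sign of P' M then
    -- forces M < 0, while M(0) = 1.
    have hneg : normBessel (-ν) 0 * normBessel (-ν) (besselZero ν 1 ^ 2) < 0 := by
      rw [normBessel_zero hm, one_mul]
      by_contra! hge
      have hd := normBessel_deriv_mul_pos hν0 hν1 hb (pz 1 le_rfl)
      obtain ⟨u, hu, hu'⟩ := exists_lt_of_hasDerivAt_pos_left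
        ((hasDerivAt_normBessel hp _).mul_const (normBessel (-ν) (besselZero ν 1 ^ 2))) hd hb
      have hu0 : 0 < normBessel ν 0 * normBessel ν u := by
        refine mul_pos_of_forall_ne_zero (S := Set.Ico 0 (besselZero ν 1 ^ 2))
          Set.ordConnected_Ico (continuous_normBessel hp).continuousOn ?_ ⟨le_rfl, hb⟩
          ⟨hu.1.le, hu.2⟩
        intro z hz
        rcases eq_or_lt_of_le hz.1 with rfl | hz0
        · simp [normBessel_zero hp]
        · exact normBessel_ne_zero_of_between hν0 hν1 (Or.inl rfl) (n := 0)
            (by simpa [besselZero] using hz0) hz.2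
      rw [normBessel_zero hp, one_mul] at hu0
      rw [pz 1 le_rfl, zero_mul] at hu'
      nlinarith
    simpa [besselZero] using exists_zero_Ioo_of_mul_neg hb (continuous_normBessel hm).continuousOn hneg
  | succ n ih =>
    have h1 : besselZero ν (n + 1) ^ 2 < besselZero (-ν) (n + 1 + 1) ^ 2 := by
      obtain ⟨z, hz, hz0⟩ := exists_zero_Ioo_of_consecutive_zeros
        (mm (Nat.lt_succ_self (n + 1))) (hasDerivAt_normBessel hm)
        (continuous_normBessel hp).neg (mz _ (by omega)) (mz _ (by omega))
        (fun z hz => normBessel_ne_zero_of_between hν0 hν1 (Or.inr rfl) hz.1 hz.2)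
        (normBessel_neg_deriv_mul_pos hν0 hν1 (hpos _ (by omega)).2 (mz _ (by omega)))
        (normBessel_neg_deriv_mul_pos hν0 hν1 (hpos _ (by omega)).2 (mz _ (by omega)))
      obtain ⟨m, hm1, rfl⟩ := ps z ((sq_nonneg _).trans_lt hz.1) (neg_eq_zero.1 hz0)
      exact (pm.monotone (pm.lt_iff_lt.1 (ih.1.trans hz.1))).trans_lt hz.2
    refine ⟨h1, next_lt _ _ ?_⟩
    obtain ⟨z, hz, hz0⟩ := exists_zero_Ioo_of_consecutive_zeros
      (pm (Nat.lt_succ_self (n + 1))) (hasDerivAt_normBessel hp)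
      (continuous_normBessel hm) (pz _ (by omega)) (pz _ (by omega))
      (fun z hz => normBessel_ne_zero_of_between hν0 hν1 (Or.inl rfl) hz.1 hz.2)
      (normBessel_deriv_mul_pos hν0 hν1 (hpos _ (by omega)).1 (pz _ (by omega)))
      (normBessel_deriv_mul_pos hν0 hν1 (hpos _ (by omega)).1 (pz _ (by omega)))
    exact ⟨z, ⟨ih.2.trans hz.1, hz.2⟩, hz0⟩

/-! ### The sign of the product -/

theorem continuous_normBessel_mul : Continuous fun s => normBessel ν s * normBessel (-ν) s :=
  (continuous_normBessel (by linarith)).mul (continuous_normBessel (by linarith))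

/-- Since P' M > 0 at positive zeros of P, the product P M passes there from negative to positive.
With interlacing this gives its sign on both adjacent gaps. -/
theorem hasDerivAt_normBessel_mul_of_zero {s : ℝ} (h : normBessel ν s = 0) :
    HasDerivAt (fun s => normBessel ν s * normBessel (-ν) s)
      (deriv (normBessel ν) s * normBessel (-ν) s) s := by
  refine ((hasDerivAt_normBessel (by linarith) s).mul
    (hasDerivAt_normBessel (μ := -ν) (by linarith) s)).congr_deriv ?_
  rw [h]; ring

theorem normBessel_mul_pos {n : ℕ} (hn : 1 ≤ n) {s : ℝ}
    (hs : s ∈ Set.Ioo (besselZero ν n ^ 2) (besselZero (-ν) (n + 1) ^ 2)) :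
    0 < normBessel ν s * normBessel (-ν) s := by
  have hz := (besselZero_sq_spec (by linarith) hν1 hν0.ne').2.1 n hn
  obtain ⟨m, rfl⟩ := Nat.exists_eq_add_of_le' hn
  obtain ⟨u, hu, hu'⟩ := exists_gt_of_hasDerivAt_pos_right
    (hasDerivAt_normBessel_mul_of_zero hν0 hν1 hz)
    (normBessel_deriv_mul_pos hν0 hν1 (besselZero_sq_pos hν0 hν1 hn).1 hz)
    (besselZero_sq_interlace hν0 hν1 _).1
  rw [hz, zero_mul] at hu'
  have := mul_pos_of_forall_ne_zero Set.ordConnected_Ioo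
    (continuous_normBessel_mul hν0 hν1).continuousOn (fun z hz => mul_ne_zero
      (normBessel_ne_zero_of_between hν0 hν1 (Or.inl rfl) hz.1
        (hz.2.trans (besselZero_sq_interlace hν0 hν1 _).2))
      (normBessel_ne_zero_of_between hν0 hν1 (Or.inr rfl)
        ((besselZero_sq_interlace hν0 hν1 _).2.trans hz.1) hz.2)) hu hs
  exact (pos_iff_pos_of_mul_pos this).1 hu'

theorem normBessel_mul_neg {n : ℕ} (hn : 1 ≤ n) {s : ℝ}
    (hs : s ∈ Set.Ioo (besselZero (-ν) n ^ 2) (besselZero ν n ^ 2)) :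
    normBessel ν s * normBessel (-ν) s < 0 := by
  have hz := (besselZero_sq_spec (by linarith) hν1 hν0.ne').2.1 n hn
  obtain ⟨m, rfl⟩ := Nat.exists_eq_add_of_le' hn
  obtain ⟨u, hu, hu'⟩ := exists_lt_of_hasDerivAt_pos_left
    (hasDerivAt_normBessel_mul_of_zero hν0 hν1 hz)
    (normBessel_deriv_mul_pos hν0 hν1 (besselZero_sq_pos hν0 hν1 hn).1 hz)
    (besselZero_sq_interlace hν0 hν1 _).2
  rw [hz, zero_mul] at hu'
  have := mul_pos_of_forall_ne_zero Set.ordConnected_Ioo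
    (continuous_normBessel_mul hν0 hν1).continuousOn (fun z hz => mul_ne_zero
      (normBessel_ne_zero_of_between hν0 hν1 (Or.inl rfl)
        ((besselZero_sq_interlace hν0 hν1 _).1.trans hz.1) hz.2)
      (normBessel_ne_zero_of_between hν0 hν1 (Or.inr rfl) hz.1
        (hz.2.trans (besselZero_sq_interlace hν0 hν1 _).1))) hu hs
  exact (neg_iff_neg_of_mul_pos this).1 hu'

theorem normBessel_mul_pos_of_lt_first {s : ℝ} (h0 : 0 ≤ s) (hs : s < besselZero (-ν) 1 ^ 2) :
    0 < normBessel ν s * normBessel (-ν) s := by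
  have := mul_pos_of_forall_ne_zero (S := Set.Ico 0 (besselZero (-ν) 1 ^ 2)) Set.ordConnected_Ico
    (continuous_normBessel_mul hν0 hν1).continuousOn (fun z hz => ?_)
    ⟨le_rfl, h0.trans_lt hs⟩ ⟨h0, hs⟩
  · simpa [normBessel_zero (by linarith : -1 < ν), normBessel_zero (by linarith : -1 < -ν)]
      using this
  · rcases eq_or_lt_of_le hz.1 with rfl | hz0
    · simp [normBessel_zero (by linarith : -1 < ν), normBessel_zero (by linarith : -1 < -ν)]
    · exact mul_ne_zero
        (normBessel_ne_zero_of_between hν0 hν1 (Or.inl rfl) (n := 0)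
          (by simpa [besselZero] using hz0) (hz.2.trans (besselZero_sq_interlace hν0 hν1 0).2))
        (normBessel_ne_zero_of_between hν0 hν1 (Or.inr rfl) (n := 0)
          (by simpa [besselZero] using hz0) hz.2)

/-- The least n with s < j_{-ν,n+1}² locates s. It exists because the zeros are unbounded, and n = 0
is the first alternative. -/
theorem positive_cases {s : ℝ} (hs : 0 < s) :
    s < besselZero (-ν) 1 ^ 2 ∨ ∃ n, 1 ≤ n ∧
      (s ∈ Set.Icc (besselZero (-ν) n ^ 2) (besselZero ν n ^ 2) ∨
        s ∈ Set.Ioo (besselZero ν n ^ 2) (besselZero (-ν) (n + 1) ^ 2)) := by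
  obtain ⟨mm, -, ms⟩ := besselZero_sq_spec (μ := -ν) (by linarith) (by linarith) (by linarith)
  obtain ⟨z, hz, hz0⟩ := exists_normBessel_eq_zero (μ := -ν) (by linarith) (by linarith) s
  obtain ⟨N, hN1, rfl⟩ := ms z (hs.trans hz) hz0
  have hex : ∃ n, s < besselZero (-ν) (n + 1) ^ 2 :=
    ⟨N - 1, by rwa [Nat.sub_add_cancel hN1]⟩
  classical
  have hfind := Nat.find_spec hex
  rcases Nat.eq_zero_or_pos (Nat.find hex) with h0 | hpos
  · left
    rwa [h0] at hfind
  · right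
    refine ⟨Nat.find hex, hpos, ?_⟩
    have hle : besselZero (-ν) (Nat.find hex) ^ 2 ≤ s := by
      have := Nat.find_min hex (Nat.sub_lt hpos one_pos)
      rw [Nat.sub_add_cancel (show 1 ≤ Nat.find hex from hpos)] at this
      exact not_lt.1 this
    rcases le_or_gt s (besselZero ν (Nat.find hex) ^ 2) with h | h
    · exact Or.inl ⟨hle, h⟩
    · exact Or.inr ⟨h, hfind⟩

/-! ### Monotonicity of the quotient -/

/-- If the product is less than one whenever the quotient is at least its value at `x`,
then the quotient at `y > x` is larger than at `x`. -/
theorem normBessel_div_lt {x y : ℝ} (hx : 0 ≤ x) (hxy : x < y)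
    (hne : ∀ z ∈ Set.Icc x y, normBessel (-ν) z ≠ 0)
    (hlt : ∀ z ∈ Set.Icc x y, 0 < z →
      normBessel ν x / normBessel (-ν) x ≤ normBessel ν z / normBessel (-ν) z →
      normBessel ν z * normBessel (-ν) z < 1) :
    normBessel ν x / normBessel (-ν) x < normBessel ν y / normBessel (-ν) y := by
  have hp : -1 < ν := by linarith
  have hm : -1 < -ν := by linarith
  refine lt_of_deriv_pos_of_le (q := fun s => normBessel ν s / normBessel (-ν) s) hxy
    (fun z hz => (hasDerivAt_normBessel hp z).div (hasDerivAt_normBessel hm z) (hne z hz)) ?_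
  intro z hz hge
  have hsq : 0 < normBessel (-ν) z ^ 2 := by have := hne z hz; positivity
  refine div_pos ?_ hsq
  -- The factor s makes the Wronskian identity empty at 0, so there the derivative is computed from
  -- P'(0) and M'(0).
  rcases eq_or_lt_of_le (hx.trans hz.1) with rfl | hz0
  · rw [deriv_normBessel_zero hp, deriv_normBessel_zero hm, normBessel_zero hp, normBessel_zero hm]
    have a1 : 0 < ν + 1 := by linarith
    have a2 : 0 < -ν + 1 := by linarith
    have : -1 / (4 * (ν + 1)) * 1 - 1 * (-1 / (4 * (-ν + 1)))
        = (2 * ν) / (4 * (ν + 1) * (-ν + 1)) := by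
      field_simp; ring
    rw [this]
    positivity
  · have hw := normBessel_wronskian hp hν1 z
    have h1 := hlt z hz hz0 hge
    have : 0 < ν * (1 - normBessel ν z * normBessel (-ν) z) := mul_pos hν0 (by linarith)
    rw [← hw] at this
    exact (pos_iff_pos_of_mul_pos this).1 hz0

/-- Where q = P/M ≥ 1 one has P M = P²/q ≤ P² < 1, so the quotient keeps increasing once it has
reached 1. -/
theorem normBessel_div_lt_of_one_le {x y : ℝ} (hx : 0 ≤ x) (hxy : x < y)
    (hne : ∀ z ∈ Set.Icc x y, normBessel (-ν) z ≠ 0)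
    (h1 : 1 ≤ normBessel ν x / normBessel (-ν) x) :
    normBessel ν x / normBessel (-ν) x < normBessel ν y / normBessel (-ν) y := by
  refine normBessel_div_lt hν0 hν1 hx hxy hne fun z hz hz0 hge => ?_
  have hq := h1.trans hge
  have hE := normBessel_sq_lt_one (μ := ν) (by linarith) hz0
  have hM := hne z hz
  set q := normBessel ν z / normBessel (-ν) z with hqd
  have hP : normBessel ν z = q * normBessel (-ν) z := by rw [hqd]; field_simp
  have : 0 < normBessel (-ν) z ^ 2 := by positivity
  rw [hP] at hE ⊢
  nlinarith [mul_nonneg (mul_nonneg (sub_nonneg.2 hq) (zero_le_one.trans hq)) this.le]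

end

/-! ### The transcendental equations -/

theorem normBessel_div_eq {ν κ s : ℝ} (hκ : κ ≠ 0) (hs : normBessel (-ν) s ≠ 0)
    (h : κ * normBessel ν s = normBessel (-ν) s) :
    normBessel ν s / normBessel (-ν) s = 1 / κ := by
  have : normBessel ν s ≠ 0 := by
    rintro h0
    rw [h0, mul_zero] at h
    exact hs h.symm
  rw [← h]
  field_simp

section
variable {ν : ℝ} (hν0 : 0 < ν) (hν1 : ν < 1)
include hν0 hν1

theorem besselJ_mul_rpow_eq {E : ℝ} (hE : 0 < E) :
    besselJ ν (√E) * (√E / 2) ^ (-2 * ν) * (Real.Gamma (ν + 1) / Real.Gamma (1 - ν)) =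
      (√E / 2) ^ (-ν) / Real.Gamma (1 - ν) * normBessel ν E := by
  have hs := Real.sqrt_pos.2 hE
  have hG : Real.Gamma (ν + 1) ≠ 0 := (Real.Gamma_pos_of_pos (by linarith)).ne'
  rw [besselJ_eq (by linarith) hs, Real.sq_sqrt hE.le,
    show -ν = ν + -2 * ν by ring, Real.rpow_add (by positivity)]
  field_simp

/-- Both sides carry the nonzero factor (√E/2)^(-ν) / Γ(1-ν). The `1 *` presents the condition as
the case κ = 1 of κ P = M. -/
theorem condPlus_iff {E : ℝ} (hE : 0 < E) :
    CondPlus ν E ↔ 1 * normBessel ν E = normBessel (-ν) E := by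
  have hs := Real.sqrt_pos.2 hE
  have hG : Real.Gamma (1 - ν) ≠ 0 := (Real.Gamma_pos_of_pos (by linarith)).ne'
  have hz : (√E / 2) ^ (-ν) ≠ 0 := (Real.rpow_pos_of_pos (by positivity) _).ne'
  rw [CondPlus, besselJ_mul_rpow_eq hν0 hν1 hE, besselJ_eq (by linarith) hs, Real.sq_sqrt hE.le,
    neg_add_eq_sub, one_mul]
  exact mul_right_inj' (div_ne_zero hz hG)

theorem condMinus_iff {E : ℝ} (hE : 0 < E) :
    CondMinus ν E ↔ (1 - 2 * ν) / (1 + 2 * ν) * normBessel ν E = normBessel (-ν) E := by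
  have hs := Real.sqrt_pos.2 hE
  have hG : Real.Gamma (1 - ν) ≠ 0 := (Real.Gamma_pos_of_pos (by linarith)).ne'
  have hz : (√E / 2) ^ (-ν) ≠ 0 := (Real.rpow_pos_of_pos (by positivity) _).ne'
  rw [CondMinus, besselJ_mul_rpow_eq hν0 hν1 hE, besselJ_eq (by linarith) hs, Real.sq_sqrt hE.le,
    neg_add_eq_sub, mul_assoc, mul_comm (normBessel ν E)]
  exact mul_right_inj' (div_ne_zero hz hG)

theorem continuous_mul_normBessel_sub (κ : ℝ) :
    Continuous fun s => κ * normBessel ν s - normBessel (-ν) s :=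
  ((continuous_normBessel (by linarith)).const_mul κ).sub (continuous_normBessel (by linarith))

/-- A solution with κ > 0 needs P and M of the same sign, whereas P M < 0 inside the interval and
exactly one factor vanishes at each end. -/
theorem mul_normBessel_ne_of_mem_Icc {κ : ℝ} (hκ : 0 < κ) {n : ℕ} (hn : 1 ≤ n) {s : ℝ}
    (hs : s ∈ Set.Icc (besselZero (-ν) n ^ 2) (besselZero ν n ^ 2)) :
    κ * normBessel ν s ≠ normBessel (-ν) s := by
  intro h
  have pz := (besselZero_sq_spec (by linarith) hν1 hν0.ne').2.1 n hn
  have mz := (besselZero_sq_spec (μ := -ν) (by linarith) (by linarith) (by linarith)).2.1 n hn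
  by_cases hP : normBessel ν s = 0
  · exact normBessel_neg_ne_zero hν0 hν1 hP (by rw [← h, hP, mul_zero])
  have hM : normBessel (-ν) s ≠ 0 := h ▸ mul_ne_zero hκ.ne' hP
  have := normBessel_mul_neg hν0 hν1 hn (s := s)
    ⟨lt_of_le_of_ne hs.1 (by rintro rfl; exact hM mz), lt_of_le_of_ne hs.2 (by rintro rfl; exact hP pz)⟩
  rw [← h] at this
  have h2 : 0 < normBessel ν s ^ 2 := by positivity
  nlinarith

theorem normBessel_neg_ne_zero_of_mem_Ioo {n : ℕ} {s : ℝ}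
    (hs : s ∈ Set.Ioo (besselZero ν n ^ 2) (besselZero (-ν) (n + 1) ^ 2)) :
    normBessel (-ν) s ≠ 0 := by
  cases n with
  | zero =>
    exact normBessel_ne_zero_of_between hν0 hν1 (Or.inr rfl) (n := 0)
      (by simpa [besselZero] using hs.1) hs.2
  | succ n =>
    exact normBessel_ne_zero_of_between hν0 hν1 (Or.inr rfl)
      ((besselZero_sq_interlace hν0 hν1 n).2.trans hs.1) hs.2

/-- On the intervals where both functions have the same sign, solutions for smaller parameters
do not lie to the left. -/
theorem le_of_mul_normBessel_eq {κ κ' : ℝ} (hκ0 : 0 < κ) (hκ' : 0 < κ') (hκ1 : κ' ≤ 1) (h : κ ≤ κ')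
    {n : ℕ} {x y : ℝ}
    (hx : x ∈ Set.Ioo (besselZero ν n ^ 2) (besselZero (-ν) (n + 1) ^ 2))
    (hy : y ∈ Set.Ioo (besselZero ν n ^ 2) (besselZero (-ν) (n + 1) ^ 2))
    (hxe : κ' * normBessel ν x = normBessel (-ν) x)
    (hye : κ * normBessel ν y = normBessel (-ν) y) : x ≤ y := by
  -- If y < x, then q(y) = 1/κ ≥ 1, so q increases from y to x and 1/κ < 1/κ', against κ ≤ κ'.
  by_contra! hlt
  have hM := fun {s} hs => normBessel_neg_ne_zero_of_mem_Ioo hν0 hν1 (n := n) (s := s) hs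
  have hqy := normBessel_div_eq hκ0.ne' (hM hy) hye
  have hqx := normBessel_div_eq hκ'.ne' (hM hx) hxe
  have := normBessel_div_lt_of_one_le hν0 hν1 ((sq_nonneg _).trans hy.1.le) hlt
    (fun z hz => hM ⟨hy.1.trans_le hz.1, hz.2.trans_lt hx.2⟩)
    (by rw [hqy, le_div_iff₀ hκ0]; linarith)
  rw [hqy, hqx, one_div_lt_one_div hκ0 hκ'] at this
  linarith

/-- At the left end κ P - M equals -M, at the right end κ P. These have opposite signs because P M >
0 in between; the midpoint serves to compare M at one end with P at the other. -/
theorem existsUnique_mul_normBessel_eq {κ : ℝ} (hκ0 : 0 < κ) (hκ1 : κ ≤ 1) {n : ℕ} (hn : 1 ≤ n) :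
    ∃! s, s ∈ Set.Ioo (besselZero ν n ^ 2) (besselZero (-ν) (n + 1) ^ 2) ∧
      κ * normBessel ν s = normBessel (-ν) s := by
  refine existsUnique_of_exists_of_unique ?_ fun x y hx hy => le_antisymm
    (le_of_mul_normBessel_eq hν0 hν1 hκ0 hκ0 hκ1 le_rfl hx.1 hy.1 hx.2 hy.2)
    (le_of_mul_normBessel_eq hν0 hν1 hκ0 hκ0 hκ1 le_rfl hy.1 hx.1 hy.2 hx.2)
  have pz := (besselZero_sq_spec (by linarith) hν1 hν0.ne').2.1 n hn
  have mz := (besselZero_sq_spec (μ := -ν) (by linarith) (by linarith) (by linarith)).2.1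
    (n + 1) (by omega)
  have hlt := (besselZero_sq_interlace hν0 hν1 n).1
  have hpp := normBessel_deriv_mul_pos hν0 hν1 (besselZero_sq_pos hν0 hν1 hn).1 pz
  have hM0 := normBessel_neg_ne_zero hν0 hν1 pz
  have hP0 : normBessel ν (besselZero (-ν) (n + 1) ^ 2) ≠ 0 :=
    fun h => normBessel_neg_ne_zero hν0 hν1 h mz
  have hM : 0 < normBessel (-ν) (besselZero ν n ^ 2)
      * normBessel (-ν) ((besselZero ν n ^ 2 + besselZero (-ν) (n + 1) ^ 2) / 2) := by
    refine mul_pos_of_forall_ne_zero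
      (S := Set.Ico (besselZero ν n ^ 2) (besselZero (-ν) (n + 1) ^ 2)) Set.ordConnected_Ico
      (continuous_normBessel (by linarith)).continuousOn ?_ ⟨le_rfl, hlt⟩
      ⟨by linarith, by linarith⟩
    intro z hz
    rcases eq_or_lt_of_le hz.1 with rfl | h
    · exact hM0
    · exact normBessel_neg_ne_zero_of_mem_Ioo hν0 hν1 ⟨h, hz.2⟩
  have hP : 0 < normBessel ν (besselZero (-ν) (n + 1) ^ 2)
      * normBessel ν ((besselZero ν n ^ 2 + besselZero (-ν) (n + 1) ^ 2) / 2) := by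
    refine mul_pos_of_forall_ne_zero
      (S := Set.Ioc (besselZero ν n ^ 2) (besselZero (-ν) (n + 1) ^ 2)) Set.ordConnected_Ioc
      (continuous_normBessel (by linarith)).continuousOn ?_ ⟨hlt, le_rfl⟩
      ⟨by linarith, by linarith⟩
    intro z hz
    exact normBessel_ne_zero_of_between hν0 hν1 (Or.inl rfl) hz.1
      (hz.2.trans_lt (besselZero_sq_interlace hν0 hν1 n).2)
  have hmid := normBessel_mul_pos hν0 hν1 hn
    (s := (besselZero ν n ^ 2 + besselZero (-ν) (n + 1) ^ 2) / 2) ⟨by linarith, by linarith⟩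
  have hprod : 0 < normBessel (-ν) (besselZero ν n ^ 2)
      * normBessel ν (besselZero (-ν) (n + 1) ^ 2) := by
    have h1 := mul_pos hM hP
    refine (pos_iff_pos_of_mul_pos (?_ : 0 < _ * (normBessel ν
      ((besselZero ν n ^ 2 + besselZero (-ν) (n + 1) ^ 2) / 2) * normBessel (-ν)
      ((besselZero ν n ^ 2 + besselZero (-ν) (n + 1) ^ 2) / 2)))).2 hmid
    linarith
  obtain ⟨z, hz, hz0⟩ := exists_zero_Ioo_of_mul_neg hlt
    (continuous_mul_normBessel_sub hν0 hν1 κ).continuousOn (by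
      rw [pz, mz]
      have := mul_pos hκ0 hprod
      linarith)
  exact ⟨z, hz, sub_eq_zero.1 hz0⟩

/-- Here κ P - M starts from κ - 1 < 0 and ends at κ P > 0. Uniqueness is the case n = 0 of the
general comparison. -/
theorem existsUnique_mul_normBessel_eq_first {κ : ℝ} (hκ0 : 0 < κ) (hκ1 : κ < 1) :
    ∃! s, s ∈ Set.Ioo 0 (besselZero (-ν) 1 ^ 2) ∧ κ * normBessel ν s = normBessel (-ν) s := by
  have hz : besselZero ν 0 ^ 2 = 0 := by simp [besselZero]
  have huniq := fun {x y} => le_of_mul_normBessel_eq hν0 hν1 hκ0 hκ0 hκ1.le le_rfl (n := 0)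
    (x := x) (y := y)
  rw [hz] at huniq
  refine existsUnique_of_exists_of_unique ?_ fun x y hx hy => le_antisymm
    (huniq hx.1 hy.1 hx.2 hy.2) (huniq hy.1 hx.1 hy.2 hx.2)
  have mz := (besselZero_sq_spec (μ := -ν) (by linarith) (by linarith) (by linarith)).2.1 1 le_rfl
  have hpos := (besselZero_sq_pos hν0 hν1 le_rfl).2
  have hP : 0 < normBessel ν 0 * normBessel ν (besselZero (-ν) 1 ^ 2) := by
    refine mul_pos_of_forall_ne_zero
      (S := Set.Icc 0 (besselZero (-ν) 1 ^ 2)) Set.ordConnected_Icc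
      (continuous_normBessel (by linarith)).continuousOn ?_ ⟨le_rfl, hpos.le⟩ ⟨hpos.le, le_rfl⟩
    intro z hz
    rcases eq_or_lt_of_le hz.1 with rfl | h
    · simp [normBessel_zero (by linarith : -1 < ν)]
    · exact normBessel_ne_zero_of_between hν0 hν1 (Or.inl rfl) (n := 0)
        (by simpa [besselZero] using h) (hz.2.trans_lt (besselZero_sq_interlace hν0 hν1 0).2)
  rw [normBessel_zero (by linarith), one_mul] at hP
  obtain ⟨z, hz, hz0⟩ := exists_zero_Ioo_of_mul_neg hpos
    (continuous_mul_normBessel_sub hν0 hν1 κ).continuousOn (by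
      rw [mz, normBessel_zero (by linarith), normBessel_zero (by linarith)]
      nlinarith [mul_pos hκ0 hP])
  exact ⟨z, hz, sub_eq_zero.1 hz0⟩

/-- The quotient P/M equals 1 at 0 and increases strictly from there, so it does not return to 1. -/
theorem normBessel_ne_of_lt_first {s : ℝ} (hs : s ∈ Set.Ioo 0 (besselZero (-ν) 1 ^ 2)) :
    1 * normBessel ν s ≠ normBessel (-ν) s := by
  intro h
  have hne : ∀ z ∈ Set.Icc 0 s, normBessel (-ν) z ≠ 0 := fun z hz h0 => by
    have := normBessel_mul_pos_of_lt_first hν0 hν1 hz.1 (hz.2.trans_lt hs.2)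
    simp [h0] at this
  have h00 : normBessel ν 0 / normBessel (-ν) 0 = 1 := by
    rw [normBessel_zero (by linarith), normBessel_zero (by linarith), div_one]
  have := normBessel_div_lt_of_one_le hν0 hν1 le_rfl hs.1 hne h00.ge
  rw [h00, normBessel_div_eq one_ne_zero (hne s ⟨hs.1.le, le_rfl⟩) h] at this
  norm_num at this

/-- A solution would give P M = κ P² < 0. -/
theorem mul_normBessel_ne_of_neg {κ : ℝ} (hκ : κ < 0) {s : ℝ}
    (hs : 0 ≤ normBessel ν s * normBessel (-ν) s) : κ * normBessel ν s ≠ normBessel (-ν) s := by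
  intro h
  have hP : normBessel ν s ≠ 0 := fun h0 => by
    rw [h0, mul_zero] at h
    exact normBessel_neg_ne_zero hν0 hν1 h0 h.symm
  have : 0 < normBessel ν s ^ 2 := by positivity
  rw [← h] at hs
  nlinarith

theorem mul_normBessel_ne_first {κ : ℝ} (hκ : κ < 0) {s : ℝ}
    (hs : s ∈ Set.Ioc 0 (besselZero (-ν) 1 ^ 2)) : κ * normBessel ν s ≠ normBessel (-ν) s := by
  have mz := (besselZero_sq_spec (μ := -ν) (by linarith) (by linarith) (by linarith)).2.1 1 le_rfl
  refine mul_normBessel_ne_of_neg hν0 hν1 hκ ?_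
  rcases eq_or_lt_of_le hs.2 with rfl | h
  · rw [mz, mul_zero]
  · exact (normBessel_mul_pos_of_lt_first hν0 hν1 hs.1.le h).le

theorem mul_normBessel_ne_of_mem_Icc_of_neg {κ : ℝ} (hκ : κ < 0) {n : ℕ} (hn : 1 ≤ n) {s : ℝ}
    (hs : s ∈ Set.Icc (besselZero ν n ^ 2) (besselZero (-ν) (n + 1) ^ 2)) :
    κ * normBessel ν s ≠ normBessel (-ν) s := by
  have pz := (besselZero_sq_spec (by linarith) hν1 hν0.ne').2.1 n hn
  have mz := (besselZero_sq_spec (μ := -ν) (by linarith) (by linarith) (by linarith)).2.1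
    (n + 1) (by omega)
  refine mul_normBessel_ne_of_neg hν0 hν1 hκ ?_
  rcases eq_or_lt_of_le hs.2 with rfl | h
  · rw [mz, mul_zero]
  rcases eq_or_lt_of_le hs.1 with rfl | h'
  · rw [pz, zero_mul]
  exact (normBessel_mul_pos hν0 hν1 hn ⟨h', h⟩).le

/-- On this gap P M < 0 < 1, so P/M is strictly increasing without any lower bound on it. The end
values κ P and -M of κ P - M have opposite signs. -/
theorem existsUnique_mul_normBessel_eq_of_neg {κ : ℝ} (hκ : κ < 0) {n : ℕ} (hn : 1 ≤ n) :
    ∃! s, s ∈ Set.Ioo (besselZero (-ν) n ^ 2) (besselZero ν n ^ 2) ∧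
      κ * normBessel ν s = normBessel (-ν) s := by
  have pz := (besselZero_sq_spec (by linarith) hν1 hν0.ne').2.1 n hn
  have mz := (besselZero_sq_spec (μ := -ν) (by linarith) (by linarith) (by linarith)).2.1 n hn
  obtain ⟨m, rfl⟩ := Nat.exists_eq_add_of_le' hn
  have hlt := (besselZero_sq_interlace hν0 hν1 m).2
  have hlt0 := (besselZero_sq_interlace hν0 hν1 m).1
  have hlt1 := (besselZero_sq_interlace hν0 hν1 (m + 1)).1
  set a := besselZero (-ν) (m + 1) ^ 2
  set b := besselZero ν (m + 1) ^ 2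
  have hM : ∀ z ∈ Set.Ioc a b, normBessel (-ν) z ≠ 0 := fun z hz =>
    normBessel_ne_zero_of_between hν0 hν1 (Or.inr rfl) hz.1 (hz.2.trans_lt hlt1)
  have hP : ∀ z ∈ Set.Ico a b, normBessel ν z ≠ 0 := fun z hz =>
    normBessel_ne_zero_of_between hν0 hν1 (Or.inl rfl) (hlt0.trans_le hz.1) hz.2
  have ha0 : 0 ≤ a := sq_nonneg _
  have huniq : ∀ x y, x ∈ Set.Ioo a b → y ∈ Set.Ioo a b → κ * normBessel ν x = normBessel (-ν) x →
      κ * normBessel ν y = normBessel (-ν) y → x ≤ y := by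
    intro x y hx hy hxe hye
    by_contra! hyx
    have := normBessel_div_lt hν0 hν1 (ha0.trans hy.1.le) hyx
      (fun z hz => hM z ⟨hy.1.trans_le hz.1, hz.2.trans hx.2.le⟩)
      (fun z hz _ _ => (normBessel_mul_neg hν0 hν1 hn
        ⟨hy.1.trans_le hz.1, hz.2.trans_lt hx.2⟩).trans one_pos)
    rw [normBessel_div_eq hκ.ne (hM x ⟨hx.1, hx.2.le⟩) hxe,
      normBessel_div_eq hκ.ne (hM y ⟨hy.1, hy.2.le⟩) hye] at this
    exact this.false
  refine existsUnique_of_exists_of_unique ?_ fun x y hx hy =>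
    le_antisymm (huniq _ _ hx.1 hy.1 hx.2 hy.2) (huniq _ _ hy.1 hx.1 hy.2 hx.2)
  have h1 := mul_pos_of_forall_ne_zero Set.ordConnected_Ioc
    (continuous_normBessel (by linarith)).continuousOn hM (x := b) (y := (a + b) / 2)
    ⟨hlt, le_rfl⟩ ⟨by linarith, by linarith⟩
  have h2 := mul_pos_of_forall_ne_zero Set.ordConnected_Ico
    (continuous_normBessel (by linarith)).continuousOn hP (x := a) (y := (a + b) / 2)
    ⟨le_rfl, hlt⟩ ⟨by linarith, by linarith⟩
  have hmid := normBessel_mul_neg hν0 hν1 hn (s := (a + b) / 2) ⟨by linarith, by linarith⟩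
  have hprod : normBessel (-ν) b * normBessel ν a < 0 := by
    have h3 := mul_pos h1 h2
    refine (neg_iff_neg_of_mul_pos (?_ : 0 < _ * (normBessel ν ((a + b) / 2)
      * normBessel (-ν) ((a + b) / 2)))).2 hmid
    linarith
  obtain ⟨z, hz, hz0⟩ := exists_zero_Ioo_of_mul_neg hlt
    (continuous_mul_normBessel_sub hν0 hν1 κ).continuousOn (by
      rw [pz, mz]
      have := mul_pos_of_neg_of_neg hκ hprod
      linarith)
  exact ⟨z, hz, sub_eq_zero.1 hz0⟩

end

/-- Interleaving two sequences. -/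
theorem exists_strictMono_interleave {p m : ℕ → ℝ} (h : ∀ n, p n < m n)
    (h' : ∀ n, m n < p (n + 1)) : ∃ e : ℕ → ℝ, (∀ n, e (2 * n) = p n) ∧
      (∀ n, e (2 * n + 1) = m n) ∧ StrictMono e ∧ Set.range e = Set.range p ∪ Set.range m := by
  let e : ℕ → ℝ := fun n => if n % 2 = 0 then p (n / 2) else m (n / 2)
  have he : ∀ n, e (2 * n) = p n := fun n => by simp [e]
  have ho : ∀ n, e (2 * n + 1) = m n := fun n => by
    simp [e, Nat.add_mod, show (2 * n + 1) / 2 = n by omega]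
  refine ⟨e, he, ho, strictMono_nat_of_lt_succ fun n => ?_, Set.Subset.antisymm ?_ ?_⟩
  · rcases Nat.even_or_odd' n with ⟨k, rfl | rfl⟩
    · rw [he, ho]; exact h k
    · rw [ho, show 2 * k + 1 + 1 = 2 * (k + 1) by ring, he]; exact h' k
  · rintro _ ⟨n, rfl⟩
    rcases Nat.even_or_odd' n with ⟨k, rfl | rfl⟩
    · exact Or.inl ⟨k, (he k).symm⟩
    · exact Or.inr ⟨k, (ho k).symm⟩
  · rintro _ (⟨k, rfl⟩ | ⟨k, rfl⟩)
    · exact ⟨2 * k, he k⟩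
    · exact ⟨2 * k + 1, ho k⟩

/-! ### Test functions and weak derivatives -/

open MeasureTheory

namespace IsTestFunction

variable {U V : Set ℝ} {φ ψ : ℝ → ℝ}

theorem mono (h : IsTestFunction U φ) (hUV : U ⊆ V) : IsTestFunction V φ :=
  ⟨h.1, h.2.1, h.2.2.trans hUV⟩

theorem continuous (h : IsTestFunction U φ) : Continuous φ := h.1.continuous

theorem hasDerivAt (h : IsTestFunction U φ) (x : ℝ) : HasDerivAt φ (deriv φ x) x :=
  (h.1.differentiable (by simp)).differentiableAt.hasDerivAt

theorem deriv (h : IsTestFunction U φ) : IsTestFunction U (deriv φ) :=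
  ⟨(contDiff_infty_iff_deriv.1 h.1).2, h.2.1.deriv,
    (closure_minimal support_deriv_subset (isClosed_tsupport φ)).trans h.2.2⟩

theorem sub (h : IsTestFunction U φ) (h' : IsTestFunction U ψ) : IsTestFunction U (φ - ψ) :=
  ⟨h.1.sub h'.1, h.2.1.sub h'.2.1, (tsupport_sub φ ψ).trans (Set.union_subset h.2.2 h'.2.2)⟩

theorem const_mul (h : IsTestFunction U φ) (c : ℝ) : IsTestFunction U fun x => c * φ x :=
  ⟨contDiff_const.mul h.1, h.2.1.mul_left,
    (tsupport_mul_subset_right (f := fun _ => c) (g := φ)).trans h.2.2⟩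

theorem eq_zero (h : IsTestFunction U φ) {x : ℝ} (hx : x ∉ U) : φ x = 0 :=
  image_eq_zero_of_notMem_tsupport fun hx' => hx (h.2.2 hx')

theorem setIntegral_mul (h : IsTestFunction U φ) (f : ℝ → ℝ) :
    ∫ x in U, f x * φ x = ∫ x, f x * φ x :=
  setIntegral_eq_integral_of_forall_compl_eq_zero fun x hx => by rw [h.eq_zero hx, mul_zero]

theorem continuous_mul (h : IsTestFunction U φ) (hU : IsOpen U) {f : ℝ → ℝ}
    (hf : ContinuousOn f U) : Continuous fun x => f x * φ x :=
  (hf.mul h.continuous.continuousOn).continuous_of_tsupport_subset hU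
    ((tsupport_mul_subset_right (f := f) (g := φ)).trans h.2.2)

theorem integrable_mul (h : IsTestFunction U φ) (hU : IsOpen U) {f : ℝ → ℝ}
    (hf : ContinuousOn f U) : Integrable fun x => f x * φ x :=
  (h.continuous_mul hU hf).integrable_of_hasCompactSupport h.2.1.mul_left

theorem integrable (h : IsTestFunction U φ) : Integrable φ :=
  h.continuous.integrable_of_hasCompactSupport h.2.1

theorem integrable_mul_of_integrableOn (h : IsTestFunction U φ) {f : ℝ → ℝ}
    (hf : IntegrableOn f U) : IntegrableOn (fun x => f x * φ x) U := by
  obtain ⟨C, hC⟩ := h.continuous.bounded_above_of_compact_support h.2.1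
  exact hf.mul_bdd h.continuous.aestronglyMeasurable (Filter.Eventually.of_forall hC)

end IsTestFunction

/-- Classical derivatives are weak derivatives. -/
theorem hasWeakDerivOn_of_hasDerivAt {U : Set ℝ} (hU : IsOpen U) {g w : ℝ → ℝ}
    (hg : ∀ x ∈ U, HasDerivAt g (w x) x) (hw : ContinuousOn w U) : HasWeakDerivOn U g w := by
  intro φ hφ
  have hgc : ContinuousOn g U := fun x hx => (hg x hx).continuousAt.continuousWithinAt
  have i1 := hφ.integrable_mul hU hw
  have i2 := hφ.deriv.integrable_mul hU hgc
  have hd : ∀ x, HasDerivAt (fun x => g x * φ x) (w x * φ x + g x * deriv φ x) x := by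
    intro x
    by_cases hx : x ∈ tsupport φ
    · exact (hg x (hφ.2.2 hx)).mul (hφ.hasDerivAt x)
    · have h0 : φ =ᶠ[nhds x] 0 := notMem_tsupport_iff_eventuallyEq.1 hx
      have h1 : deriv φ x = 0 := by rw [h0.deriv_eq]; simp
      rw [h1, h0.eq_of_nhds]
      simp only [Pi.zero_apply, mul_zero, add_zero]
      exact (hasDerivAt_const x (0 : ℝ)).congr_of_eventuallyEq
        (h0.mono fun y hy => by simp [hy])
  have h := integral_eq_zero_of_hasDerivAt_of_integrable hd (i1.add i2) (hφ.integrable_mul hU hgc)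
  rw [hφ.setIntegral_mul, hφ.deriv.setIntegral_mul]
  rw [integral_add i1 i2] at h
  linarith

/-- Functions which are differentiable away from a point, with integrable derivative, have
a weak derivative. -/
theorem hasWeakDerivOn_of_hasDerivAt_off_point {a b c : ℝ} (hab : a ≤ b) {g w : ℝ → ℝ}
    (hgc : ContinuousOn g (Set.Icc a b)) (hg : ∀ x ∈ Set.Ioo a b, x ≠ c → HasDerivAt g (w x) x)
    (hw : IntegrableOn w (Set.Ioo a b)) : HasWeakDerivOn (Set.Ioo a b) g w := by
  intro φ hφ
  have i1 := hφ.integrable_mul_of_integrableOn hw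
  have i2 : IntegrableOn (fun x => g x * deriv φ x) (Set.Ioo a b) :=
    (hφ.deriv.integrable_mul isOpen_Ioo (hgc.mono Set.Ioo_subset_Icc_self)).integrableOn
  have i := i1.add i2
  have h := integral_eq_of_hasDerivAt_off_countable_of_le (fun x => g x * φ x)
    (fun x => w x * φ x + g x * deriv φ x) hab (Set.countable_singleton c)
    (hgc.mul hφ.continuous.continuousOn)
    (fun x hx => (hg x hx.1 hx.2).mul (hφ.hasDerivAt x))
    ((intervalIntegrable_iff_integrableOn_Ioo_of_le hab).2 i)
  rw [hφ.eq_zero (x := a) (by simp), hφ.eq_zero (x := b) (by simp),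
    intervalIntegral.integral_of_le hab, integral_Ioc_eq_integral_Ioo, integral_add i1 i2] at h
  linarith

/-- Mean zero makes the primitive from a vanish again beyond the support. Its support lies in the
convex hull of that of ψ, hence the compact interval [α, β]. -/
theorem IsTestFunction.exists_primitive {a b : ℝ} (hab : a < b) {ψ : ℝ → ℝ}
    (hψ : IsTestFunction (Set.Ioo a b) ψ) (h0 : ∫ x, ψ x = 0) :
    ∃ φ, IsTestFunction (Set.Ioo a b) φ ∧ _root_.deriv φ = ψ := by
  obtain ⟨α, β, haα, hβb, hsub⟩ : ∃ α β, a < α ∧ β < b ∧ tsupport ψ ⊆ Set.Icc α β := by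
    rcases (tsupport ψ).eq_empty_or_nonempty with he | hne
    · exact ⟨(a + b) / 2, (a + b) / 2, by linarith, by linarith, by simp [he]⟩
    · have hK : IsCompact (tsupport ψ) := hψ.2.1
      obtain ⟨α, hα⟩ := hK.exists_isLeast hne
      obtain ⟨β, hβ⟩ := hK.exists_isGreatest hne
      exact ⟨α, β, (hψ.2.2 hα.1).1, (hψ.2.2 hβ.1).2, fun x hx => ⟨hα.2 hx, hβ.2 hx⟩⟩
  have hz : ∀ x, x ∉ Set.Icc α β → ψ x = 0 := fun x hx =>
    image_eq_zero_of_notMem_tsupport fun h => hx (hsub h)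
  set φ : ℝ → ℝ := fun x => ∫ t in a..x, ψ t with hφ
  have hd : ∀ x, HasDerivAt φ (ψ x) x := fun x =>
    intervalIntegral.integral_hasDerivAt_right (hψ.continuous.intervalIntegrable _ _)
      (hψ.continuous.stronglyMeasurableAtFilter _ _) hψ.continuous.continuousAt
  have hderiv : _root_.deriv φ = ψ := funext fun x => (hd x).deriv
  have hsupp : Function.support φ ⊆ Set.Icc α β := by
    intro x hx
    by_contra hxn
    refine hx ?_
    rcases lt_or_ge x α with hlt | hge
    · refine (intervalIntegral.integral_congr (g := fun _ => 0) fun t ht => hz t ?_).trans (by simp)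
      intro ht'
      rcases Set.mem_uIcc.1 ht with h | h <;> linarith [h.1, h.2, ht'.1]
    · have hβx : β < x := by
        by_contra! hle
        exact hxn ⟨hge, hle⟩
      simp only [hφ]
      rw [intervalIntegral.integral_of_le (by linarith),
        setIntegral_eq_integral_of_forall_compl_eq_zero, h0]
      intro t ht
      refine hz t fun ht' => ht ⟨by linarith [ht'.1], by linarith [ht'.2]⟩
  refine ⟨φ, ⟨contDiff_infty_iff_deriv.2 ⟨fun x => (hd x).differentiableAt, hderiv ▸ hψ.1⟩,
    HasCompactSupport.of_support_subset_isCompact isCompact_Icc hsupp, ?_⟩, hderiv⟩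
  exact (closure_minimal hsupp isClosed_Icc).trans fun x hx => ⟨haα.trans_le hx.1, hx.2.trans_lt hβb⟩

/-- A continuous function with vanishing weak derivative on an interval is constant. -/
theorem exists_forall_eq_of_weakDeriv_zero {a b : ℝ} (hab : a < b) {k : ℝ → ℝ}
    (hk : ContinuousOn k (Set.Ioo a b))
    (h : ∀ φ, IsTestFunction (Set.Ioo a b) φ → ∫ x, k x * deriv φ x = 0) :
    ∃ c, ∀ x ∈ Set.Ioo a b, k x = c := by
  -- The du Bois-Reymond argument: with η of mass one, ψ - (∫ψ) η is the derivative of a test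
  -- function, so k - ∫ k η annihilates every ψ.
  let f : ContDiffBump ((a + b) / 2) := ⟨(b - a) / 8, (b - a) / 4, by linarith, by linarith⟩
  set η := f.normed volume with hη
  have hηt : IsTestFunction (Set.Ioo a b) η := by
    refine ⟨f.contDiff_normed, f.hasCompactSupport_normed, ?_⟩
    rw [hη, f.tsupport_normed_eq, Real.closedBall_eq_Icc]
    intro x hx
    have h1 : f.rOut = (b - a) / 4 := rfl
    rw [h1] at hx
    exact ⟨by linarith [hx.1], by linarith [hx.2]⟩
  have hη1 : ∫ x, η x = 1 := f.integral_normed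
  set c := ∫ x, k x * η x with hc
  have key : ∀ᵐ x, x ∈ Set.Ioo a b → k x - c = 0 := by
    refine isOpen_Ioo.ae_eq_zero_of_integral_contDiff_smul_eq_zero
      ((hk.sub continuousOn_const).locallyIntegrableOn measurableSet_Ioo) fun ψ h1 h2 h3 => ?_
    have hψ : IsTestFunction (Set.Ioo a b) ψ := ⟨h1, h2, h3⟩
    set m := ∫ x, ψ x
    obtain ⟨φ, hφ, hφd⟩ := (hψ.sub (hηt.const_mul m)).exists_primitive hab (by
      simp only [Pi.sub_apply]
      rw [integral_sub hψ.integrable (hηt.const_mul m).integrable, integral_const_mul, hη1, mul_one,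
        sub_self])
    have h := h φ hφ
    rw [hφd] at h
    simp only [Pi.sub_apply, mul_sub] at h
    rw [integral_sub (hψ.integrable_mul isOpen_Ioo hk)
      ((hηt.const_mul m).integrable_mul isOpen_Ioo hk)] at h
    simp only [mul_left_comm _ m] at h
    rw [integral_const_mul, ← hc] at h
    simp only [smul_eq_mul, mul_sub]
    rw [integral_sub (by simpa only [mul_comm] using hψ.integrable_mul isOpen_Ioo hk)
      (hψ.integrable.mul_const c), integral_mul_const]
    simp only [mul_comm (ψ _)]
    exact h
  refine ⟨c, Measure.eqOn_open_of_ae_eq (μ := volume) ?_ isOpen_Ioo hk continuousOn_const⟩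
  rw [Filter.EventuallyEq, ae_restrict_iff' measurableSet_Ioo]
  exact key.mono fun x hx hxm => sub_eq_zero.1 (hx hxm)

/-- A continuous function with continuous weak derivative is continuously differentiable. -/
theorem HasWeakDerivOn.hasDerivAt {U : Set ℝ} (hU : IsOpen U) {g w : ℝ → ℝ}
    (h : HasWeakDerivOn U g w) (hg : ContinuousOn g U) (hw : ContinuousOn w U) {x : ℝ}
    (hx : x ∈ U) : HasDerivAt g (w x) x := by
  obtain ⟨ε, hε, hball⟩ := Metric.isOpen_iff.1 hU x hx
  rw [Real.ball_eq_Ioo] at hball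
  set I := Set.Ioo (x - ε) (x + ε)
  have hxI : x ∈ I := ⟨by linarith, by linarith⟩
  have hgI := hg.mono hball
  have hwI := hw.mono hball
  -- g minus this primitive of w has zero weak derivative, so it is constant near x.
  set W : ℝ → ℝ := fun y => ∫ t in x..y, w t
  have hW : ∀ y ∈ I, HasDerivAt W (w y) y := by
    intro y hy
    refine intervalIntegral.integral_hasDerivAt_right (ContinuousOn.intervalIntegrable ?_)
      (hwI.stronglyMeasurableAtFilter isOpen_Ioo y hy) (hwI.continuousAt (isOpen_Ioo.mem_nhds hy))
    exact hwI.mono (Set.ordConnected_Ioo.uIcc_subset hxI hy)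
  have hWI : ContinuousOn W I := fun y hy => (hW y hy).continuousAt.continuousWithinAt
  obtain ⟨c, hc⟩ := exists_forall_eq_of_weakDeriv_zero (a := x - ε) (b := x + ε) (by linarith)
    (hgI.sub hWI) (by
      intro φ hφ
      have h1 := h φ (hφ.mono hball)
      have h2 := hasWeakDerivOn_of_hasDerivAt isOpen_Ioo hW hwI φ hφ
      rw [(hφ.mono hball).setIntegral_mul, (hφ.mono hball).deriv.setIntegral_mul] at h1
      rw [hφ.setIntegral_mul, hφ.deriv.setIntegral_mul] at h2
      simp only [Pi.sub_apply, sub_mul]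
      rw [integral_sub (hφ.deriv.integrable_mul isOpen_Ioo hgI)
        (hφ.deriv.integrable_mul isOpen_Ioo hWI), h1, h2, sub_self])
  refine ((hW x hxI).add_const c).congr_of_eventuallyEq ?_
  filter_upwards [isOpen_Ioo.mem_nhds hxI] with y hy
  have := hc y hy
  simp only [Pi.sub_apply] at this
  linarith

/-- Weak derivatives are unique almost everywhere. -/
theorem HasWeakDerivOn.ae_eq {U : Set ℝ} (hU : IsOpen U) {g w v : ℝ → ℝ}
    (hw : HasWeakDerivOn U g w) (hv : HasWeakDerivOn U g v) (hwi : IntegrableOn w U)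
    (hvc : ContinuousOn v U) : ∀ᵐ x ∂volume.restrict U, w x = v x := by
  rw [ae_restrict_iff' hU.measurableSet]
  have : ∀ᵐ x, x ∈ U → w x - v x = 0 := by
    refine hU.ae_eq_zero_of_integral_contDiff_smul_eq_zero
      (hwi.locallyIntegrableOn.sub (hvc.locallyIntegrableOn hU.measurableSet)) fun φ h1 h2 h3 => ?_
    have hφ : IsTestFunction U φ := ⟨h1, h2, h3⟩
    have e1 := hw φ hφ
    rw [hv φ hφ] at e1
    simp only [smul_eq_mul, mul_comm (φ _)]
    rw [← hφ.setIntegral_mul]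
    simp only [sub_mul]
    rw [integral_sub (hφ.integrable_mul_of_integrableOn hwi)
      (hφ.integrable_mul hU hvc).integrableOn]
    linarith
  exact this.mono fun x hx hxU => sub_eq_zero.1 (hx hxU)

/-! ### Gluing functions on the two half-intervals -/

/-- The function equal to `A (-x)` for `x < 0` and to `B x` for `x ≥ 0`. -/
def reflectGlue (A B : ℝ → ℝ) (x : ℝ) : ℝ := if x < 0 then A (-x) else B x

/-- The interval `(-1, 1)` without the origin. -/
def puncturedInterval : Set ℝ := Set.Ioo (-1) 0 ∪ Set.Ioo 0 1

theorem isOpen_puncturedInterval : IsOpen puncturedInterval := isOpen_Ioo.union isOpen_Ioo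

theorem puncturedInterval_subset : puncturedInterval ⊆ Set.Ioo (-1) 1 :=
  Set.union_subset (Set.Ioo_subset_Ioo_right zero_le_one) (Set.Ioo_subset_Ioo_left (by norm_num))

theorem mem_puncturedInterval {x : ℝ} (hx : x ∈ Set.Ioo (-1 : ℝ) 1) (h0 : x ≠ 0) :
    x ∈ puncturedInterval :=
  (lt_or_gt_of_ne h0).elim (fun h => Or.inl ⟨hx.1, h⟩) fun h => Or.inr ⟨h, hx.2⟩

theorem reflectGlue_of_neg {A B : ℝ → ℝ} {x : ℝ} (hx : x < 0) : reflectGlue A B x = A (-x) :=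
  if_pos hx

theorem reflectGlue_of_nonneg {A B : ℝ → ℝ} {x : ℝ} (hx : 0 ≤ x) : reflectGlue A B x = B x :=
  if_neg hx.not_gt

theorem hasDerivAt_reflectGlue {A B A' B' : ℝ → ℝ}
    (hA : ∀ x, 0 < x → HasDerivAt A (A' x) x) (hB : ∀ x, 0 < x → HasDerivAt B (B' x) x)
    {x : ℝ} (hx : x ≠ 0) :
    HasDerivAt (reflectGlue A B) (reflectGlue (fun y => -A' y) B' x) x := by
  rcases lt_or_gt_of_ne hx with h | h
  · rw [reflectGlue_of_neg h]
    refine HasDerivAt.congr_of_eventuallyEq (f := fun y => A (-y)) ?_ ?_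
    · exact ((hA (-x) (by linarith)).scomp x (hasDerivAt_neg x)).congr_deriv (by simp)
    · filter_upwards [Iio_mem_nhds h] with y hy using reflectGlue_of_neg hy
  · rw [reflectGlue_of_nonneg h.le]
    refine (hB x h).congr_of_eventuallyEq ?_
    filter_upwards [Ioi_mem_nhds h] with y hy using reflectGlue_of_nonneg (le_of_lt hy)

theorem continuous_reflectGlue {A B : ℝ → ℝ} (hA : ContinuousOn A (Set.Ici 0))
    (hB : ContinuousOn B (Set.Ici 0)) (h0 : A 0 = B 0) : Continuous (reflectGlue A B) := by
  have h : reflectGlue A B = fun x => if x ≤ 0 then A (-x) else B x := by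
    funext x
    rcases lt_trichotomy x 0 with h | rfl | h
    · rw [reflectGlue_of_neg h, if_pos h.le]
    · rw [reflectGlue_of_nonneg le_rfl, if_pos le_rfl, neg_zero, h0]
    · rw [reflectGlue_of_nonneg h.le, if_neg h.not_ge]
  rw [h]
  refine continuous_if_le continuous_id continuous_const ?_ ?_ ?_
  · exact hA.comp continuous_neg.continuousOn fun x hx => by simpa using hx
  · exact hB.mono fun x hx => hx
  · rintro x rfl
    simpa using h0

theorem continuousOn_puncturedInterval_reflectGlue {A B : ℝ → ℝ}
    (hA : ContinuousOn A (Set.Ioi 0)) (hB : ContinuousOn B (Set.Ioi 0)) :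
    ContinuousOn (reflectGlue A B) puncturedInterval := by
  refine ContinuousOn.union_of_isOpen ?_ ?_ isOpen_Ioo isOpen_Ioo
  · refine (hA.comp continuous_neg.continuousOn (s := Set.Ioo (-1) 0) fun x hx => ?_).congr
      fun x hx => reflectGlue_of_neg hx.2
    simpa using hx.2
  · exact (hB.mono fun x hx => hx.1).congr fun x hx => reflectGlue_of_nonneg hx.1.le

theorem measurePreserving_neg_Ioo_left : MeasurePreserving (fun x : ℝ => -x)
    (volume.restrict (Set.Ioo (-1) 0)) (volume.restrict (Set.Ioo 0 1)) := by
  have h := (Measure.measurePreserving_neg (volume : Measure ℝ)).restrict_preimage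
    (measurableSet_Ioo (a := (0 : ℝ)) (b := 1))
  simpa using h

theorem measurePreserving_neg_Ioo_right : MeasurePreserving (fun x : ℝ => -x)
    (volume.restrict (Set.Ioo 0 1)) (volume.restrict (Set.Ioo (-1) 0)) := by
  have h := (Measure.measurePreserving_neg (volume : Measure ℝ)).restrict_preimage
    (measurableSet_Ioo (a := (-1 : ℝ)) (b := 0))
  simpa using h

theorem puncturedInterval_ae_eq :
    (puncturedInterval : Set ℝ) =ᵐ[volume] (Set.Ioo (-1) 1 : Set ℝ) := by
  have h0 : ∀ᵐ x : ℝ, x ≠ 0 := by simp [ae_iff]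
  filter_upwards [h0] with x hx
  exact propext ⟨fun h => puncturedInterval_subset h, fun h => mem_puncturedInterval h hx⟩

theorem intervalMeasure_eq : intervalMeasure = volume.restrict puncturedInterval :=
  (Measure.restrict_congr_set puncturedInterval_ae_eq).symm

instance : IsFiniteMeasure intervalMeasure := by
  unfold intervalMeasure
  infer_instance

theorem memLp_two_reflectGlue {A B : ℝ → ℝ} (hA : MemLp A 2 (volume.restrict (Set.Ioo 0 1)))
    (hB : MemLp B 2 (volume.restrict (Set.Ioo 0 1))) :
    MemLp (reflectGlue A B) 2 intervalMeasure := by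
  have h1 : MemLp (reflectGlue A B) 2 (volume.restrict (Set.Ioo (-1) 0)) := by
    refine (hA.comp_measurePreserving measurePreserving_neg_Ioo_left).ae_eq ?_
    filter_upwards [ae_restrict_mem measurableSet_Ioo] with x hx
    rw [reflectGlue_of_neg hx.2, Function.comp]
  have h2 : MemLp (reflectGlue A B) 2 (volume.restrict (Set.Ioo 0 1)) := by
    refine hB.ae_eq ?_
    filter_upwards [ae_restrict_mem measurableSet_Ioo] with x hx
    rw [reflectGlue_of_nonneg hx.1.le]
  have hm : AEStronglyMeasurable (reflectGlue A B) intervalMeasure := by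
    rw [intervalMeasure_eq]
    exact aestronglyMeasurable_union_iff.2 ⟨h1.1, h2.1⟩
  rw [memLp_two_iff_integrable_sq hm, intervalMeasure_eq]
  exact IntegrableOn.union ((memLp_two_iff_integrable_sq h1.1).1 h1)
    ((memLp_two_iff_integrable_sq h2.1).1 h2)

/-- The square x^(2p) is integrable as 2p > -1. For p = -ν + 1/2 this is the condition ν < 1. -/
theorem memLp_two_rpow_mul {p : ℝ} (hp : -1 / 2 < p) {k : ℝ → ℝ} (hk : Continuous k) :
    MemLp (fun x => x ^ p * k x) 2 (volume.restrict (Set.Ioo 0 1)) := by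
  have hm : AEStronglyMeasurable (fun x : ℝ => x ^ p) (volume.restrict (Set.Ioo 0 1)) :=
    (measurable_id.pow_const p).aestronglyMeasurable
  have h1 : MemLp (fun x : ℝ => x ^ p) 2 (volume.restrict (Set.Ioo 0 1)) := by
    rw [memLp_two_iff_integrable_sq hm]
    have := (intervalIntegral.integrableOn_Ioo_rpow_iff (s := 2 * p) one_pos).2 (by linarith)
    refine Integrable.congr this ?_
    filter_upwards [ae_restrict_mem measurableSet_Ioo] with x hx
    rw [← Real.rpow_natCast (x ^ p) 2, ← Real.rpow_mul hx.1.le]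
    congr 1
    push_cast; ring
  obtain ⟨C, hC⟩ := isCompact_Icc.exists_bound_of_continuousOn (hk.continuousOn (s := Set.Icc 0 1))
  refine h1.of_le_mul (c := C) (hm.mul hk.aestronglyMeasurable) ?_
  filter_upwards [ae_restrict_mem measurableSet_Ioo] with x hx
  rw [norm_mul, mul_comm]
  gcongr
  exact hC x ⟨hx.1.le, hx.2.le⟩

/-! ### The regular part of the solutions -/

theorem rpow_eq_mul_sq {x : ℝ} (hx : 0 < x) (p : ℝ) : x ^ (p + 2) = x ^ p * x ^ 2 := by
  rw [Real.rpow_add hx]; norm_num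

section
variable {μ : ℝ} (hμ : -1 < μ) (E : ℝ)
include hμ

theorem besselSol_zero_energy (x : ℝ) : besselSol μ 0 x = x ^ (μ + 1 / 2) := by
  rw [besselSol, zero_mul, normBessel_zero hμ, mul_one]

/-- With s = E x² this extracts two extra powers of x from the difference between the solutions at
energies E and 0, with a continuous cofactor. -/
theorem normBessel_sub_one (s : ℝ) : normBessel μ s - 1 = s * dslope (normBessel μ) 0 s := by
  have := sub_smul_dslope (normBessel μ) 0 s
  rw [normBessel_zero hμ, sub_zero, smul_eq_mul] at this
  exact this.symm

theorem continuous_dslope_normBessel : Continuous (dslope (normBessel μ) 0) := by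
  refine continuous_iff_continuousAt.2 fun s => ?_
  by_cases hs : s = 0
  · subst hs
    exact continuousAt_dslope_same.2 (hasDerivAt_normBessel hμ 0).differentiableAt
  · exact (continuousAt_dslope_of_ne hs).2 (continuous_normBessel hμ).continuousAt

theorem besselSol_sub_eq {x : ℝ} (hx : 0 ≤ x) : besselSol μ E x - besselSol μ 0 x =
    x ^ (μ + 1 / 2 + 2) * (E * dslope (normBessel μ) 0 (E * x ^ 2)) := by
  rcases eq_or_lt_of_le hx with rfl | hx
  · rw [Real.zero_rpow (by linarith : μ + 1 / 2 + 2 ≠ 0)]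
    simp [besselSol]
  · rw [besselSol_zero_energy hμ, besselSol, rpow_eq_mul_sq hx]
    linear_combination x ^ (μ + 1 / 2) * normBessel_sub_one hμ (E * x ^ 2)

theorem besselSolDeriv_sub_eq {x : ℝ} (hx : 0 ≤ x) : besselSolDeriv μ E x - besselSolDeriv μ 0 x =
    x ^ (μ - 1 / 2 + 2) * (E * ((μ + 1 / 2) * dslope (normBessel μ) 0 (E * x ^ 2)
      + 2 * deriv (normBessel μ) (E * x ^ 2))) := by
  rcases eq_or_lt_of_le hx with rfl | hx
  -- At x = 0 neither term on the left depends on E, whatever value `rpow` assigns to 0^(μ-1/2).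
  · rw [Real.zero_rpow (by linarith : μ - 1 / 2 + 2 ≠ 0)]
    simp [besselSolDeriv]
  · rw [besselSolDeriv, besselSolDeriv, rpow_eq_mul_sq hx, zero_mul, normBessel_zero hμ]
    linear_combination x ^ (μ - 1 / 2) * (μ + 1 / 2) * normBessel_sub_one hμ (E * x ^ 2)

/-- The x^(μ-3/2) singularities of the two second derivatives cancel, leaving x^(μ+1/2), which is
square integrable. -/
theorem besselSol_secondDeriv_sub_eq {x : ℝ} (hx : 0 < x) :
    ((μ ^ 2 - 1 / 4) / x ^ 2 - E) * besselSol μ E x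
      - (μ ^ 2 - 1 / 4) / x ^ 2 * besselSol μ 0 x =
    x ^ (μ + 1 / 2) * (E * ((μ ^ 2 - 1 / 4) * dslope (normBessel μ) 0 (E * x ^ 2)
      - normBessel μ (E * x ^ 2))) := by
  have h := besselSol_sub_eq hμ E hx.le
  rw [rpow_eq_mul_sq hx] at h
  have h2 : besselSol μ E x = x ^ (μ + 1 / 2) * normBessel μ (E * x ^ 2) := rfl
  calc _ = (μ ^ 2 - 1 / 4) / x ^ 2 * (besselSol μ E x - besselSol μ 0 x) - E * besselSol μ E x := by
        ring
    _ = _ := by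
        rw [h, h2]
        field_simp

theorem continuousOn_besselSol_sub :
    ContinuousOn (fun x => besselSol μ E x - besselSol μ 0 x) (Set.Ici 0) := by
  have hT := continuous_dslope_normBessel hμ
  refine ContinuousOn.congr (Continuous.continuousOn ?_) fun x hx => besselSol_sub_eq hμ E hx
  exact (Real.continuous_rpow_const (by linarith)).mul
    (continuous_const.mul (hT.comp (by fun_prop)))

theorem continuousOn_besselSolDeriv_sub :
    ContinuousOn (fun x => besselSolDeriv μ E x - besselSolDeriv μ 0 x) (Set.Ici 0) := by
  have hT := continuous_dslope_normBessel hμ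
  have hP := continuous_deriv_normBessel hμ
  refine ContinuousOn.congr (Continuous.continuousOn ?_) fun x hx => besselSolDeriv_sub_eq hμ E hx
  exact (Real.continuous_rpow_const (by linarith)).mul
    (continuous_const.mul ((continuous_const.mul (hT.comp (by fun_prop))).add
      (continuous_const.mul (hP.comp (by fun_prop)))))

theorem memLp_besselSol : MemLp (besselSol μ E) 2 (volume.restrict (Set.Ioo 0 1)) :=
  memLp_two_rpow_mul (by linarith) ((continuous_normBessel hμ).comp (by fun_prop))

theorem memLp_besselSol_secondDeriv_sub :
    MemLp (fun x => ((μ ^ 2 - 1 / 4) / x ^ 2 - E) * besselSol μ E x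
      - (μ ^ 2 - 1 / 4) / x ^ 2 * besselSol μ 0 x) 2 (volume.restrict (Set.Ioo 0 1)) := by
  have hT := continuous_dslope_normBessel hμ
  have hP := continuous_normBessel hμ
  have hk : Continuous fun x => E * ((μ ^ 2 - 1 / 4) * dslope (normBessel μ) 0 (E * x ^ 2)
      - normBessel μ (E * x ^ 2)) :=
    continuous_const.mul ((continuous_const.mul (hT.comp (by fun_prop))).sub
      (hP.comp (by fun_prop)))
  refine (memLp_two_rpow_mul (p := μ + 1 / 2) (by linarith) hk).ae_eq ?_
  filter_upwards [ae_restrict_mem measurableSet_Ioo] with x hx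
  exact (besselSol_secondDeriv_sub_eq hμ E hx.1).symm

end

/-- The Wronskian is 2ν P M + 2s (P' M - P M') at s = E x², which `normBessel_wronskian` makes
constant. For ν ≠ 0 the two solutions are therefore independent at every energy. -/
theorem besselSol_wronskian {ν : ℝ} (h0 : -1 < ν) (h1 : ν < 1) (E : ℝ) {x : ℝ} (hx : 0 < x) :
    besselSolDeriv ν E x * besselSol (-ν) E x - besselSol ν E x * besselSolDeriv (-ν) E x
      = 2 * ν := by
  have hw := normBessel_wronskian h0 h1 (E * x ^ 2)
  have e1 : x ^ (ν - 1 / 2) * x ^ (-ν + 1 / 2) = 1 := by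
    rw [← Real.rpow_add hx]; simp
  have e2 : x ^ (ν + 1 / 2) * x ^ (-ν - 1 / 2) = 1 := by
    rw [← Real.rpow_add hx, show ν + 1 / 2 + (-ν - 1 / 2) = 0 by ring, Real.rpow_zero]
  simp only [besselSol, besselSolDeriv]
  set P := normBessel ν (E * x ^ 2)
  set M := normBessel (-ν) (E * x ^ 2)
  set P' := deriv (normBessel ν) (E * x ^ 2)
  set M' := deriv (normBessel (-ν)) (E * x ^ 2)
  linear_combination 2 * hw + (((ν + 1 / 2) * P + 2 * E * x ^ 2 * P') * M) * e1
    - (((-ν + 1 / 2) * M + 2 * E * x ^ 2 * M') * P) * e2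

/-! ### Uniqueness of regular solutions -/

/-- A crude form of Cauchy–Schwarz, from the pointwise bound |f| ≤ √x f² + 1/√x. Only the rate √x
matters. -/
theorem abs_integral_le_sqrt {f : ℝ → ℝ} (hf : MemLp f 2 (volume.restrict (Set.Ioo 0 1)))
    {x : ℝ} (hx : x ∈ Set.Ioo (0 : ℝ) 1) :
    |∫ t in 0..x, f t| ≤ ((∫ t in Set.Ioo 0 1, f t ^ 2) + 1) * √x := by
  have hsub : Set.Ioo 0 x ⊆ Set.Ioo 0 1 := Set.Ioo_subset_Ioo_right hx.2.le
  have hs := Real.sqrt_pos.2 hx.1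
  have hss : √x * √x = x := Real.mul_self_sqrt hx.1.le
  have hi : IntegrableOn f (Set.Ioo 0 1) := hf.integrable (by norm_num)
  have hi2 : IntegrableOn (fun t => f t ^ 2) (Set.Ioo 0 1) :=
    (memLp_two_iff_integrable_sq hf.1).1 hf
  have hc : IntegrableOn (fun _ : ℝ => 1 / √x) (Set.Ioo 0 x) := by simp
  rw [intervalIntegral.integral_of_le hx.1.le, integral_Ioc_eq_integral_Ioo]
  have h2 : ∫ t in Set.Ioo 0 x, f t ^ 2 ≤ ∫ t in Set.Ioo 0 1, f t ^ 2 :=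
    setIntegral_mono_set hi2 (Filter.Eventually.of_forall fun t => sq_nonneg _)
      hsub.eventuallyLE
  calc |∫ t in Set.Ioo 0 x, f t| ≤ ∫ t in Set.Ioo 0 x, |f t| := abs_integral_le_integral_abs
    _ ≤ ∫ t in Set.Ioo 0 x, (√x * f t ^ 2 + 1 / √x) := by
        refine integral_mono (hi.mono_set hsub).abs
          (((hi2.mono_set hsub).const_mul _).add hc) fun t => ?_
        have : √x * f t ^ 2 + 1 / √x - |f t| = ((√x * |f t| - 1 / 2) ^ 2 + 3 / 4) / √x := by
          field_simp
          rw [← sq_abs (f t)]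
          ring
        have : 0 ≤ ((√x * |f t| - 1 / 2) ^ 2 + 3 / 4) / √x := by positivity
        simp only
        linarith
    _ = √x * (∫ t in Set.Ioo 0 x, f t ^ 2) + √x := by
        rw [integral_add ((hi2.mono_set hsub).const_mul _) hc, integral_const_mul]
        congr 1
        simp only [integral_const, smul_eq_mul, measureReal_restrict_apply_univ]
        rw [Real.volume_real_Ioo_of_le hx.1.le]
        field_simp
        nlinarith
    _ ≤ _ := by nlinarith

/-- D'' in L² and zero data give D' = O(√x) and D = O(x^(3/2)). The Wronskian of D with the solution
of order μ = ±ν is then O(x^(μ+1)), so it tends to 0; being constant, it vanishes, and two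
independent solutions force D = 0. -/
theorem eq_zero_of_regular_solution {ν : ℝ} (hν0 : 0 < ν) (hν1 : ν < 1) {E : ℝ}
    {D D₁ D₂ : ℝ → ℝ} (hD : ContinuousOn D (Set.Icc 0 1)) (hD₁ : ContinuousOn D₁ (Set.Icc 0 1))
    (h0 : D 0 = 0) (h₁0 : D₁ 0 = 0) (hd : ∀ x ∈ Set.Ioo 0 1, HasDerivAt D (D₁ x) x)
    (hd₁ : ∀ x ∈ Set.Ioo 0 1, HasDerivAt D₁ (D₂ x) x)
    (h2 : MemLp D₂ 2 (volume.restrict (Set.Ioo 0 1)))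
    (heq : ∀ x ∈ Set.Ioo 0 1, D₂ x = ((ν ^ 2 - 1 / 4) / x ^ 2 - E) * D x) :
    ∀ x ∈ Set.Icc 0 1, D x = 0 := by
  set C := (∫ t in Set.Ioo 0 1, D₂ t ^ 2) + 1 with hC
  have hC0 : 0 ≤ C := add_nonneg (integral_nonneg fun t => sq_nonneg _) zero_le_one
  have hi : IntegrableOn D₂ (Set.Ioo 0 1) := h2.integrable (by norm_num)
  have b1 : ∀ x ∈ Set.Ioo (0 : ℝ) 1, |D₁ x| ≤ C * √x := by
    intro x hx
    have := intervalIntegral.integral_eq_sub_of_hasDerivAt_of_le hx.1.le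
      (hD₁.mono (Set.Icc_subset_Icc_right hx.2.le))
      (fun y hy => hd₁ y ⟨hy.1, hy.2.trans hx.2⟩)
      ((intervalIntegrable_iff_integrableOn_Ioo_of_le hx.1.le).2
        (hi.mono_set (Set.Ioo_subset_Ioo_right hx.2.le)))
    rw [h₁0, sub_zero] at this
    rw [← this]
    exact abs_integral_le_sqrt h2 hx
  have b0 : ∀ x ∈ Set.Ioo (0 : ℝ) 1, |D x| ≤ C * √x * x := by
    intro x hx
    obtain ⟨c, hc, hce⟩ := exists_hasDerivAt_eq_slope D D₁ hx.1
      (hD.mono (Set.Icc_subset_Icc_right hx.2.le)) (fun y hy => hd y ⟨hy.1, hy.2.trans hx.2⟩)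
    rw [h0, sub_zero, sub_zero, eq_div_iff hx.1.ne'] at hce
    rw [← hce, abs_mul, abs_of_pos hx.1]
    gcongr
    · exact hx.1.le
    · exact (b1 c ⟨hc.1, hc.2.trans hx.2⟩).trans
        (mul_le_mul_of_nonneg_left (Real.sqrt_le_sqrt hc.2.le) hC0)
  have key : ∀ μ : ℝ, -1 < μ → μ ^ 2 = ν ^ 2 → ∀ x ∈ Set.Ioo (0 : ℝ) 1,
      D x * besselSolDeriv μ E x - D₁ x * besselSol μ E x = 0 := by
    intro μ hμ hμν x hx
    set W : ℝ → ℝ := fun x => D x * besselSolDeriv μ E x - D₁ x * besselSol μ E x with hW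
    have hWd : ∀ y ∈ Set.Ioo (0 : ℝ) 1, HasDerivAt W 0 y := by
      intro y hy
      refine (((hd y hy).mul (hasDerivAt_besselSolDeriv hμ E hy.1)).sub
        ((hd₁ y hy).mul (hasDerivAt_besselSol hμ E hy.1))).congr_deriv ?_
      rw [heq y hy, hμν]
      ring
    have hWc : ∀ y ∈ Set.Ioo (0 : ℝ) 1, W x = W y := fun y hy =>
      isOpen_Ioo.is_const_of_deriv_eq_zero isPreconnected_Ioo
        (fun z hz => (hWd z hz).differentiableAt.differentiableWithinAt)
        (fun z hz => (hWd z hz).deriv) hx hy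
    have hPc := continuous_normBessel hμ
    have hPc' := continuous_deriv_normBessel hμ
    obtain ⟨K₀, hK₀⟩ := isCompact_Icc.exists_bound_of_continuousOn (s := Set.Icc (0 : ℝ) 1)
      (f := fun x => normBessel μ (E * x ^ 2)) (hPc.comp (by fun_prop)).continuousOn
    obtain ⟨K₁, hK₁⟩ := isCompact_Icc.exists_bound_of_continuousOn (s := Set.Icc (0 : ℝ) 1)
      (f := fun x => (μ + 1 / 2) * normBessel μ (E * x ^ 2)
        + 2 * E * x ^ 2 * deriv (normBessel μ) (E * x ^ 2))
      ((continuous_const.mul (hPc.comp (by fun_prop))).add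
        (Continuous.mul (by fun_prop) (hPc'.comp (by fun_prop)))).continuousOn
    have hbound : ∀ y ∈ Set.Ioo (0 : ℝ) 1, |W x| ≤ C * (K₁ + K₀) * y ^ (μ + 1) := by
      intro y hy
      have hyI : y ∈ Set.Icc (0 : ℝ) 1 := ⟨hy.1.le, hy.2.le⟩
      have e0 : √y * y ^ (μ + 1 / 2) = y ^ (μ + 1) := by
        rw [Real.sqrt_eq_rpow, ← Real.rpow_add hy.1]; ring_nf
      have e1 : √y * y * y ^ (μ - 1 / 2) = y ^ (μ + 1) := by
        rw [← e0, rpow_add_half_eq hy.1]; ring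
      have p1 := (Real.rpow_pos_of_pos hy.1 (μ - 1 / 2)).le
      have p0 := (Real.rpow_pos_of_pos hy.1 (μ + 1 / 2)).le
      have q1 : |besselSolDeriv μ E y| ≤ y ^ (μ - 1 / 2) * K₁ := by
        rw [besselSolDeriv, abs_mul, abs_of_nonneg p1]
        exact mul_le_mul_of_nonneg_left (hK₁ y hyI) p1
      have q0 : |besselSol μ E y| ≤ y ^ (μ + 1 / 2) * K₀ := by
        rw [besselSol, abs_mul, abs_of_nonneg p0]
        exact mul_le_mul_of_nonneg_left (hK₀ y hyI) p0
      have hy0 := hy.1.le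
      rw [hWc y hy]
      calc |W y| ≤ |D y| * |besselSolDeriv μ E y| + |D₁ y| * |besselSol μ E y| := by
            rw [← abs_mul, ← abs_mul]; exact abs_sub _ _
        _ ≤ (C * √y * y) * (y ^ (μ - 1 / 2) * K₁) + (C * √y) * (y ^ (μ + 1 / 2) * K₀) := by
            gcongr
            · exact b0 y hy
            · exact b1 y hy
        _ = _ := by linear_combination C * K₁ * e1 + C * K₀ * e0
    have ht : Filter.Tendsto (fun y : ℝ => C * (K₁ + K₀) * y ^ (μ + 1)) (nhdsWithin 0 (Set.Ioi 0))
        (nhds 0) := by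
      have h := (Real.continuous_rpow_const (q := μ + 1) (by linarith)).tendsto 0
      rw [Real.zero_rpow (by linarith)] at h
      simpa using (h.mono_left nhdsWithin_le_nhds).const_mul (C * (K₁ + K₀))
    have : |W x| ≤ 0 := by
      refine ge_of_tendsto ht ?_
      filter_upwards [Ioo_mem_nhdsGT (zero_lt_one' ℝ)] with y hy using hbound y hy
    exact abs_nonpos_iff.1 this
  have hIoo : Set.EqOn D 0 (Set.Ioo 0 1) := by
    intro x hx
    have k1 := key ν (by linarith) rfl x hx
    have k2 := key (-ν) (by linarith) (by ring) x hx
    have hw := besselSol_wronskian (by linarith) hν1 E hx.1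
    have : D x * (2 * ν) = 0 := by
      rw [← hw]
      linear_combination besselSol (-ν) E x * k1 - besselSol ν E x * k2
    simpa [hν0.ne'] using this
  exact hIoo.of_subset_closure hD continuousOn_const Set.Ioo_subset_Icc_self
    (closure_Ioo zero_ne_one).ge

/-! ### Combinations of solutions on the two half-intervals -/

/-- A linear combination of the two basic solutions. -/
def solPair (ν E c d x : ℝ) : ℝ := c * besselSol ν E x + d * besselSol (-ν) E x

/-- The derivative of `solPair ν E c d`. -/
def solPairDeriv (ν E c d x : ℝ) : ℝ := c * besselSolDeriv ν E x + d * besselSolDeriv (-ν) E x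

theorem solPair_one (ν E c d : ℝ) :
    solPair ν E c d 1 = c * normBessel ν E + d * normBessel (-ν) E := by
  simp [solPair, besselSol]

theorem solPair_sub_zero (ν E c d : ℝ) : solPair ν E c d 0 - solPair ν 0 c d 0 = 0 := by
  simp [solPair, besselSol]

theorem solPairDeriv_sub_zero (ν E c d : ℝ) :
    solPairDeriv ν E c d 0 - solPairDeriv ν 0 c d 0 = 0 := by
  simp [solPairDeriv, besselSolDeriv]

/-- At energy 0 the basic solutions are pure powers, so the singular part is itself a zero-energy
solution on each side. -/
theorem singularPart_eq {ν : ℝ} (h0 : -1 < ν) (h1 : ν < 1) (a b c d x : ℝ) :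
    singularPart ν a b c d x = reflectGlue (solPair ν 0 a b) (solPair ν 0 c d) x := by
  have h0' : -1 < -ν := by linarith
  simp only [singularPart, reflectGlue, solPair, besselSol_zero_energy h0,
    besselSol_zero_energy h0']
  split_ifs with h
  · rw [abs_of_neg h]
  · rw [abs_of_nonneg (not_lt.1 h)]

section
variable {ν : ℝ} (hν0 : 0 < ν) (hν1 : ν < 1) (E : ℝ)
include hν0 hν1

theorem hasDerivAt_solPair (c d : ℝ) {x : ℝ} (hx : 0 < x) :
    HasDerivAt (solPair ν E c d) (solPairDeriv ν E c d x) x :=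
  ((hasDerivAt_besselSol (by linarith) E hx).const_mul c).add
    ((hasDerivAt_besselSol (by linarith) E hx).const_mul d)

theorem hasDerivAt_solPairDeriv (c d : ℝ) {x : ℝ} (hx : 0 < x) :
    HasDerivAt (solPairDeriv ν E c d) (((ν ^ 2 - 1 / 4) / x ^ 2 - E) * solPair ν E c d x) x := by
  refine (((hasDerivAt_besselSolDeriv (by linarith) E hx).const_mul c).add
    ((hasDerivAt_besselSolDeriv (μ := -ν) (by linarith) E hx).const_mul d)).congr_deriv ?_
  rw [solPair]
  ring

theorem memLp_solPair (c d : ℝ) : MemLp (solPair ν E c d) 2 (volume.restrict (Set.Ioo 0 1)) :=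
  ((memLp_besselSol (by linarith) E).const_mul c).add
    ((memLp_besselSol (by linarith) E).const_mul d)

/-- Cramer's rule at x = 1/2, with determinant the Wronskian 2ν. -/
theorem solPair_coeff_eq_zero {c d : ℝ} (h : ∀ x ∈ Set.Ioo (0 : ℝ) 1, solPair ν E c d x = 0) :
    c = 0 ∧ d = 0 := by
  have hx : (1 / 2 : ℝ) ∈ Set.Ioo (0 : ℝ) 1 := by norm_num
  have hd : solPairDeriv ν E c d (1 / 2) = 0 := by
    refine (hasDerivAt_solPair hν0 hν1 E c d hx.1).unique ?_
    refine (hasDerivAt_const _ (0 : ℝ)).congr_of_eventuallyEq ?_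
    filter_upwards [isOpen_Ioo.mem_nhds hx] with y hy using h y hy
  have h0 := h _ hx
  have hw := besselSol_wronskian (by linarith) hν1 E hx.1
  rw [solPair] at h0
  rw [solPairDeriv] at hd
  constructor
  · have : c * (2 * ν) = 0 := by
      rw [← hw]
      linear_combination besselSol (-ν) E (1 / 2) * hd - besselSolDeriv (-ν) E (1 / 2) * h0
    simpa [hν0.ne'] using this
  · have : d * (2 * ν) = 0 := by
      rw [← hw]
      linear_combination besselSolDeriv ν E (1 / 2) * h0 - besselSol ν E (1 / 2) * hd
    simpa [hν0.ne'] using this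

/-! The regular part `solPair ν E c d - solPair ν 0 c d`. -/

theorem continuousOn_solPair_sub (c d : ℝ) :
    ContinuousOn (fun x => solPair ν E c d x - solPair ν 0 c d x) (Set.Ici 0) := by
  have h₁ := continuousOn_besselSol_sub (μ := ν) (by linarith) E
  have h₂ := continuousOn_besselSol_sub (μ := -ν) (by linarith) E
  refine ((h₁.const_mul c).add (h₂.const_mul d)).congr fun x _ => ?_
  simp only [solPair, Pi.add_apply]
  ring

theorem continuousOn_solPairDeriv_sub (c d : ℝ) :
    ContinuousOn (fun x => solPairDeriv ν E c d x - solPairDeriv ν 0 c d x) (Set.Ici 0) := by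
  have h₁ := continuousOn_besselSolDeriv_sub (μ := ν) (by linarith) E
  have h₂ := continuousOn_besselSolDeriv_sub (μ := -ν) (by linarith) E
  refine ((h₁.const_mul c).add (h₂.const_mul d)).congr fun x _ => ?_
  simp only [solPairDeriv, Pi.add_apply]
  ring

theorem hasDerivAt_solPair_sub (c d : ℝ) {x : ℝ} (hx : 0 < x) :
    HasDerivAt (fun x => solPair ν E c d x - solPair ν 0 c d x)
      (solPairDeriv ν E c d x - solPairDeriv ν 0 c d x) x :=
  (hasDerivAt_solPair hν0 hν1 E c d hx).sub (hasDerivAt_solPair hν0 hν1 0 c d hx)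

theorem hasDerivAt_solPairDeriv_sub (c d : ℝ) {x : ℝ} (hx : 0 < x) :
    HasDerivAt (fun x => solPairDeriv ν E c d x - solPairDeriv ν 0 c d x)
      (((ν ^ 2 - 1 / 4) / x ^ 2 - E) * solPair ν E c d x
        - (ν ^ 2 - 1 / 4) / x ^ 2 * solPair ν 0 c d x) x :=
  ((hasDerivAt_solPairDeriv hν0 hν1 E c d hx).sub
    (hasDerivAt_solPairDeriv hν0 hν1 0 c d hx)).congr_deriv (by ring)

theorem memLp_solPair_secondDeriv_sub (c d : ℝ) :
    MemLp (fun x => ((ν ^ 2 - 1 / 4) / x ^ 2 - E) * solPair ν E c d x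
        - (ν ^ 2 - 1 / 4) / x ^ 2 * solPair ν 0 c d x) 2 (volume.restrict (Set.Ioo 0 1)) := by
  have h := ((memLp_besselSol_secondDeriv_sub (μ := ν) (by linarith) E).const_mul c).add
    ((memLp_besselSol_secondDeriv_sub (μ := -ν) (by linarith) E).const_mul d)
  refine h.ae_eq (Filter.Eventually.of_forall fun x => ?_)
  simp only [Pi.add_apply, solPair]
  ring

/-! Solutions on both sides of the origin. -/

theorem hasDerivAt_reflectGlue_solPair (a b c d : ℝ) {x : ℝ} (hx : x ≠ 0) :
    HasDerivAt (reflectGlue (solPair ν E a b) (solPair ν E c d))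
      (reflectGlue (fun y => -solPairDeriv ν E a b y) (solPairDeriv ν E c d) x) x :=
  hasDerivAt_reflectGlue (fun _ h => hasDerivAt_solPair hν0 hν1 E a b h)
    (fun _ h => hasDerivAt_solPair hν0 hν1 E c d h) hx

theorem hasDerivAt_reflectGlue_solPairDeriv (a b c d : ℝ) {x : ℝ} (hx : x ≠ 0) :
    HasDerivAt (reflectGlue (fun y => -solPairDeriv ν E a b y) (solPairDeriv ν E c d))
      (((ν ^ 2 - 1 / 4) / x ^ 2 - E) * reflectGlue (solPair ν E a b) (solPair ν E c d) x) x := by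
  refine (hasDerivAt_reflectGlue (fun _ h => (hasDerivAt_solPairDeriv hν0 hν1 E a b h).neg)
    (fun _ h => hasDerivAt_solPairDeriv hν0 hν1 E c d h) hx).congr_deriv ?_
  rcases lt_or_gt_of_ne hx with h | h
  · simp [reflectGlue_of_neg h]
  · simp [reflectGlue_of_nonneg h.le]

theorem continuousOn_reflectGlue_solPair (a b c d : ℝ) :
    ContinuousOn (reflectGlue (solPair ν E a b) (solPair ν E c d)) puncturedInterval := by
  refine continuousOn_puncturedInterval_reflectGlue ?_ ?_ <;>
  exact fun x hx => (hasDerivAt_solPair hν0 hν1 E _ _ hx).continuousAt.continuousWithinAt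

end

/-! ### The weak eigenvalue equation -/

theorem ne_zero_of_mem_puncturedInterval {x : ℝ} (hx : x ∈ puncturedInterval) : x ≠ 0 := by
  rcases hx with h | h
  · exact h.2.ne
  · exact h.1.ne'

theorem continuousOn_potential (ν : ℝ) :
    ContinuousOn (fun x : ℝ => (ν ^ 2 - 1 / 4) / x ^ 2) puncturedInterval :=
  continuousOn_const.div (continuous_pow 2).continuousOn fun _ hx =>
    pow_ne_zero 2 (ne_zero_of_mem_puncturedInterval hx)

theorem integral_mul_deriv_deriv {U : Set ℝ} (hU : IsOpen U) {u u₁ u₂ φ : ℝ → ℝ}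
    (hφ : IsTestFunction U φ) (h₁ : ∀ x ∈ U, HasDerivAt u (u₁ x) x)
    (h₂ : ∀ x ∈ U, HasDerivAt u₁ (u₂ x) x) (hc : ContinuousOn u₂ U) :
    ∫ x, u x * deriv (deriv φ) x = ∫ x, u₂ x * φ x := by
  have hc₁ : ContinuousOn u₁ U := fun x hx => (h₂ x hx).continuousAt.continuousWithinAt
  have e1 := hasWeakDerivOn_of_hasDerivAt hU h₁ hc₁ _ hφ.deriv
  have e2 := hasWeakDerivOn_of_hasDerivAt hU h₂ hc _ hφ
  rw [hφ.deriv.deriv.setIntegral_mul, hφ.deriv.setIntegral_mul] at e1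
  rw [hφ.deriv.setIntegral_mul, hφ.setIntegral_mul] at e2
  rw [e1, e2, neg_neg]

theorem integral_operator_eq (ν : ℝ) {h φ : ℝ → ℝ} (hφ : IsTestFunction puncturedInterval φ)
    (hh : ContinuousOn h puncturedInterval) :
    ∫ x, h x * (-iteratedDeriv 2 φ x + (ν ^ 2 - 1 / 4) / x ^ 2 * φ x) ∂intervalMeasure =
      -(∫ x, h x * deriv (deriv φ) x) + ∫ x, (ν ^ 2 - 1 / 4) / x ^ 2 * h x * φ x := by
  have hφ' := hφ.mono puncturedInterval_subset
  have i1 : Integrable fun x => -(h x * deriv (deriv φ) x) :=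
    (hφ.deriv.deriv.integrable_mul isOpen_puncturedInterval hh).neg
  have i2 : Integrable fun x => (ν ^ 2 - 1 / 4) / x ^ 2 * h x * φ x :=
    hφ.integrable_mul isOpen_puncturedInterval ((continuousOn_potential ν).mul hh)
  rw [← integral_neg, ← integral_add i1 i2, intervalMeasure,
    setIntegral_eq_integral_of_forall_compl_eq_zero]
  · refine integral_congr_ae (Filter.Eventually.of_forall fun x => ?_)
    simp only [iteratedDeriv_succ, iteratedDeriv_zero]
    ring
  · intro x hx
    simp only [iteratedDeriv_succ, iteratedDeriv_zero]
    rw [hφ'.eq_zero hx, hφ'.deriv.deriv.eq_zero hx]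
    ring

/-- Used at energy E to verify eigenfunctions and at energy 0 to remove the singular part from the
equation. -/
theorem integral_operator_solPair {ν : ℝ} (hν0 : 0 < ν) (hν1 : ν < 1) (E a b c d : ℝ)
    {φ : ℝ → ℝ} (hφ : IsTestFunction puncturedInterval φ) :
    -(∫ x, reflectGlue (solPair ν E a b) (solPair ν E c d) x * deriv (deriv φ) x)
      + ∫ x, (ν ^ 2 - 1 / 4) / x ^ 2 * reflectGlue (solPair ν E a b) (solPair ν E c d) x * φ x
      = E * ∫ x, reflectGlue (solPair ν E a b) (solPair ν E c d) x * φ x := by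
  set u := reflectGlue (solPair ν E a b) (solPair ν E c d)
  have huc : ContinuousOn u puncturedInterval := continuousOn_reflectGlue_solPair hν0 hν1 E a b c d
  have hV := continuousOn_potential ν
  have h := integral_mul_deriv_deriv isOpen_puncturedInterval hφ
    (fun x hx => hasDerivAt_reflectGlue_solPair hν0 hν1 E a b c d
      (ne_zero_of_mem_puncturedInterval hx))
    (fun x hx => hasDerivAt_reflectGlue_solPairDeriv hν0 hν1 E a b c d
      (ne_zero_of_mem_puncturedInterval hx)) ((hV.sub continuousOn_const).mul huc)
  have i1 : Integrable fun x => (ν ^ 2 - 1 / 4) / x ^ 2 * u x * φ x :=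
    hφ.integrable_mul isOpen_puncturedInterval (hV.mul huc)
  have i2 : Integrable fun x => -(((ν ^ 2 - 1 / 4) / x ^ 2 - E) * u x * φ x) :=
    (hφ.integrable_mul isOpen_puncturedInterval ((hV.sub continuousOn_const).mul huc)).neg
  rw [h, ← integral_const_mul, ← integral_neg, ← integral_add i2 i1]
  refine integral_congr_ae (Filter.Eventually.of_forall fun x => ?_)
  simp only
  ring

theorem integral_mul_test {f φ : ℝ → ℝ} (hφ : IsTestFunction puncturedInterval φ) :
    ∫ x, f x * φ x ∂intervalMeasure = ∫ x, f x * φ x :=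
  (hφ.mono puncturedInterval_subset).setIntegral_mul f

section
variable {ν : ℝ} (hν0 : 0 < ν) (hν1 : ν < 1) {E : ℝ}
include hν0 hν1

/-- Values and first derivatives of both halves vanish at 0, so the gluing is C¹ there, and the
second derivative is square integrable on each side. -/
theorem isRegularPart_solPair_sub (E a b c d : ℝ) :
    IsRegularPart (reflectGlue (fun x => solPair ν E a b x - solPair ν 0 a b x)
      (fun x => solPair ν E c d x - solPair ν 0 c d x)) := by
  have hc := continuous_reflectGlue (continuousOn_solPair_sub hν0 hν1 E a b)
    (continuousOn_solPair_sub hν0 hν1 E c d)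
    ((solPair_sub_zero ν E a b).trans (solPair_sub_zero ν E c d).symm)
  have hc₁ := continuous_reflectGlue (continuousOn_solPairDeriv_sub hν0 hν1 E a b).neg
    (continuousOn_solPairDeriv_sub hν0 hν1 E c d) (by
      simp only [Pi.neg_apply]
      rw [solPairDeriv_sub_zero, solPairDeriv_sub_zero, neg_zero])
  -- Each differentiation of the reflected half contributes a sign; the double negation matches the
  -- form produced by `hasDerivAt_reflectGlue`.
  have h₂ := memLp_two_reflectGlue (memLp_solPair_secondDeriv_sub hν0 hν1 E a b).neg.neg
    (memLp_solPair_secondDeriv_sub hν0 hν1 E c d)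
  have hmem : ∀ {g : ℝ → ℝ}, Continuous g → MemLp g 2 intervalMeasure := by
    intro g hg
    obtain ⟨C, hC⟩ := isCompact_Icc.exists_bound_of_continuousOn
      (hg.continuousOn (s := Set.Icc (-1) 1))
    refine MemLp.of_bound hg.aestronglyMeasurable C ?_
    rw [intervalMeasure]
    filter_upwards [ae_restrict_mem measurableSet_Ioo] with x hx
    exact hC x ⟨hx.1.le, hx.2.le⟩
  have hint : ∀ {g : ℝ → ℝ}, MemLp g 2 intervalMeasure → IntegrableOn g (Set.Ioo (-1) 1) :=
    fun hg => hg.integrable (by norm_num)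
  refine ⟨_, _, hmem hc, hmem hc₁, h₂, ?_, ?_, hc.continuousOn, hc₁.continuousOn, ?_, ?_⟩
  · refine hasWeakDerivOn_of_hasDerivAt_off_point (c := 0) (by norm_num) hc.continuousOn
      (fun x _ hx => ?_) (hint (hmem hc₁))
    exact hasDerivAt_reflectGlue (fun _ h => hasDerivAt_solPair_sub hν0 hν1 E a b h)
      (fun _ h => hasDerivAt_solPair_sub hν0 hν1 E c d h) hx
  · refine hasWeakDerivOn_of_hasDerivAt_off_point (c := 0) (by norm_num) hc₁.continuousOn
      (fun x _ hx => ?_) (hint h₂)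
    exact hasDerivAt_reflectGlue (fun _ h => (hasDerivAt_solPairDeriv_sub hν0 hν1 E a b h).neg)
      (fun _ h => hasDerivAt_solPairDeriv_sub hν0 hν1 E c d h) hx
  · rw [reflectGlue_of_nonneg le_rfl, solPair_sub_zero]
  · rw [reflectGlue_of_nonneg le_rfl, solPairDeriv_sub_zero]

theorem singularPart_one (a b c d : ℝ) : singularPart ν a b c d 1 = solPair ν 0 c d 1 := by
  rw [singularPart_eq (by linarith) hν1, reflectGlue_of_nonneg zero_le_one]

theorem singularPart_neg_one (a b c d : ℝ) :
    singularPart ν a b c d (-1) = solPair ν 0 a b 1 := by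
  rw [singularPart_eq (by linarith) hν1, reflectGlue_of_neg (by norm_num), neg_neg]

/-- The solution at energy E splits into the zero-energy solution with the same coefficients, which
is its singular part, and a regular remainder. -/
theorem isEigenvalue_of_coeffs {a b c d : ℝ}
    (hm : a * normBessel ν E + b * normBessel (-ν) E = 0)
    (hp : c * normBessel ν E + d * normBessel (-ν) E = 0) (hsum : a + b + c + d = 0)
    (hder : (ν + 1 / 2) * a + (-ν + 1 / 2) * b = (ν + 1 / 2) * c + (-ν + 1 / 2) * d)
    (hne : ¬ (c = 0 ∧ d = 0)) : IsEigenvalue ν E := by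
  set u := reflectGlue (solPair ν E a b) (solPair ν E c d) with hu
  have hmem : MemLp u 2 intervalMeasure :=
    memLp_two_reflectGlue (memLp_solPair hν0 hν1 E a b) (memLp_solPair hν0 hν1 E c d)
  have huc : ContinuousOn u puncturedInterval := continuousOn_reflectGlue_solPair hν0 hν1 E a b c d
  have hfu : hmem.toLp u =ᵐ[intervalMeasure] u := hmem.coeFn_toLp
  refine ⟨hmem.toLp u, ⟨_, a, b, c, d, isRegularPart_solPair_sub hν0 hν1 E a b c d, ?_, ?_, ?_,
    hsum, hder⟩, ?_, ?_⟩
  · filter_upwards [hfu] with x hx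
    rw [hx, singularPart_eq (by linarith) hν1]
    simp only [hu, reflectGlue]
    split_ifs <;> ring
  · rw [singularPart_neg_one hν0 hν1, reflectGlue_of_neg (by norm_num), neg_neg, sub_add_cancel,
      solPair_one, hm]
  · rw [singularPart_one hν0 hν1, reflectGlue_of_nonneg zero_le_one, sub_add_cancel,
      solPair_one, hp]
  · intro h0
    have hu0 : u =ᵐ[volume.restrict puncturedInterval] 0 := by
      rw [← intervalMeasure_eq]
      exact hfu.symm.trans (Lp.eq_zero_iff_ae_eq_zero.1 h0)
    have hz := Measure.eqOn_open_of_ae_eq hu0 isOpen_puncturedInterval huc continuousOn_const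
    refine hne (solPair_coeff_eq_zero hν0 hν1 E fun x hx => ?_)
    have := hz (Or.inr hx)
    rwa [hu, reflectGlue_of_nonneg hx.1.le] at this
  · intro φ hφ
    change IsTestFunction puncturedInterval φ at hφ
    have e1 : ∫ x, (hmem.toLp u) x * (-iteratedDeriv 2 φ x + (ν ^ 2 - 1 / 4) / x ^ 2 * φ x)
        ∂intervalMeasure = ∫ x, u x * (-iteratedDeriv 2 φ x + (ν ^ 2 - 1 / 4) / x ^ 2 * φ x)
        ∂intervalMeasure := by
      refine integral_congr_ae ?_
      filter_upwards [hfu] with x hx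
      rw [hx]
    have e2 : ∫ x, (E • hmem.toLp u) x * φ x ∂intervalMeasure =
        E * ∫ x, u x * φ x ∂intervalMeasure := by
      rw [← integral_const_mul]
      refine integral_congr_ae ?_
      filter_upwards [hfu, Lp.coeFn_smul E (hmem.toLp u)] with x hx hx'
      rw [hx', Pi.smul_apply, hx, smul_eq_mul, mul_assoc]
    rw [e1, e2, integral_operator_eq ν hφ huc, integral_mul_test hφ]
    exact integral_operator_solPair hν0 hν1 E a b c d hφ

/-- Eigenfunctions are combinations of the basic solutions on both sides, with the coefficients
of their singular parts. -/
theorem exists_coeffs_of_isEigenvalue (h : IsEigenvalue ν E) : ∃ a b c d : ℝ,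
    a * normBessel ν E + b * normBessel (-ν) E = 0 ∧
    c * normBessel ν E + d * normBessel (-ν) E = 0 ∧ a + b + c + d = 0 ∧
    (ν + 1 / 2) * a + (-ν + 1 / 2) * b = (ν + 1 / 2) * c + (-ν + 1 / 2) * d ∧
    ¬ (a = 0 ∧ b = 0 ∧ c = 0 ∧ d = 0) := by
  obtain ⟨f, ⟨fr, a, b, c, d, ⟨f₁, f₂, -, -, hf₂, hw₁, hw₂, hfc, hf₁c, hfr0, hf₁0⟩, hfe, hbm, hbp,
    hsum, hder⟩, hne, hop⟩ := h
  have hU := isOpen_puncturedInterval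
  set V : ℝ → ℝ := fun x => (ν ^ 2 - 1 / 4) / x ^ 2 with hV
  have hVc : ContinuousOn V puncturedInterval := continuousOn_potential ν
  set s := reflectGlue (solPair ν 0 a b) (solPair ν 0 c d) with hs
  have hsc : ContinuousOn s puncturedInterval := continuousOn_reflectGlue_solPair hν0 hν1 0 a b c d
  have hse : singularPart ν a b c d = s := funext (singularPart_eq (by linarith) hν1 a b c d)
  have hfcU : ContinuousOn fr puncturedInterval :=
    hfc.mono (puncturedInterval_subset.trans Set.Ioo_subset_Icc_self)
  have hf₁cU : ContinuousOn f₁ puncturedInterval :=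
    hf₁c.mono (puncturedInterval_subset.trans Set.Ioo_subset_Icc_self)
  -- The second derivative that the eigenvalue equation imposes on `fr`: the contribution V s
  -- cancels against s''.
  set w : ℝ → ℝ := fun x => V x * fr x - E * (fr x + s x) with hw
  have hwc : ContinuousOn w puncturedInterval :=
    (hVc.mul hfcU).sub (continuousOn_const.mul (hfcU.add hsc))
  have hd₁ : ∀ x ∈ Set.Ioo (-1 : ℝ) 1, HasDerivAt fr (f₁ x) x := fun x hx =>
    hw₁.hasDerivAt isOpen_Ioo (hfc.mono Set.Ioo_subset_Icc_self)
      (hf₁c.mono Set.Ioo_subset_Icc_self) hx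
  have hww : HasWeakDerivOn puncturedInterval f₁ w := by
    intro φ hφ
    have hφI := hφ.mono puncturedInterval_subset
    have e1 := hop φ hφ
    have e2 : ∫ x, f x * (-iteratedDeriv 2 φ x + (ν ^ 2 - 1 / 4) / x ^ 2 * φ x)
        ∂intervalMeasure = ∫ x, (fr x + s x) * (-iteratedDeriv 2 φ x
          + (ν ^ 2 - 1 / 4) / x ^ 2 * φ x) ∂intervalMeasure := by
      refine integral_congr_ae ?_
      filter_upwards [hfe] with x hx
      rw [hx, hse]
    have e3 : ∫ x, (E • f) x * φ x ∂intervalMeasure =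
        E * ∫ x, (fr x + s x) * φ x ∂intervalMeasure := by
      rw [← integral_const_mul]
      refine integral_congr_ae ?_
      filter_upwards [hfe, Lp.coeFn_smul E f] with x hx hx'
      rw [hx', Pi.smul_apply, hx, smul_eq_mul, mul_assoc, hse]
    have hadd : ContinuousOn (fun x => fr x + s x) puncturedInterval := hfcU.add hsc
    rw [e2, e3, integral_operator_eq ν hφ hadd, integral_mul_test hφ] at e1
    have e4 := integral_operator_solPair hν0 hν1 0 a b c d hφ
    rw [← hs, zero_mul] at e4
    have e5 := hw₁ _ hφI.deriv
    rw [hφI.deriv.deriv.setIntegral_mul, hφI.deriv.setIntegral_mul] at e5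
    have i1 := hφ.deriv.deriv.integrable_mul hU hfcU
    have i2 := hφ.deriv.deriv.integrable_mul hU hsc
    have i3 : Integrable fun x => V x * fr x * φ x := hφ.integrable_mul hU (hVc.mul hfcU)
    have i4 := hφ.integrable_mul hU (hVc.mul hsc)
    have i5 := hφ.integrable_mul hU hadd
    have s1 : ∫ x, (fr x + s x) * deriv (deriv φ) x =
        (∫ x, fr x * deriv (deriv φ) x) + ∫ x, s x * deriv (deriv φ) x := by
      simp only [add_mul]
      exact integral_add i1 i2
    have s2 : ∫ x, (ν ^ 2 - 1 / 4) / x ^ 2 * (fr x + s x) * φ x =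
        (∫ x, V x * fr x * φ x) + ∫ x, (ν ^ 2 - 1 / 4) / x ^ 2 * s x * φ x := by
      simp only [mul_add, add_mul]
      exact integral_add i3 i4
    have s3 : ∫ x, w x * φ x = (∫ x, V x * fr x * φ x) - E * ∫ x, (fr x + s x) * φ x := by
      rw [← integral_const_mul, ← integral_sub i3 (i5.const_mul E)]
      refine integral_congr_ae (Filter.Eventually.of_forall fun x => ?_)
      simp only [hw]
      ring
    rw [hφ.deriv.setIntegral_mul, hφ.setIntegral_mul, s3]
    rw [s1, s2] at e1
    linarith
  have hd₂ : ∀ x ∈ puncturedInterval, HasDerivAt f₁ (w x) x := fun x hx =>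
    hww.hasDerivAt hU hf₁cU hwc hx
  -- Square integrability is not visible from the formula for w; it comes from agreement a.e. with
  -- the weak second derivative `f₂` of the H² part.
  have hw2 : MemLp w 2 (volume.restrict puncturedInterval) := by
    have hw₂' : HasWeakDerivOn puncturedInterval f₁ f₂ := by
      intro φ hφ
      have hφI := hφ.mono puncturedInterval_subset
      have := hw₂ φ hφI
      rwa [hφI.deriv.setIntegral_mul, hφI.setIntegral_mul, ← hφ.deriv.setIntegral_mul,
        ← hφ.setIntegral_mul] at this
    have hfi : Integrable f₂ intervalMeasure := hf₂.integrable (by norm_num)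
    rw [intervalMeasure_eq] at hf₂ hfi
    exact hf₂.ae_eq (hw₂'.ae_eq hU hww hfi hwc)
  -- Since s is the zero-energy solution, this difference satisfies the homogeneous equation at
  -- energy E, with zero data at the origin.
  have hright : ∀ x ∈ Set.Icc (0 : ℝ) 1, fr x - (solPair ν E c d x - solPair ν 0 c d x) = 0 := by
    refine eq_zero_of_regular_solution hν0 hν1 (E := E)
      (D₁ := fun x => f₁ x - (solPairDeriv ν E c d x - solPairDeriv ν 0 c d x))
      (D₂ := fun x => w x - (((ν ^ 2 - 1 / 4) / x ^ 2 - E) * solPair ν E c d x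
        - (ν ^ 2 - 1 / 4) / x ^ 2 * solPair ν 0 c d x)) ?_ ?_ ?_ ?_ ?_ ?_ ?_ ?_
    · exact (hfc.mono (Set.Icc_subset_Icc_left (by norm_num))).sub
        ((continuousOn_solPair_sub hν0 hν1 E c d).mono fun x hx => hx.1)
    · exact (hf₁c.mono (Set.Icc_subset_Icc_left (by norm_num))).sub
        ((continuousOn_solPairDeriv_sub hν0 hν1 E c d).mono fun x hx => hx.1)
    · rw [solPair_sub_zero, hfr0, sub_zero]
    · rw [solPairDeriv_sub_zero, hf₁0, sub_zero]
    · exact fun x hx => (hd₁ x ⟨by linarith [hx.1], hx.2⟩).sub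
        (hasDerivAt_solPair_sub hν0 hν1 E c d hx.1)
    · exact fun x hx => (hd₂ x (Or.inr hx)).sub
        (hasDerivAt_solPairDeriv_sub hν0 hν1 E c d hx.1)
    · exact (hw2.mono_measure (Measure.restrict_mono Set.subset_union_right le_rfl)).sub
        (memLp_solPair_secondDeriv_sub hν0 hν1 E c d)
    · intro x hx
      simp only [hw, hV, hs, reflectGlue_of_nonneg hx.1.le]
      ring
  have hleft : ∀ x ∈ Set.Icc (0 : ℝ) 1,
      fr (-x) - (solPair ν E a b x - solPair ν 0 a b x) = 0 := by
    have hnegU : ∀ x ∈ Set.Ioo (0 : ℝ) 1, -x ∈ Set.Ioo (-1 : ℝ) 0 := fun x hx =>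
      ⟨by linarith [hx.2], by linarith [hx.1]⟩
    have hnegI : Set.MapsTo (fun x : ℝ => -x) (Set.Icc 0 1) (Set.Icc (-1) 1) := fun x hx =>
      ⟨by linarith [hx.2], by linarith [hx.1]⟩
    refine eq_zero_of_regular_solution hν0 hν1 (E := E)
      (D₁ := fun x => -f₁ (-x) - (solPairDeriv ν E a b x - solPairDeriv ν 0 a b x))
      (D₂ := fun x => w (-x) - (((ν ^ 2 - 1 / 4) / x ^ 2 - E) * solPair ν E a b x
        - (ν ^ 2 - 1 / 4) / x ^ 2 * solPair ν 0 a b x)) ?_ ?_ ?_ ?_ ?_ ?_ ?_ ?_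
    · exact (hfc.comp continuous_neg.continuousOn hnegI).sub
        ((continuousOn_solPair_sub hν0 hν1 E a b).mono fun x hx => hx.1)
    · exact (hf₁c.comp continuous_neg.continuousOn hnegI).neg.sub
        ((continuousOn_solPairDeriv_sub hν0 hν1 E a b).mono fun x hx => hx.1)
    · rw [solPair_sub_zero, neg_zero, hfr0, sub_zero]
    · rw [solPairDeriv_sub_zero, neg_zero, hf₁0, neg_zero, sub_zero]
    · intro x hx
      refine HasDerivAt.sub ?_ (hasDerivAt_solPair_sub hν0 hν1 E a b hx.1)
      exact ((hd₁ (-x) (puncturedInterval_subset (Or.inl (hnegU x hx)))).scomp x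
        (hasDerivAt_neg x)).congr_deriv (by simp)
    · intro x hx
      refine HasDerivAt.sub ?_ (hasDerivAt_solPairDeriv_sub hν0 hν1 E a b hx.1)
      exact ((hd₂ (-x) (Or.inl (hnegU x hx))).scomp x (hasDerivAt_neg x)).neg.congr_deriv (by simp)
    · exact ((hw2.mono_measure (Measure.restrict_mono Set.subset_union_left
        le_rfl)).comp_measurePreserving measurePreserving_neg_Ioo_right).sub
        (memLp_solPair_secondDeriv_sub hν0 hν1 E a b)
    · intro x hx
      simp only [hw, hV, hs, reflectGlue_of_neg (hnegU x hx).2, neg_neg, neg_sq]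
      ring
  refine ⟨a, b, c, d, ?_, ?_, hsum, hder, ?_⟩
  · have h1 := hleft 1 ⟨zero_le_one, le_rfl⟩
    rw [singularPart_neg_one hν0 hν1] at hbm
    rw [← solPair_one]
    linarith
  · have h1 := hright 1 ⟨zero_le_one, le_rfl⟩
    rw [singularPart_one hν0 hν1] at hbp
    rw [← solPair_one]
    linarith
  · rintro ⟨rfl, rfl, rfl, rfl⟩
    refine hne ((Lp.eq_zero_iff_ae_eq_zero).2 ?_)
    have hz : ∀ x, solPair ν 0 0 0 x = 0 := fun x => by simp [solPair]
    have hz' : ∀ x, solPair ν E 0 0 x = 0 := fun x => by simp [solPair]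
    have hI : ∀ᵐ x ∂intervalMeasure, x ∈ Set.Ioo (-1 : ℝ) 1 := ae_restrict_mem measurableSet_Ioo
    filter_upwards [hfe, hI] with x hx hxI
    rw [hx, hse]
    rcases lt_or_ge x 0 with h | h
    · have := hleft (-x) ⟨by linarith, by linarith [hxI.1]⟩
      rw [neg_neg, hz, hz'] at this
      rw [hs, reflectGlue_of_neg h, hz]
      simpa using this
    · have := hright x ⟨h, hxI.2.le⟩
      rw [hz, hz'] at this
      rw [hs, reflectGlue_of_nonneg h, hz]
      simpa using this

/-- The eigenvalues are the roots of two transcendental equations. -/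
theorem isEigenvalue_iff : IsEigenvalue ν E ↔ 1 * normBessel ν E = normBessel (-ν) E ∨
    (1 - 2 * ν) / (1 + 2 * ν) * normBessel ν E = normBessel (-ν) E := by
  have h12 : 0 < 1 + 2 * ν := by linarith
  have hmin : (1 - 2 * ν) / (1 + 2 * ν) * normBessel ν E = normBessel (-ν) E ↔
      (1 - 2 * ν) * normBessel ν E = (1 + 2 * ν) * normBessel (-ν) E := by
    rw [div_mul_eq_mul_div, div_eq_iff h12.ne', mul_comm (normBessel (-ν) E)]
  rw [hmin, one_mul]
  constructor
  · intro h
    obtain ⟨a, b, c, d, hm, hp, hsum, hder, hne⟩ := exists_coeffs_of_isEigenvalue hν0 hν1 h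
    by_contra! hcon
    obtain ⟨hc1, hc2⟩ := hcon
    -- The even part (a + c, b + d) sees only the sum condition; the odd part (a - c, b - d) below
    -- sees only the derivative condition.
    have e1 : (a + c) * (normBessel ν E - normBessel (-ν) E) = 0 := by
      linear_combination hm + hp - normBessel (-ν) E * hsum
    have e1' := (mul_eq_zero.1 e1).resolve_right (sub_ne_zero.2 hc1)
    have e2 : (b + d) = 0 := by linarith
    have e3 : (a - c) * ((1 - 2 * ν) * normBessel ν E - (1 + 2 * ν) * normBessel (-ν) E) = 0 := by
      linear_combination (1 - 2 * ν) * hm - (1 - 2 * ν) * hp - 2 * normBessel (-ν) E * hder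
    have e3' := (mul_eq_zero.1 e3).resolve_right (sub_ne_zero.2 hc2)
    have e4 : (b - d) * ((1 - 2 * ν) * normBessel ν E - (1 + 2 * ν) * normBessel (-ν) E) = 0 := by
      linear_combination 2 * normBessel ν E * hder - (1 + 2 * ν) * hm + (1 + 2 * ν) * hp
    have e4' := (mul_eq_zero.1 e4).resolve_right (sub_ne_zero.2 hc2)
    exact hne ⟨by linarith, by linarith, by linarith, by linarith⟩
  · rintro (h | h)
    -- An even eigenfunction whose coefficients sum to zero on each side.
    · refine isEigenvalue_of_coeffs hν0 hν1 (a := 1) (b := -1) (c := 1) (d := -1) ?_ ?_ ?_ ?_ ?_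
      · linarith
      · linarith
      · norm_num
      · ring
      · norm_num
    -- An odd eigenfunction for which each side of the derivative condition is zero separately.
    · refine isEigenvalue_of_coeffs hν0 hν1 (a := 1 - 2 * ν) (b := -(1 + 2 * ν))
        (c := -(1 - 2 * ν)) (d := 1 + 2 * ν) ?_ ?_ ?_ ?_ ?_
      · linarith
      · linarith
      · ring
      · ring
      · exact fun h => h12.ne' h.2

theorem isEigenvalue_zero : IsEigenvalue ν 0 := by
  refine (isEigenvalue_iff hν0 hν1).2 (Or.inl ?_)
  rw [normBessel_zero (by linarith), normBessel_zero (by linarith), one_mul]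

/-- From 0 < P < M and κ ≤ 1 it follows that κ P ≤ P < M for both values of κ. -/
theorem not_isEigenvalue_of_neg (hE : E < 0) : ¬ IsEigenvalue ν E := by
  rw [isEigenvalue_iff hν0 hν1]
  obtain ⟨h1, h2⟩ := normBessel_lt_of_neg hν0 hν1 hE
  have h12 : 0 < 1 + 2 * ν := by linarith
  rintro (h | h)
  · linarith
  · have : (1 - 2 * ν) / (1 + 2 * ν) ≤ 1 := by rw [div_le_one h12]; linarith
    nlinarith

end

end

/-! ### Localization and enumeration of the spectrum -/

theorem mainTheorem4 (ν : ℝ) (hν0 : 0 < ν) (hν1 : ν < 1) :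
    -- the numbers `j_{±ν,n}`, `n ≥ 1`, enumerate the positive zeros of `J_{±ν}` increasingly
    (∀ μ : ℝ, μ = ν ∨ μ = -ν →
      StrictMono (besselZero μ) ∧
      besselZero μ '' Set.Ici 1 = {x : ℝ | 0 < x ∧ besselJ μ x = 0}) ∧
    -- the positive eigenvalues are the solutions of the two equations
    (∀ E : ℝ, 0 < E → (IsEigenvalue ν E ↔ CondPlus ν E ∨ CondMinus ν E)) ∧
    -- solutions of the first equation
    (¬ ∃ E ∈ Set.Ioo 0 (besselZero (-ν) 1 ^ 2), CondPlus ν E) ∧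
    (∀ n : ℕ, 1 ≤ n →
      ¬ ∃ E ∈ Set.Icc (besselZero (-ν) n ^ 2) (besselZero ν n ^ 2), CondPlus ν E) ∧
    (∀ n : ℕ, 1 ≤ n →
      ∃! E : ℝ, E ∈ Set.Ioo (besselZero ν n ^ 2) (besselZero (-ν) (n + 1) ^ 2) ∧
        CondPlus ν E) ∧
    -- solutions of the second equation
    (ν < 1 / 2 →
      (∃! E : ℝ, E ∈ Set.Ioo 0 (besselZero (-ν) 1 ^ 2) ∧ CondMinus ν E) ∧
      (∀ n : ℕ, 1 ≤ n →
        ¬ ∃ E ∈ Set.Icc (besselZero (-ν) n ^ 2) (besselZero ν n ^ 2), CondMinus ν E) ∧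
      (∀ n : ℕ, 1 ≤ n →
        ∃! E : ℝ, E ∈ Set.Ioo (besselZero ν n ^ 2) (besselZero (-ν) (n + 1) ^ 2) ∧
          CondMinus ν E)) ∧
    (1 / 2 < ν →
      (¬ ∃ E ∈ Set.Ioc 0 (besselZero (-ν) 1 ^ 2), CondMinus ν E) ∧
      (∀ n : ℕ, 1 ≤ n →
        ∃! E : ℝ, E ∈ Set.Ioo (besselZero (-ν) n ^ 2) (besselZero ν n ^ 2) ∧
          CondMinus ν E) ∧
      (∀ n : ℕ, 1 ≤ n →
        ¬ ∃ E ∈ Set.Icc (besselZero ν n ^ 2) (besselZero (-ν) (n + 1) ^ 2),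
          CondMinus ν E)) ∧
    (ν = 1 / 2 →
      (∀ n : ℕ, 1 ≤ n → CondMinus ν (besselZero (-ν) n ^ 2)) ∧
      (∀ E : ℝ, 0 < E → (∀ n : ℕ, 1 ≤ n → E ≠ besselZero (-ν) n ^ 2) → ¬ CondMinus ν E)) ∧
    -- the resulting increasing enumeration of all the eigenvalues
    (∃ ev : ℕ → ℝ,
      ev 0 = 0 ∧
      (∀ n : ℕ, 1 ≤ n →
        ev (2 * n) ∈ Set.Ioo (besselZero ν n ^ 2) (besselZero (-ν) (n + 1) ^ 2) ∧
        CondPlus ν (ev (2 * n))) ∧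
      (∀ n : ℕ, CondMinus ν (ev (2 * n + 1))) ∧
      (ν < 1 / 2 →
        ev 1 ∈ Set.Ioo 0 (besselZero (-ν) 1 ^ 2) ∧
        ∀ n : ℕ, 1 ≤ n →
          ev (2 * n + 1) ∈
            Set.Ioo (besselZero ν n ^ 2) (besselZero (-ν) (n + 1) ^ 2)) ∧
      (1 / 2 < ν → ∀ n : ℕ, 1 ≤ n →
        ev (2 * n - 1) ∈ Set.Ioo (besselZero (-ν) n ^ 2) (besselZero ν n ^ 2)) ∧
      (ν = 1 / 2 → ∀ n : ℕ, 1 ≤ n → ev (2 * n - 1) = besselZero (-ν) n ^ 2) ∧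
      StrictMono ev ∧
      Set.range ev = {E : ℝ | IsEigenvalue ν E}) := by
  have hnz : ν ≠ 0 := hν0.ne'
  have h12 : 0 < 1 + 2 * ν := by linarith
  have hil := besselZero_sq_interlace hν0 hν1
  have hapos : ∀ n, 1 ≤ n → 0 < besselZero (-ν) n ^ 2 := fun n hn =>
    (besselZero_sq_pos hν0 hν1 hn).2
  have hmz := (besselZero_sq_spec (μ := -ν) (by linarith) (by linarith) (by linarith)).2
  set κ := (1 - 2 * ν) / (1 + 2 * ν) with hκ
  have hplus : ∀ {E : ℝ}, 0 < E → (CondPlus ν E ↔ 1 * normBessel ν E = normBessel (-ν) E) :=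
    fun hE => condPlus_iff hν0 hν1 hE
  have hminus : ∀ {E : ℝ}, 0 < E → (CondMinus ν E ↔ κ * normBessel ν E = normBessel (-ν) E) :=
    fun hE => condMinus_iff hν0 hν1 hE
  have hκpos : ν < 1 / 2 → 0 < κ ∧ κ < 1 := fun h =>
    ⟨div_pos (by linarith) h12, (div_lt_one h12).2 (by linarith)⟩
  have hκneg : 1 / 2 < ν → κ < 0 := fun h => div_neg_of_neg_of_pos (by linarith) h12
  have unique_congr : ∀ {S : Set ℝ} {p q : ℝ → Prop}, (∀ s ∈ S, p s ↔ q s) →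
      (∃! s, s ∈ S ∧ p s) → ∃! s, s ∈ S ∧ q s := by
    rintro S p q hpq ⟨s, ⟨hs, hps⟩, hu⟩
    exact ⟨s, ⟨hs, (hpq s hs).1 hps⟩, fun t ht => hu t ⟨ht.1, (hpq t ht.1).2 ht.2⟩⟩
  have pos_of_gt : ∀ {μ : ℝ} {n : ℕ} {s : ℝ}, besselZero μ n ^ 2 < s → 0 < s := fun h =>
    (sq_nonneg _).trans_lt h
  have eig : ∀ E : ℝ, 0 < E → (IsEigenvalue ν E ↔ CondPlus ν E ∨ CondMinus ν E) := by
    intro E hE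
    rw [isEigenvalue_iff hν0 hν1, hplus hE, hminus hE]
  have p1 : ¬ ∃ E ∈ Set.Ioo 0 (besselZero (-ν) 1 ^ 2), CondPlus ν E := by
    rintro ⟨E, hE, hc⟩
    exact normBessel_ne_of_lt_first hν0 hν1 hE ((hplus hE.1).1 hc)
  have p2 : ∀ n : ℕ, 1 ≤ n →
      ¬ ∃ E ∈ Set.Icc (besselZero (-ν) n ^ 2) (besselZero ν n ^ 2), CondPlus ν E := by
    rintro n hn ⟨E, hE, hc⟩
    exact mul_normBessel_ne_of_mem_Icc hν0 hν1 one_pos hn hE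
      ((hplus ((hapos n hn).trans_le hE.1)).1 hc)
  have p3 : ∀ n : ℕ, 1 ≤ n →
      ∃! E : ℝ, E ∈ Set.Ioo (besselZero ν n ^ 2) (besselZero (-ν) (n + 1) ^ 2) ∧
        CondPlus ν E := fun n hn =>
    unique_congr (fun s hs => (hplus (pos_of_gt hs.1)).symm)
      (existsUnique_mul_normBessel_eq hν0 hν1 one_pos le_rfl hn)
  have m1 : ν < 1 / 2 → ∃! E : ℝ, E ∈ Set.Ioo 0 (besselZero (-ν) 1 ^ 2) ∧ CondMinus ν E := fun h =>
    unique_congr (fun s hs => (hminus hs.1).symm)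
      (existsUnique_mul_normBessel_eq_first hν0 hν1 (hκpos h).1 (hκpos h).2)
  have m2 : ν < 1 / 2 → ∀ n : ℕ, 1 ≤ n →
      ¬ ∃ E ∈ Set.Icc (besselZero (-ν) n ^ 2) (besselZero ν n ^ 2), CondMinus ν E := by
    rintro h n hn ⟨E, hE, hc⟩
    exact mul_normBessel_ne_of_mem_Icc hν0 hν1 (hκpos h).1 hn hE
      ((hminus ((hapos n hn).trans_le hE.1)).1 hc)
  have m3 : ν < 1 / 2 → ∀ n : ℕ, 1 ≤ n →
      ∃! E : ℝ, E ∈ Set.Ioo (besselZero ν n ^ 2) (besselZero (-ν) (n + 1) ^ 2) ∧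
        CondMinus ν E := fun h n hn =>
    unique_congr (fun s hs => (hminus (pos_of_gt hs.1)).symm)
      (existsUnique_mul_normBessel_eq hν0 hν1 (hκpos h).1 (hκpos h).2.le hn)
  have m4 : 1 / 2 < ν → ¬ ∃ E ∈ Set.Ioc 0 (besselZero (-ν) 1 ^ 2), CondMinus ν E := by
    rintro h ⟨E, hE, hc⟩
    exact mul_normBessel_ne_first hν0 hν1 (hκneg h) hE ((hminus hE.1).1 hc)
  have m5 : 1 / 2 < ν → ∀ n : ℕ, 1 ≤ n →
      ∃! E : ℝ, E ∈ Set.Ioo (besselZero (-ν) n ^ 2) (besselZero ν n ^ 2) ∧ CondMinus ν E :=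
    fun h n hn => unique_congr (fun s hs => (hminus (pos_of_gt hs.1)).symm)
      (existsUnique_mul_normBessel_eq_of_neg hν0 hν1 (hκneg h) hn)
  have m6 : 1 / 2 < ν → ∀ n : ℕ, 1 ≤ n →
      ¬ ∃ E ∈ Set.Icc (besselZero ν n ^ 2) (besselZero (-ν) (n + 1) ^ 2), CondMinus ν E := by
    rintro h n hn ⟨E, hE, hc⟩
    exact mul_normBessel_ne_of_mem_Icc_of_neg hν0 hν1 (hκneg h) hn hE
      ((hminus ((besselZero_sq_pos hν0 hν1 hn).1.trans_le hE.1)).1 hc)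
  have hκ0 : ν = 1 / 2 → κ = 0 := fun h => by rw [hκ, h]; norm_num
  have m7 : ν = 1 / 2 → ∀ n : ℕ, 1 ≤ n → CondMinus ν (besselZero (-ν) n ^ 2) := by
    intro h n hn
    rw [hminus (hapos n hn), hκ0 h, zero_mul, hmz.1 n hn]
  have m8 : ν = 1 / 2 →
      ∀ E : ℝ, 0 < E → (∀ n : ℕ, 1 ≤ n → E ≠ besselZero (-ν) n ^ 2) → ¬ CondMinus ν E := by
    intro h E hE hne hc
    rw [hminus hE, hκ0 h, zero_mul] at hc
    obtain ⟨n, hn, hnE⟩ := hmz.2 E hE hc.symm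
    exact hne n hn hnE.symm
  refine ⟨?_, eig, p1, p2, p3, fun h => ⟨m1 h, m2 h, m3 h⟩, fun h => ⟨m4 h, m5 h, m6 h⟩,
    fun h => ⟨m7 h, m8 h⟩, ?_⟩
  · rintro μ (rfl | rfl)
    · exact besselZero_strictMono_and_image (by linarith) hν1 hnz
    · exact besselZero_strictMono_and_image (by linarith) (by linarith) (by linarith)
  -- a common choice of the odd-indexed eigenvalues in the three cases
  obtain ⟨em, hem, hlt, hgt, hrange, hcase⟩ : ∃ em : ℕ → ℝ, (∀ n, CondMinus ν (em n)) ∧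
      -- Either way `em n` lies beyond the n-th even eigenvalue: it is past the whole gap (ν ≥ 1/2),
      -- or it exceeds every solution of (+) in that gap (ν < 1/2). Positivity covers n = 0, where
      -- the even eigenvalue is 0.
      (∀ n, besselZero (-ν) (n + 1) ^ 2 ≤ em n ∨
        (∀ x ∈ Set.Ioo (besselZero ν n ^ 2) (besselZero (-ν) (n + 1) ^ 2),
          CondPlus ν x → x < em n) ∧ 0 < em n) ∧
      (∀ n, em n < besselZero ν (n + 1) ^ 2) ∧
      (∀ E, 0 < E → CondMinus ν E → E ∈ Set.range em) ∧
      ((ν < 1 / 2 → em 0 ∈ Set.Ioo 0 (besselZero (-ν) 1 ^ 2) ∧ ∀ n : ℕ, 1 ≤ n →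
          em n ∈ Set.Ioo (besselZero ν n ^ 2) (besselZero (-ν) (n + 1) ^ 2)) ∧
        (1 / 2 < ν → ∀ n : ℕ,
          em n ∈ Set.Ioo (besselZero (-ν) (n + 1) ^ 2) (besselZero ν (n + 1) ^ 2)) ∧
        (ν = 1 / 2 → ∀ n : ℕ, em n = besselZero (-ν) (n + 1) ^ 2)) := by
    rcases lt_trichotomy ν (1 / 2) with h | h | h
    · have hb0 : besselZero ν 0 ^ 2 = 0 := by simp [besselZero]
      have hex : ∀ n : ℕ, ∃! E : ℝ,
          E ∈ Set.Ioo (besselZero ν n ^ 2) (besselZero (-ν) (n + 1) ^ 2) ∧ CondMinus ν E := by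
        intro n
        rcases Nat.eq_zero_or_pos n with rfl | hn
        · rw [hb0]; exact m1 h
        · exact m3 h n hn
      choose em hem huniq using hex
      refine ⟨em, fun n => (hem n).2, fun n => Or.inr ⟨fun x hx hc => ?_, pos_of_gt (hem n).1.1⟩,
        fun n => (hem n).1.2.trans (hil n).2, fun E hE hc => ?_,
        fun _ => ⟨hb0 ▸ (hem 0).1, fun n _ => (hem n).1⟩, fun h' => absurd h h'.not_gt,
        fun h' => absurd h h'.not_lt⟩
      · have hx' := (hplus (pos_of_gt hx.1)).1 hc
        have he' := (hminus (pos_of_gt (hem n).1.1)).1 (hem n).2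
        -- Equality would make x solve both equations, so κ P = P with P ≠ 0, contrary to κ < 1.
        refine lt_of_le_of_ne (le_of_mul_normBessel_eq hν0 hν1 (hκpos h).1 one_pos le_rfl
          (hκpos h).2.le hx (hem n).1 hx' he') fun heq => ?_
        rw [← heq, ← hx'] at he'
        have hP : normBessel ν x ≠ 0 := fun h0 =>
          normBessel_neg_ne_zero_of_mem_Ioo hν0 hν1 hx (by rw [← hx', h0, mul_zero])
        exact (hκpos h).2.ne (mul_right_cancel₀ hP he')
      · rcases positive_cases hν0 hν1 hE with h1 | ⟨n, hn, h1 | h1⟩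
        · exact ⟨0, (huniq 0 E ⟨by rw [hb0]; exact ⟨hE, h1⟩, hc⟩).symm⟩
        · exact absurd ⟨E, h1, hc⟩ (m2 h n hn)
        · exact ⟨n, (huniq n E ⟨h1, hc⟩).symm⟩
    · refine ⟨fun n => besselZero (-ν) (n + 1) ^ 2, fun n => m7 h _ (by omega),
        fun n => Or.inl le_rfl, fun n => (hil n).2, fun E hE hc => ?_,
        fun h' => absurd h h'.ne, fun h' => absurd h h'.ne', fun _ n => rfl⟩
      rw [hminus hE, hκ0 h, zero_mul] at hc
      obtain ⟨n, hn, hnE⟩ := hmz.2 E hE hc.symm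
      exact ⟨n - 1, by simp only [Nat.sub_add_cancel hn, hnE]⟩
    · choose em hem huniq using fun n : ℕ => m5 h (n + 1) (by omega)
      refine ⟨em, fun n => (hem n).2, fun n => Or.inl (hem n).1.1.le, fun n => (hem n).1.2,
        fun E hE hc => ?_, fun h' => absurd h h'.not_gt, fun _ n => (hem n).1,
        fun h' => absurd h h'.not_gt⟩
      rcases positive_cases hν0 hν1 hE with h1 | ⟨n, hn, h1 | h1⟩
      · exact absurd ⟨E, ⟨hE, h1.le⟩, hc⟩ (m4 h)
      · have h2 : E ∈ Set.Ioo (besselZero (-ν) n ^ 2) (besselZero ν n ^ 2) := by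
          refine ⟨lt_of_le_of_ne h1.1 ?_, lt_of_le_of_ne h1.2 ?_⟩
          -- The endpoints belong to the closed sets already shown to contain no solution of (-).
          · rintro rfl
            obtain ⟨m, rfl⟩ := Nat.exists_eq_add_of_le' hn
            cases m with
            | zero => exact m4 h ⟨_, ⟨hE, le_rfl⟩, hc⟩
            | succ m => exact m6 h (m + 1) (by omega) ⟨_, ⟨(hil _).1.le, le_rfl⟩, hc⟩
          · rintro rfl
            exact m6 h n hn ⟨_, ⟨le_rfl, (hil n).1.le⟩, hc⟩
        obtain ⟨m, rfl⟩ := Nat.exists_eq_add_of_le' hn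
        exact ⟨m, (huniq m E ⟨h2, hc⟩).symm⟩
      · exact absurd ⟨E, ⟨h1.1.le, h1.2.le⟩, hc⟩ (m6 h n hn)
  have hepos : ∀ n, 0 < em n := fun n =>
    (hlt n).elim (fun h => (hapos _ (by omega)).trans_le h) fun h => h.2
  obtain ⟨ep, hep0, hep⟩ : ∃ ep : ℕ → ℝ, ep 0 = 0 ∧ ∀ n, 1 ≤ n →
      (ep n ∈ Set.Ioo (besselZero ν n ^ 2) (besselZero (-ν) (n + 1) ^ 2) ∧ CondPlus ν (ep n)) ∧
      ∀ E, E ∈ Set.Ioo (besselZero ν n ^ 2) (besselZero (-ν) (n + 1) ^ 2) ∧ CondPlus ν E →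
        E = ep n := by
    choose ep hep using fun n : ℕ => p3 (n + 1) (by omega)
    -- Index 0 is reserved for the eigenvalue 0, which lies in none of the gaps.
    refine ⟨fun n => Nat.casesOn n 0 ep, rfl, fun n hn => ?_⟩
    obtain ⟨m, rfl⟩ := Nat.exists_eq_add_of_le' hn
    exact hep m
  obtain ⟨ev, hev, hev', hmono, hr⟩ := exists_strictMono_interleave (p := ep) (m := em)
    (fun n => by
      rcases Nat.eq_zero_or_pos n with rfl | hn
      · rw [hep0]; exact hepos 0
      · obtain ⟨⟨h1, h2⟩, -⟩ := hep n hn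
        exact (hlt n).elim (fun h => h1.2.trans_le h) fun h => h.1 _ h1 h2)
    (fun n => (hgt n).trans (hep (n + 1) (by omega)).1.1.1)
  have hpred : ∀ n, 1 ≤ n → ev (2 * n - 1) = em (n - 1) := fun n hn => by
    rw [← hev', show 2 * (n - 1) + 1 = 2 * n - 1 by omega]
  refine ⟨ev, (hev 0).trans hep0, fun n hn => hev n ▸ (hep n hn).1, fun n => hev' n ▸ hem n,
    fun h => ⟨hev' 0 ▸ (hcase.1 h).1, fun n hn => hev' n ▸ (hcase.1 h).2 n hn⟩,
    fun h n hn => ?_, fun h n hn => ?_, hmono, ?_⟩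
  · have := hcase.2.1 h (n - 1)
    rwa [hpred n hn, ← Nat.sub_add_cancel hn, Nat.add_sub_cancel]
  · rw [hpred n hn, hcase.2.2 h, Nat.sub_add_cancel hn]
  rw [hr]
  refine Set.Subset.antisymm ?_ fun E hE => ?_
  · rintro _ (⟨n, rfl⟩ | ⟨n, rfl⟩)
    · rcases Nat.eq_zero_or_pos n with rfl | hn
      · rw [hep0]; exact isEigenvalue_zero hν0 hν1
      · obtain ⟨⟨h1, h2⟩, -⟩ := hep n hn
        exact (eig _ (pos_of_gt h1.1)).2 (Or.inl h2)
    · exact (eig _ (hepos n)).2 (Or.inr (hem n))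
  · rcases lt_trichotomy E 0 with h | rfl | h
    · exact absurd hE (not_isEigenvalue_of_neg hν0 hν1 h)
    · exact Or.inl ⟨0, hep0⟩
    · rcases (eig E h).1 hE with hc | hc
      · rcases positive_cases hν0 hν1 h with h1 | ⟨n, hn, h1 | h1⟩
        · exact absurd ⟨E, ⟨h, h1⟩, hc⟩ p1
        · exact absurd ⟨E, h1, hc⟩ (p2 n hn)
        · exact Or.inl ⟨n, ((hep n hn).2 E ⟨h1, hc⟩).symm⟩
      · exact Or.inr (hrange E h hc)
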